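/- **Setting.** Let $W\ge 1$ be the number of channels. A schedule $S$ assigns to each time slot $t=0,1,2,\dots$ and each channel $k\in\{1,\dots,W\}$ at most one message $S(t,k)$. Every message $i$ has a request probability $p_i\ge 0$ and a broadcast cost $c_i\ge 0$. For $n\ge1$ let $\mathrm{ERT}(S_n)=\sum_i p_i w_i$, where $w_i$ is the mean time that a request for $i$, made at a uniformly random instant of $[0,n]$, waits until the next beginning of a broadcast of $i$ (on any channel) or until time $n$, whichever comes first. Let $\mathrm{BC}(S_n)$ be the total cost of all broadcasts in the first $n$ time slots, divided by $n$, and $$\mathrm{COST}(S)=\limsup_{n\to\infty}\bigl(\mathrm{ERT}(S_n)+\mathrm{BC}(S_n)\bigr)\in[0,\infty].$$ $\mathrm{OPT}(M)$ is the infimum of $\mathrm{COST}(S)$ over all schedules $S$ of the message set $M$ on $W$ channels. $\mathrm{COST}(S,A)$ is the cost of a schedule of the messages of $A$ only (with their given probabilities, which need not sum to $1$). The density of a periodic schedule is the fraction of its $W\cdot P$ slots in one period $P$ that are occupied. The message set is a disjoint union $A\cup B$, and the probabilities of all its messages sum to $1$. The set $A$ is finite and non-empty, with costs at most $C$. The set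 $B$ is partitioned into finitely many groups $G_1,\dots,G_q$ ($q\ge 0$); the $g_j\ge1$ messages of $G_j$ all have the same probability $p_j>0$ and the same cost $c_j\ge0$. Let $0<\varepsilon<1/7$, $$T(\varepsilon)=\frac{40\ln(1+4/\varepsilon)}{\varepsilon^4(1-\varepsilon/6)}\max(C,1),\qquad \kappa(\varepsilon)=\frac{2W\,T(\varepsilon)}{\varepsilon},\qquad N=\lfloor T(\varepsilon)|A|^2\rfloor ,$$ and assume $g_j\ge\kappa(\varepsilon)|A|^2$ for all $j$. For $\beta>0$ let $$\mathrm{LB}(B,\beta)=\inf\Bigl\{\sum_{j=1}^q\Bigl(\frac{p_jg_j^2\tau_j}{2}+\frac{c_j}{\tau_j}\Bigr)\;:\;\tau_1,\dots,\tau_q>0,\ \sum_{j=1}^q\frac1{\tau_j}\le\beta W\Bigr\}.$$ **Algorithm.** 1. For $x=1,\dots,WN-1$ let $S_\alpha$, with $\alpha=x/(WN)$, be a schedule of $A$ of least cost among all periodic schedules of $A$ on $W$ channels with density $\alpha$ and a period at most $N$. 2. Choose $\alpha_0$ among these densities so that $\mathrm{COST}(S_{\alpha_0},A)+\mathrm{LB}(B,1-\alpha_0)$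 is least, and let $\tau^*$ be a minimizer in $\mathrm{LB}(B,1-\alpha_0)$. 3. Broadcast $A$ as in $S_{\alpha_0}$. For each slot left empty by $S_{\alpha_0}$, in order of time and, within a time slot, of channels, draw independently the group $G_j$ with probability $1/(\tau^*_j(1-\alpha_0)W)$, and no group with the remaining probability. If $G_j$ is drawn, broadcast in this slot the next message of $G_j$ in cyclic (round-robin) order; if no group is drawn, leave the slot empty. **Claim.** The algorithm is well defined (all the objects in steps 1 and 2 exist), and, whatever choices are made among equally good $S_\alpha$, $\alpha_0$ and $\tau^*$, the random schedule $S$ that it produces satisfies $$\mathbb E[\mathrm{COST}(S)]\le(1+5\varepsilon)\,\mathrm{OPT}(A\cup B).$$ -/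

import Mathlib

open scoped ENNReal

noncomputable section

namespace DataBroadcast

/-! ### Schedules and their cost -/

/-- An infinite schedule on `W` channels of messages from `M`: `S t k` is the message broadcast
in time slot `t` on channel `k`, with `none` for an empty slot. -/
abbrev Schedule (W : ℕ) (M : Type) : Type := ℕ → Fin W → Option M

section General

variable {W : ℕ} {M : Type}

/-- Message `i` is broadcast, on some channel, in time slot `t`. -/
def Broadcasts (S : Schedule W M) (t : ℕ) (i : M) : Prop := ∃ k, S t k = some i

/-- For `t < n`: the first time after the beginning of slot `t` at which a broadcast of `i`
begins, or the end `n` of the schedule restricted to its first `n` slots, whichever comes first. -/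
def nextStart (S : Schedule W M) (n t : ℕ) (i : M) : ℕ :=
  sInf {s : ℕ | t < s ∧ (Broadcasts S s i ∨ n ≤ s)}

/-- The mean waiting time of a request for `i` that is made at a uniformly random instant of slot
`t`, i.e. of the real interval `[t, t + 1]`, and that waits until `nextStart S n t i`. -/
def meanWait (S : Schedule W M) (n t : ℕ) (i : M) : ℝ := (nextStart S n t i : ℝ) - t - 1 / 2

/-- `meanWait` is what its description says. -/
theorem integral_wait (S : Schedule W M) (n t : ℕ) (i : M) :
    ∫ r in (t : ℝ)..(t + 1), ((nextStart S n t i : ℝ) - r) = meanWait S n t i := by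
  rw [intervalIntegral.integral_sub (by simp) (by simp), integral_id]
  simp only [meanWait, intervalIntegral.integral_const, smul_eq_mul]
  ring

/-- Expected response time of the first `n` slots of `S`; `p i` is the request probability. -/
def finERT [Fintype M] (p : M → ℝ) (S : Schedule W M) (n : ℕ) : ℝ :=
  (∑ i, p i * ∑ t ∈ Finset.range n, meanWait S n t i) / n

/-- Broadcast cost of the first `n` slots of `S`; `c i` is the cost of one broadcast of `i`. -/
def finBC (c : M → ℝ) (S : Schedule W M) (n : ℕ) : ℝ :=
  (∑ t ∈ Finset.range n, ∑ k, (S t k).elim 0 c) / n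

/-- Fraction of the `W * n` slots of the first `n` time slots that are occupied. -/
def finDensity (S : Schedule W M) (n : ℕ) : ℝ :=
  (∑ t ∈ Finset.range n, ∑ k, (S t k).elim (0 : ℝ) (fun _ => 1)) / (W * n)

/-- Cost of the infinite schedule `S`: the upper limit of the costs of its finite restrictions. -/
def cost [Fintype M] (p c : M → ℝ) (S : Schedule W M) : ℝ≥0∞ :=
  Filter.limsup (fun n : ℕ => ENNReal.ofReal (finERT p S n + finBC c S n)) Filter.atTop

/-- The optimal cost over all infinite schedules on `W` channels. -/
def opt (W : ℕ) [Fintype M] (p c : M → ℝ) : ℝ≥0∞ := ⨅ S : Schedule W M, cost p c S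

/-- `S` is periodic with some period `P ≤ N` and has density `α` (the density of a periodic
schedule is the density of one period). -/
def IsPeriodicWithDensity (N : ℕ) (α : ℝ) (S : Schedule W M) : Prop :=
  ∃ P : ℕ, 1 ≤ P ∧ P ≤ N ∧ (∀ t, S (t + P) = S t) ∧ finDensity S P = α

/-- `S` has least cost among the schedules of density `α` with a period `≤ N`. -/
def IsOptimalPeriodic [Fintype M] (p c : M → ℝ) (N : ℕ) (α : ℝ) (S : Schedule W M) : Prop :=
  IsPeriodicWithDensity N α S ∧
    ∀ S' : Schedule W M, IsPeriodicWithDensity N α S' → cost p c S ≤ cost p c S'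

end General

/-! ### The input: important messages `A` and large groups `B` -/

/-- A message set `A ∪ B`: `A` has `a` messages with individual probabilities and costs, and `B`
consists of `q` groups, all `g j` messages of group `j` having probability `pB j` and cost `cB j`.
The probabilities of all messages add up to `1`. -/
structure Input where
  a : ℕ
  q : ℕ
  g : Fin q → ℕ
  pA : Fin a → ℝ
  cA : Fin a → ℝ
  pB : Fin q → ℝ
  cB : Fin q → ℝ
  g_pos : ∀ j, 0 < g j
  pA_nonneg : ∀ i, 0 ≤ pA i
  cA_nonneg : ∀ i, 0 ≤ cA i
  pB_pos : ∀ j, 0 < pB j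
  cB_nonneg : ∀ j, 0 ≤ cB j
  sum_prob : ∑ i, pA i + ∑ j, (g j : ℝ) * pB j = 1

namespace Input

variable (I : Input)

/-- The messages of `A ∪ B`; `Sum.inr ⟨j, k⟩` is the message number `k` of group `j`. -/
abbrev Msg : Type := Fin I.a ⊕ (Σ j : Fin I.q, Fin (I.g j))

/-- Request probability of a message of `A ∪ B`. -/
def prob : I.Msg → ℝ := Sum.elim I.pA (fun m => I.pB m.1)

/-- Broadcast cost of a message of `A ∪ B`. -/
def bcost : I.Msg → ℝ := Sum.elim I.cA (fun m => I.cB m.1)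

/-- Objective of the Ammar-Wong relaxation for `B`; group `j` is broadcast every `τ j` time
units. -/
def lbObj (τ : Fin I.q → ℝ) : ℝ :=
  ∑ j, (I.pB j * (I.g j : ℝ) ^ 2 * τ j / 2 + I.cB j / τ j)

/-- Feasible points of the relaxation when `B` gets a fraction `β` of the slots of `W` channels. -/
def lbFeasible (W : ℕ) (β : ℝ) : Set (Fin I.q → ℝ) :=
  {τ | (∀ j, 0 < τ j) ∧ ∑ j, 1 / τ j ≤ β * W}

/-- The value `LB(B, β)` of the relaxation. -/
def lb (W : ℕ) (β : ℝ) : ℝ := sInf (I.lbObj '' I.lbFeasible W β)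

end Input

/-! ### The constants -/

/-- `T(ε) = 40 ln(1 + 4/ε) / (ε⁴ (1 - ε/6)) · max(C, 1)`. -/
def boundT (C ε : ℝ) : ℝ :=
  40 * Real.log (1 + 4 / ε) / (ε ^ 4 * (1 - ε / 6)) * max C 1

/-- `κ(ε) = 2 W T(ε) / ε`. -/
def kappa (W : ℕ) (C ε : ℝ) : ℝ := 2 * W * boundT C ε / ε

/-- The bound `T(ε) |A|²` for the periods, rounded down to an integer. -/
def periodBound (C ε : ℝ) (a : ℕ) : ℕ := ⌊boundT C ε * (a : ℝ) ^ 2⌋₊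

/-! ### The algorithm -/

/-- The result of the deterministic first phase of the algorithm, with period bound `N`:
best schedules `sched x` of `A` at each density `x / (W N)`, `x = 1, …, W N - 1`, the choice `x₀`
of the density, and an optimal solution `τ` of the relaxation for the remaining slots. -/
structure Phase1 (I : Input) (W N : ℕ) where
  sched : ℕ → Schedule W (Fin I.a)
  sched_optimal : ∀ x, 1 ≤ x → x < W * N →
    IsOptimalPeriodic I.pA I.cA N ((x : ℝ) / (W * N)) (sched x)
  x₀ : ℕ
  one_le_x₀ : 1 ≤ x₀
  x₀_lt : x₀ < W * N
  x₀_best : ∀ x, 1 ≤ x → x < W * N →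
    cost I.pA I.cA (sched x₀) + ENNReal.ofReal (I.lb W (1 - (x₀ : ℝ) / (W * N))) ≤
      cost I.pA I.cA (sched x) + ENNReal.ofReal (I.lb W (1 - (x : ℝ) / (W * N)))
  τ : Fin I.q → ℝ
  τ_feasible : τ ∈ I.lbFeasible W (1 - (x₀ : ℝ) / (W * N))
  τ_optimal : IsMinOn I.lbObj (I.lbFeasible W (1 - (x₀ : ℝ) / (W * N))) τ

instance instMeasurableSpaceDraw (q : ℕ) : MeasurableSpace (Option (Fin q)) := ⊤

namespace Phase1

variable {I : Input} {W N : ℕ} (R : Phase1 I W N)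

/-- The chosen density `α₀` of `A`. -/
def α₀ : ℝ := (R.x₀ : ℝ) / (W * N)

/-- The chosen schedule of `A`. -/
def schedA : Schedule W (Fin I.a) := R.sched R.x₀

/-- The rate `(1 - α₀) W - ∑ j, 1 / τ j` of the dummy group, which stands for staying idle. -/
def dummyRate : ℝ := (1 - R.α₀) * W - ∑ j, 1 / R.τ j

/-- Probability of drawing group `j` (`some j`), or the dummy group (`none`), for an empty slot. -/
def drawProb : Option (Fin I.q) → ℝ
  | some j => 1 / (R.τ j * ((1 - R.α₀) * W))
  | none => R.dummyRate / ((1 - R.α₀) * W)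

theorem freeRate_pos : 0 < (1 - R.α₀) * (W : ℝ) := by
  have h : 0 < W * N := lt_of_le_of_lt (Nat.zero_le _) R.x₀_lt
  have hW : 0 < (W : ℝ) := by exact_mod_cast Nat.pos_of_mul_pos_right h
  have hWN : 0 < (W : ℝ) * N := by exact_mod_cast h
  have hx : (R.x₀ : ℝ) < W * N := by exact_mod_cast R.x₀_lt
  have : R.α₀ < 1 := by rw [α₀, div_lt_one hWN]; exact hx
  exact mul_pos (by linarith) hW

theorem drawProb_nonneg (o : Option (Fin I.q)) : 0 ≤ R.drawProb o := by
  have h := R.freeRate_pos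
  cases o with
  | none =>
    have h2 : ∑ j, 1 / R.τ j ≤ (1 - R.α₀) * W := R.τ_feasible.2
    exact div_nonneg (by simp only [dummyRate]; linarith) h.le
  | some j =>
    have h2 : 0 < R.τ j := R.τ_feasible.1 j
    simp only [drawProb]
    positivity

theorem drawProb_sum : ∑ o, R.drawProb o = 1 := by
  have h := R.freeRate_pos
  rw [Fintype.sum_option]
  simp only [drawProb, dummyRate]
  have e : ∀ j, 1 / (R.τ j * ((1 - R.α₀) * W)) = 1 / R.τ j / ((1 - R.α₀) * W) := fun j => by
    rw [div_div]
  rw [Finset.sum_congr rfl (fun j _ => e j), ← Finset.sum_div, ← add_div, sub_add_cancel,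
    div_self h.ne']

/-- The distribution of one draw. -/
def draw : PMF (Option (Fin I.q)) :=
  PMF.ofFintype (fun o => ENNReal.ofReal (R.drawProb o)) (by
    rw [← ENNReal.ofReal_sum_of_nonneg (fun o _ => R.drawProb_nonneg o), R.drawProb_sum,
      ENNReal.ofReal_one])

/-- Independent draws, one for each slot (time, channel); only those for empty slots are used. -/
def drawMeasure : MeasureTheory.Measure (ℕ × Fin W → Option (Fin I.q)) :=
  MeasureTheory.Measure.infinitePi (fun _ => R.draw.toMeasure)

/-- The number of empty slots of `schedA` before slot `(t, k)`, in the order of time and, at the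
same time, of the channels, for which group `j` has been drawn. -/
def drawCount (X : ℕ × Fin W → Option (Fin I.q)) (j : Fin I.q) (t : ℕ) (k : Fin W) : ℕ :=
  ((Finset.range (t + 1) ×ˢ (Finset.univ : Finset (Fin W))).filter
    (fun s => (s.1 < t ∨ s.2 < k) ∧ R.schedA s.1 s.2 = none ∧ X s = some j)).card

/-- The schedule produced from the draws `X`: `A` is scheduled as in `schedA`, and an empty slot
receives the next message, in cyclic order, of the group drawn for it. -/
def output (X : ℕ × Fin W → Option (Fin I.q)) : Schedule W I.Msg := fun t k =>
  match R.schedA t k with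
  | some i => some (Sum.inl i)
  | none =>
    match X (t, k) with
    | none => none
    | some j => some (Sum.inr ⟨j, ⟨R.drawCount X j t k % I.g j, Nat.mod_lt _ (I.g_pos j)⟩⟩)

/-- The expected cost of the random schedule produced by the algorithm. -/
def expectedCost : ℝ≥0∞ :=
  MeasureTheory.lintegral R.drawMeasure (fun X => cost I.prob I.bcost (R.output X))

end Phase1

end DataBroadcast

end

/-! Both halves of the proof compare a cost with the quantity minimized in step 2, the cost of a
periodic schedule of `A` of density `α` plus `LB(B, 1 - α)`.

Upper half (`Phase1.expectedCost_le`): almost surely the output costs at most the cost of `schedA`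
plus `(1 + η)` times the relaxation value, with `η = 11 ε / 10`. The total waiting time of a message
in `n` slots is half the number of ordered pairs of slots not separated by a broadcast
(`sum_meanWait`). In a group served round-robin, the number of messages not broadcast in the time
slots `(t, s]` is at most the number of draws that are missing there from `g`. The expected shortage
of a binomial variable sums to `P g + τ g (g + 1) / 2`, where `P` is the period of `schedA`
(`sum_missing_le`). As `P ≤ N` and `g` is large, this is at most `(1 + η) τ g ^ 2 / 2`. Expectations
become almost sure bounds by a law of large numbers (`ae_eventually_mean_le`): the covariances of
the age sums decay because a full round of draws erases the past (`shortage_le_mul`).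

Lower half (`Input.exists_candidate`): a long prefix of any schedule `S` of `A ∪ B` yields a
schedule of `A` of period `N` whose cost plus relaxation value is at most `1 + 3 ε` times the mean
cost of the prefix, up to an arbitrarily small error. The prefix is cut into `Q` windows of length
`m = r h + s`. Inserting one empty time slot into each of `r` runs of `h` slots multiplies the
waiting pairs by at most `(h + 3) / h`, averaged over the place of insertion
(`sum_pairs_stretched_le`). The new period consists of `h + 1` stretched windows, each followed by
one broadcast of every message of `A`; these short lumps keep waiting times from reaching from one
window into another (`pairs_windows_le`). The chosen windows have to be good on average both in cost
and in occupancy; a mixture of two candidates achieves this up to an occupancy error of one window,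
`W m` slots (`exists_mixture`). The inserted slots of all `h + 1` windows outweigh this error, so
`B` keeps the room that it had in `S`. By Cauchy-Schwarz, what `S` pays for `B` is at least the
relaxation value, up to the factor `N / ((h + 1) m)` and vanishing terms (`Input.lb_le_totalB`).

Finally `(1 + 11 ε / 10) (1 + 3 ε) ≤ 1 + 5 ε`. -/

noncomputable section

namespace DataBroadcast

open Finset

/-! ### Waiting times as numbers of pairs of slots -/

/-- The number of `u < n` with `P u`. -/
def cnt (P : ℕ → Prop) (n : ℕ) : ℕ := @Nat.count P (Classical.decPred P) n

theorem cnt_zero (P : ℕ → Prop) : cnt P 0 = 0 := by simp [cnt]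

open Classical in
theorem cnt_succ (P : ℕ → Prop) (n : ℕ) : cnt P (n + 1) = cnt P n + if P n then 1 else 0 := by
  unfold cnt
  rw [Nat.count_succ]

theorem cnt_mono (P : ℕ → Prop) : Monotone (cnt P) := by
  intro a b h
  unfold cnt
  exact @Nat.count_monotone P (Classical.decPred P) a b h

theorem cnt_add (P : ℕ → Prop) (a b : ℕ) :
    cnt P (a + b) = cnt P a + cnt (fun u => P (a + u)) b := by
  unfold cnt
  rw [Nat.count_add]

theorem cnt_strict {P : ℕ → Prop} {u n : ℕ} (hu : P u) (h : u < n) : cnt P u < cnt P n := by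
  unfold cnt
  exact @Nat.count_strict_mono P (Classical.decPred P) u n hu h

theorem exists_of_cnt_lt {P : ℕ → Prop} {a b : ℕ} (h : cnt P a < cnt P b) :
    ∃ u, a ≤ u ∧ u < b ∧ P u := by
  unfold cnt at h
  obtain ⟨u, hu, hp⟩ := @Nat.exists_of_count_lt_count P (Classical.decPred P) a b h
  exact ⟨u, hu.1, hu.2, hp⟩

theorem cnt_eq_iff {P : ℕ → Prop} {a b : ℕ} (hab : a ≤ b) :
    cnt P a = cnt P b ↔ ∀ u, a ≤ u → u < b → ¬ P u := by
  constructor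
  · intro h u h1 h2 h3
    have := cnt_strict h3 h2
    have := cnt_mono P h1
    omega
  · intro h
    by_contra hne
    obtain ⟨u, h1, h2, h3⟩ := exists_of_cnt_lt (lt_of_le_of_ne (cnt_mono P hab) hne)
    exact h u h1 h2 h3

/-- The number of ordered pairs of slots below `n` with no `P`-slot after the earlier one up to
the later one. -/
def pairs (P : ℕ → Prop) (n : ℕ) : ℕ :=
  ((range n ×ˢ range n).filter (fun x => cnt P (x.1 + 1) = cnt P (x.2 + 1))).card

theorem pairs_mono (P : ℕ → Prop) : Monotone (pairs P) := by
  intro a b h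
  apply card_le_card
  intro x
  simp only [mem_filter, mem_product, mem_range]
  omega

theorem le_pairs (P : ℕ → Prop) (n : ℕ) : n ≤ pairs P n := by
  have : ((range n).image (fun t => (t, t))).card = n := by
    rw [card_image_of_injective _ (fun a b h => (Prod.mk.inj h).1), card_range]
  refine this.symm.le.trans (card_le_card ?_)
  intro x
  simp only [mem_image, mem_filter, mem_product, mem_range]
  rintro ⟨t, ht, rfl⟩
  exact ⟨⟨ht, ht⟩, rfl⟩

theorem pairs_eq_sum (P : ℕ → Prop) (n : ℕ) :
    pairs P n = ∑ t ∈ range n, ∑ s ∈ range n, if cnt P (t + 1) = cnt P (s + 1) then 1 else 0 := by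
  unfold pairs
  rw [card_filter, sum_product]

/-- By symmetry, the pairs with `t ≤ s` and those with `s ≤ t` are equally many; together they count
the `n` diagonal pairs twice. -/
theorem pairs_add_eq (P : ℕ → Prop) (n : ℕ) :
    pairs P n + n = 2 * ∑ t ∈ range n,
      ((range n).filter (fun s => t ≤ s ∧ cnt P (t + 1) = cnt P (s + 1))).card := by
  have h1 : ∀ t ∈ range n, (∑ s ∈ range n, if cnt P (t + 1) = cnt P (s + 1) then 1 else 0) + 1 =
      (∑ s ∈ range n, if t ≤ s ∧ cnt P (t + 1) = cnt P (s + 1) then 1 else 0) +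
      ∑ s ∈ range n, if s ≤ t ∧ cnt P (t + 1) = cnt P (s + 1) then 1 else 0 := by
    intro t ht
    have : (1 : ℕ) = ∑ s ∈ range n, if s = t then 1 else 0 := by
      rw [sum_ite_eq' (range n) t, if_pos ht]
    rw [congrArg (HAdd.hAdd _) this, ← sum_add_distrib, ← sum_add_distrib]
    apply sum_congr rfl
    intro s _
    rcases lt_trichotomy s t with h | h | h
    · simp [h.le, h.not_ge, h.ne]
    · subst h; simp
    · simp [h.le, h.not_ge, h.ne']
  have h2 : pairs P n + n = ∑ t ∈ range n,
      ((∑ s ∈ range n, if cnt P (t + 1) = cnt P (s + 1) then 1 else 0) + 1) := by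
    rw [sum_add_distrib, ← pairs_eq_sum]; simp
  rw [h2, sum_congr rfl h1, sum_add_distrib, two_mul]
  have h3 : (∑ t ∈ range n, ∑ s ∈ range n, if s ≤ t ∧ cnt P (t + 1) = cnt P (s + 1) then 1 else 0)
      = ∑ t ∈ range n, ∑ s ∈ range n, if t ≤ s ∧ cnt P (t + 1) = cnt P (s + 1) then 1 else 0 := by
    rw [sum_comm]
    apply sum_congr rfl; intro s _; apply sum_congr rfl; intro t _
    simp only [eq_comm]
  rw [h3]
  simp only [card_filter]

section General

variable {W : ℕ} {M : Type}

theorem nextStart_filter (S : Schedule W M) (i : M) {n t : ℕ} (ht : t < n) :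
    (range n).filter (fun s => t ≤ s ∧
      cnt (fun u => Broadcasts S u i) (t + 1) = cnt (fun u => Broadcasts S u i) (s + 1)) =
      Ico t (nextStart S n t i) := by
  have hmem : nextStart S n t i ∈ {s : ℕ | t < s ∧ (Broadcasts S s i ∨ n ≤ s)} :=
    Nat.sInf_mem ⟨n, ht, Or.inr le_rfl⟩
  have hle : nextStart S n t i ≤ n := Nat.sInf_le ⟨ht, Or.inr le_rfl⟩
  ext s
  simp only [mem_filter, mem_range, mem_Ico]
  constructor
  · rintro ⟨h1, h2, h3⟩
    refine ⟨h2, ?_⟩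
    by_contra hge
    push Not at hge
    rw [cnt_eq_iff (by omega)] at h3
    rcases hmem.2 with h | h
    · exact h3 _ hmem.1 (by omega) h
    · omega
  · rintro ⟨h1, h2⟩
    refine ⟨by omega, h1, ?_⟩
    rw [cnt_eq_iff (by omega)]
    intro u hu1 hu2 hu
    have : nextStart S n t i ≤ u := Nat.sInf_le ⟨hu1, Or.inl hu⟩
    omega

/-- Summing `nextStart - t` counts the pairs with `t ≤ s`, that is `(pairs + n) / 2`, and the half
slots of `meanWait` remove the `n / 2`. The symmetric count is a sum of squares of class sizes, the
form needed for Cauchy-Schwarz and Young's inequality. -/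
theorem sum_meanWait (S : Schedule W M) (n : ℕ) (i : M) :
    ∑ t ∈ range n, meanWait S n t i = (pairs (fun u => Broadcasts S u i) n : ℝ) / 2 := by
  have h := pairs_add_eq (fun u => Broadcasts S u i) n
  have h1 : ∀ t ∈ range n, meanWait S n t i =
      (((range n).filter (fun s => t ≤ s ∧ cnt (fun u => Broadcasts S u i) (t + 1) =
        cnt (fun u => Broadcasts S u i) (s + 1))).card : ℝ) - 1 / 2 := by
    intro t ht
    have ht := mem_range.1 ht
    rw [nextStart_filter S i ht, Nat.card_Ico, Nat.cast_sub, meanWait]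
    exact (Nat.sInf_mem (s := {s : ℕ | t < s ∧ (Broadcasts S s i ∨ n ≤ s)})
      ⟨n, ht, Or.inr le_rfl⟩).1.le
  rw [sum_congr rfl h1, sum_sub_distrib]
  have h' : (pairs (fun u => Broadcasts S u i) n : ℝ) + n = 2 * ∑ t ∈ range n,
      (((range n).filter (fun s => t ≤ s ∧ cnt (fun u => Broadcasts S u i) (t + 1) =
        cnt (fun u => Broadcasts S u i) (s + 1))).card : ℝ) := by exact_mod_cast h
  simp only [sum_const, card_range, nsmul_eq_mul]
  linarith

/-- The number of broadcasts of `i` in the first `n` time slots. -/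
def occ (S : Schedule W M) (n : ℕ) (i : M) : ℕ :=
  ∑ t ∈ range n, ∑ k, @ite ℕ (S t k = some i) (Classical.propDecidable _) 1 0

theorem occ_mono (S : Schedule W M) (i : M) : Monotone (fun n => occ S n i) := by
  intro a b h
  exact sum_le_sum_of_subset (range_subset_range.2 h)

theorem elim_eq_sum [Fintype M] (c : M → ℝ) (o : Option M) :
    o.elim 0 c = ∑ i, c i * @ite ℝ (o = some i) (Classical.propDecidable _) 1 0 := by
  classical
  cases o with
  | none => simp
  | some j => simp

theorem sum_elim_eq [Fintype M] (c : M → ℝ) (S : Schedule W M) (n : ℕ) :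
    ∑ t ∈ range n, ∑ k, (S t k).elim 0 c = ∑ i, c i * occ S n i := by
  simp only [elim_eq_sum]
  have : ∀ t ∈ range n, ∑ k, ∑ i, c i * (@ite ℝ (S t k = some i) (Classical.propDecidable _) 1 0) =
      ∑ i, ∑ k, c i * (@ite ℝ (S t k = some i) (Classical.propDecidable _) 1 0) := fun t _ => sum_comm
  rw [sum_congr rfl this, sum_comm]
  apply sum_congr rfl
  intro i _
  unfold occ
  push_cast
  simp only [mul_sum]

theorem sum_occ_le [Fintype M] (S : Schedule W M) (n : ℕ) : ∑ i, occ S n i ≤ W * n := by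
  classical
  unfold occ
  rw [sum_comm]
  have : ∀ t ∈ range n, (∑ i : M, ∑ k, @ite ℕ (S t k = some i) (Classical.propDecidable _) 1 0) ≤ W := by
    intro t _
    rw [sum_comm]
    calc _ ≤ ∑ k : Fin W, 1 := by
          apply sum_le_sum
          intro k _
          cases h : S t k with
          | none => simp
          | some j => simp
      _ = W := by simp
  calc _ ≤ ∑ t ∈ range n, W := sum_le_sum this
    _ = W * n := by simp [mul_comm]

theorem finDensity_eq [Fintype M] (S : Schedule W M) (n : ℕ) :
    finDensity S n = ((∑ i, occ S n i : ℕ) : ℝ) / (W * n) := by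
  unfold finDensity
  rw [sum_elim_eq (fun _ => (1 : ℝ)) S n]
  push_cast
  simp

/-- The cost of the first `n` time slots, not divided by `n`. -/
def total [Fintype M] (p c : M → ℝ) (S : Schedule W M) (n : ℕ) : ℝ :=
  ∑ i, (p i * ((pairs (fun u => Broadcasts S u i) n : ℝ) / 2) + c i * occ S n i)

theorem fin_cost_eq [Fintype M] (p c : M → ℝ) (S : Schedule W M) (n : ℕ) :
    finERT p S n + finBC c S n = total p c S n / n := by
  unfold finERT finBC total
  rw [sum_elim_eq, sum_add_distrib, add_div]
  simp only [sum_meanWait]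

theorem total_mono [Fintype M] {p c : M → ℝ} (hp : ∀ i, 0 ≤ p i) (hc : ∀ i, 0 ≤ c i)
    (S : Schedule W M) : Monotone (total p c S) := by
  intro a b h
  apply sum_le_sum
  intro i _
  have h1 : (pairs (fun u => Broadcasts S u i) a : ℝ) ≤ pairs (fun u => Broadcasts S u i) b := by
    exact_mod_cast pairs_mono _ h
  have h2 : (occ S a i : ℝ) ≤ occ S b i := by exact_mod_cast occ_mono S i h
  have := mul_le_mul_of_nonneg_left h1 (hp i)
  have := mul_le_mul_of_nonneg_left h2 (hc i)
  linarith

theorem total_nonneg [Fintype M] {p c : M → ℝ} (hp : ∀ i, 0 ≤ p i) (hc : ∀ i, 0 ≤ c i)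
    (S : Schedule W M) (n : ℕ) : 0 ≤ total p c S n := by
  apply sum_nonneg
  intro i _
  have := hp i
  have := hc i
  positivity

/-- With this the cost of `A` enters as its exact upper limit, while the part of `B` is controlled
by an eventual bound. -/
theorem limsup_add_ofReal_le {u : ℕ → ℝ≥0∞} {f : ℕ → ℝ} {v : ℝ}
    (h : ∀ δ > 0, ∀ᶠ n in Filter.atTop, f n ≤ v + δ) :
    Filter.limsup (fun n => u n + ENNReal.ofReal (f n)) Filter.atTop ≤
      Filter.limsup u Filter.atTop + ENNReal.ofReal v := by
  apply ENNReal.le_of_forall_pos_le_add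
  intro δ hδ _
  have h1 : ENNReal.ofReal (v + δ) ≤ ENNReal.ofReal v + (δ : ℝ≥0∞) := by
    refine (ENNReal.ofReal_add_le).trans ?_
    simp
  rw [add_assoc]
  refine le_trans ?_ (add_le_add le_rfl h1)
  rw [← limsup_add_const _ _ _ (by isBoundedDefault) (by isBoundedDefault)]
  apply Filter.limsup_le_limsup
  · filter_upwards [h δ (by exact_mod_cast hδ)] with n hn
    exact add_le_add le_rfl (ENNReal.ofReal_le_ofReal hn)
  · isBoundedDefault
  · isBoundedDefault

theorem limsup_ofReal_le {f : ℕ → ℝ} {v : ℝ}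
    (h : ∀ δ > 0, ∀ᶠ n in Filter.atTop, f n ≤ v + δ) :
    Filter.limsup (fun n => ENNReal.ofReal (f n)) Filter.atTop ≤ ENNReal.ofReal v := by
  have := limsup_add_ofReal_le (u := fun _ => 0) h
  simpa using this

theorem eventually_le_of_linear {F : ℕ → ℝ} {v D : ℝ} (h : ∀ n : ℕ, F n ≤ n * v + D) :
    ∀ δ > 0, ∀ᶠ n : ℕ in Filter.atTop, F n / n ≤ v + δ := by
  intro δ hδ
  have hD : Filter.Tendsto (fun n : ℕ => D / (n : ℝ)) Filter.atTop (nhds 0) :=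
    tendsto_const_div_atTop_nhds_zero_nat D
  filter_upwards [hD.eventually (gt_mem_nhds hδ), Filter.eventually_gt_atTop 0] with n h1 h2
  have hn : (0 : ℝ) < n := by exact_mod_cast h2
  rw [div_le_iff₀ hn]
  rw [div_lt_iff₀ hn] at h1
  have := h n
  nlinarith

/-- The cost is bounded by the mean costs of the multiples of a period. -/
theorem cost_le_of_multiples [Fintype M] {p c : M → ℝ} (hp : ∀ i, 0 ≤ p i) (hc : ∀ i, 0 ≤ c i)
    (S : Schedule W M) {N : ℕ} (hN : 0 < N) {v : ℝ}
    (h : ∀ m : ℕ, total p c S (N * m) ≤ N * m * v) : cost p c S ≤ ENNReal.ofReal v := by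
  unfold cost
  simp only [fin_cost_eq]
  apply limsup_ofReal_le
  -- Rounding `n` up to a multiple of `N` costs at most `N * v`, which vanishes in the mean.
  apply eventually_le_of_linear (D := N * v)
  have hNr : (0 : ℝ) < N := by exact_mod_cast hN
  have hv : 0 ≤ v := by
    have h1 := h 1
    have h2 := total_nonneg hp hc S (N * 1)
    push_cast at h1
    by_contra hneg
    push Not at hneg
    nlinarith
  intro n
  have h1 : n ≤ N * (n / N + 1) := by
    have := Nat.lt_mul_div_succ n hN
    omega
  have h2 : N * (n / N) ≤ n := Nat.mul_div_le n N
  have h2' : (N : ℝ) * (n / N : ℕ) ≤ n := by exact_mod_cast h2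
  have h3 := total_mono hp hc S h1
  have h4 := h (n / N + 1)
  push_cast at h4
  nlinarith

end General

end DataBroadcast

end

noncomputable section

namespace DataBroadcast

open Finset

theorem sum_range_mul_eq {β : Type*} [AddCommMonoid β] (f : ℕ → β) (n w : ℕ) :
    ∑ u ∈ range (n * w), f u = ∑ t ∈ range n, ∑ k ∈ range w, f (t * w + k) := by
  induction n with
  | zero => simp
  | succ n ih => rw [Nat.add_mul, one_mul, sum_range_add, ih, sum_range_succ]

/-! ### The first phase of the algorithm is feasible -/

/-- A schedule of period `P` is determined by its first `P` time slots, for which there are finitely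
many possibilities. -/
theorem finite_periodic (W a N : ℕ) (α : ℝ) :
    {S : Schedule W (Fin a) | IsPeriodicWithDensity N α S}.Finite := by
  have h : {S : Schedule W (Fin a) | IsPeriodicWithDensity N α S} ⊆
      ⋃ P ∈ Set.Icc 1 N, {S : Schedule W (Fin a) | ∀ t, S (t + P) = S t} := by
    rintro S ⟨P, h1, h2, h3, -⟩
    simp only [Set.mem_iUnion]
    exact ⟨P, ⟨h1, h2⟩, h3⟩
  refine Set.Finite.subset ((Set.finite_Icc 1 N).biUnion ?_) h
  intro P hP
  refine Set.Finite.of_finite_image (f := fun S (t : Fin P) => S t) (Set.toFinite _) ?_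
  intro S hS S' hS' heq
  funext t
  have h1 : ∀ (S : Schedule W (Fin a)), (∀ t, S (t + P) = S t) → S t = S (t % P) := by
    intro S hS
    exact (Function.Periodic.map_mod_nat (f := S) (fun t => hS t) t).symm
  rw [h1 S hS, h1 S' hS']
  exact congrFun heq ⟨t % P, Nat.mod_lt _ hP.1⟩

theorem exists_optimal_periodic {a W N x : ℕ} (ha : 1 ≤ a) (p c : Fin a → ℝ) (hx : x ≤ W * N)
    (hN : 1 ≤ N) :
    ∃ S : Schedule W (Fin a), IsOptimalPeriodic p c N ((x : ℝ) / (W * N)) S := by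
  have hne : {S : Schedule W (Fin a) | IsPeriodicWithDensity N ((x : ℝ) / (W * N)) S}.Nonempty := by
    -- The first `x` of the `W * N` slots of a period carry message `0`, the others are empty.
    refine ⟨fun t k => if (t % N) * W + k < x then some ⟨0, ha⟩ else none, N, hN, le_rfl, ?_, ?_⟩
    · intro t; simp
    · unfold finDensity
      congr 1
      have h1 : ∀ t ∈ range N, (∑ k : Fin W,
          (if (t % N) * W + (k : ℕ) < x then some (⟨0, ha⟩ : Fin a) else none).elim (0 : ℝ)
            (fun _ => 1)) = ∑ k ∈ range W, if t * W + k < x then (1 : ℝ) else 0 := by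
        intro t ht
        rw [Nat.mod_eq_of_lt (mem_range.1 ht), Finset.sum_range]
        apply sum_congr rfl
        intro k _
        split_ifs <;> rfl
      rw [sum_congr rfl h1, ← sum_range_mul_eq (fun u => if u < x then (1 : ℝ) else 0)]
      rw [← sum_filter, sum_const, nsmul_eq_mul, mul_one]
      congr 1
      have : (range (N * W)).filter (fun u => u < x) = range x := by
        ext u
        simp only [mem_filter, mem_range]
        rw [mul_comm N W]; omega
      rw [this, card_range]
  obtain ⟨S, hS, hmin⟩ := Set.exists_min_image _ (cost p c) (finite_periodic W a N _) hne
  exact ⟨S, hS, hmin⟩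

namespace Input

variable (I : Input)

theorem lbObj_nonneg {τ : Fin I.q → ℝ} (h : ∀ j, 0 < τ j) : 0 ≤ I.lbObj τ := by
  apply sum_nonneg
  intro j _
  have := I.pB_pos j
  have := I.cB_nonneg j
  have := h j
  positivity

theorem lb_le {W : ℕ} {β : ℝ} {τ : Fin I.q → ℝ} (h : τ ∈ I.lbFeasible W β) :
    I.lb W β ≤ I.lbObj τ := by
  apply csInf_le
  · refine ⟨0, ?_⟩
    rintro _ ⟨σ, hσ, rfl⟩
    exact I.lbObj_nonneg hσ.1
  · exact ⟨τ, h, rfl⟩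

theorem lb_eq {W : ℕ} {β : ℝ} {τ : Fin I.q → ℝ} (h : τ ∈ I.lbFeasible W β)
    (hmin : IsMinOn I.lbObj (I.lbFeasible W β) τ) : I.lb W β = I.lbObj τ := by
  apply le_antisymm (I.lb_le h)
  apply le_csInf (Set.Nonempty.image _ ⟨τ, h⟩)
  rintro _ ⟨σ, hσ, rfl⟩
  exact hmin hσ

theorem inv_le_of_feasible {W : ℕ} {β : ℝ} {τ : Fin I.q → ℝ} (h : τ ∈ I.lbFeasible W β)
    (j : Fin I.q) : 1 / τ j ≤ β * W :=
  (single_le_sum (f := fun j => 1 / τ j) (fun j _ => (one_div_pos.2 (h.1 j)).le)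
    (mem_univ j)).trans h.2

/-- Compactness: the constraint bounds every `τ j` from below, and since `pB j > 0` the linear term
bounds it from above for all points no worse than `τ₀`. On the resulting box the objective is
continuous. -/
theorem exists_lb_minimizer {W : ℕ} {β : ℝ} (hβ : 0 < β * W) :
    ∃ τ ∈ I.lbFeasible W β, IsMinOn I.lbObj (I.lbFeasible W β) τ := by
  set b := β * W with hb
  let τ₀ : Fin I.q → ℝ := fun _ => (I.q + 1) / b
  have hτ₀ : τ₀ ∈ I.lbFeasible W β := by
    refine ⟨fun j => by positivity, ?_⟩
    simp only [τ₀, one_div_div, sum_const, card_univ, Fintype.card_fin, nsmul_eq_mul]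
    rw [← hb, mul_div_assoc', div_le_iff₀ (by positivity)]
    nlinarith
  set V := I.lbObj τ₀
  have hco : ∀ j, 0 < I.pB j * (I.g j : ℝ) ^ 2 := fun j => by
    have := I.pB_pos j
    have : (0 : ℝ) < I.g j := by exact_mod_cast I.g_pos j
    positivity
  let hi : Fin I.q → ℝ := fun j => 2 * V / (I.pB j * (I.g j : ℝ) ^ 2)
  let box : Set (Fin I.q → ℝ) := Set.Icc (fun _ => 1 / b) hi
  have hbox : ∀ τ ∈ I.lbFeasible W β, I.lbObj τ ≤ V → τ ∈ box := by
    intro τ hτ hV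
    refine ⟨fun j => ?_, fun j => ?_⟩
    · have := I.inv_le_of_feasible hτ j
      rw [one_div_le (by positivity) (hτ.1 j)]
      exact this
    · have h1 : I.pB j * (I.g j : ℝ) ^ 2 * τ j / 2 + I.cB j / τ j ≤ I.lbObj τ := by
        unfold lbObj
        apply single_le_sum (f := fun j => I.pB j * (I.g j : ℝ) ^ 2 * τ j / 2 + I.cB j / τ j) _
          (mem_univ j)
        intro i _
        have := I.pB_pos i
        have := I.cB_nonneg i
        have := hτ.1 i
        positivity
      have h2 : 0 ≤ I.cB j / τ j := div_nonneg (I.cB_nonneg j) (hτ.1 j).le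
      simp only [hi]
      rw [le_div_iff₀ (hco j)]
      linarith
  have hpos : ∀ τ ∈ box, ∀ j, 0 < τ j := fun τ hτ j =>
    lt_of_lt_of_le (by positivity) (hτ.1 j)
  have hinv : ∀ j, ContinuousOn (fun τ : Fin I.q → ℝ => 1 / τ j) box := fun j =>
    ContinuousOn.div continuousOn_const (continuous_apply j).continuousOn
      (fun τ hτ => (hpos τ hτ j).ne')
  have hK : IsCompact (box ∩ (fun τ => ∑ j, 1 / τ j) ⁻¹' Set.Iic b) := by
    refine IsCompact.of_isClosed_subset (isCompact_Icc (a := fun _ : Fin I.q => 1 / b) (b := hi)) ?_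
      Set.inter_subset_left
    exact (continuousOn_finsetSum _ (fun j _ => hinv j)).preimage_isClosed_of_isClosed
      isClosed_Icc isClosed_Iic
  have hcont : ContinuousOn I.lbObj (box ∩ (fun τ => ∑ j, 1 / τ j) ⁻¹' Set.Iic b) := by
    refine ContinuousOn.mono ?_ Set.inter_subset_left
    unfold lbObj
    refine continuousOn_finsetSum _ (fun j _ => ContinuousOn.add ?_ ?_)
    · exact Continuous.continuousOn (by fun_prop)
    · have := (hinv j).const_mul (I.cB j)
      simpa [div_eq_mul_inv] using this
  obtain ⟨τ, hτ, hmin⟩ := hK.exists_isMinOn ⟨τ₀, hbox τ₀ hτ₀ le_rfl, hτ₀.2⟩ hcont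
  refine ⟨τ, ⟨hpos τ hτ.1, hτ.2⟩, ?_⟩
  intro σ hσ
  by_cases h : I.lbObj σ ≤ V
  · exact hmin ⟨hbox σ hσ h, hσ.2⟩
  · have h1 : I.lbObj τ ≤ V := hmin ⟨hbox τ₀ hτ₀ le_rfl, hτ₀.2⟩
    exact h1.trans (not_le.1 h).le

end Input

theorem nonempty_phase1 (I : Input) {W N : ℕ} (ha : 1 ≤ I.a) (h : 2 ≤ W * N) :
    Nonempty (Phase1 I W N) := by
  have hN : 1 ≤ N := Nat.pos_of_ne_zero (by rintro rfl; simp at h)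
  have hW : 1 ≤ W := Nat.pos_of_ne_zero (by rintro rfl; simp at h)
  have hex : ∀ x : ℕ, ∃ S : Schedule W (Fin I.a), 1 ≤ x → x < W * N →
      IsOptimalPeriodic I.pA I.cA N ((x : ℝ) / (W * N)) S := by
    intro x
    by_cases hx : x < W * N
    · obtain ⟨S, hS⟩ := exists_optimal_periodic ha I.pA I.cA hx.le hN
      exact ⟨S, fun _ _ => hS⟩
    · exact ⟨fun _ _ => none, fun _ h => absurd h hx⟩
  choose sched hs using hex
  obtain ⟨x₀, hx₀, hmin⟩ := (Finset.Ico 1 (W * N)).exists_min_image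
    (fun x => cost I.pA I.cA (sched x) + ENNReal.ofReal (I.lb W (1 - (x : ℝ) / (W * N))))
    ⟨1, by simp; omega⟩
  rw [mem_Ico] at hx₀
  have hβ : 0 < (1 - (x₀ : ℝ) / (W * N)) * W := by
    have hW' : (0 : ℝ) < W := by exact_mod_cast hW
    have hN' : (0 : ℝ) < N := by exact_mod_cast hN
    have : (x₀ : ℝ) < W * N := by exact_mod_cast hx₀.2
    have : (x₀ : ℝ) / (W * N) < 1 := by rwa [div_lt_one (by positivity)]
    apply mul_pos _ hW'
    linarith
  obtain ⟨τ, h1, h2⟩ := I.exists_lb_minimizer hβ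
  exact ⟨⟨sched, hs, x₀, hx₀.1, hx₀.2, fun x h1 h2 => hmin x (by simp [h1, h2]), τ, h1, h2⟩⟩

end DataBroadcast

end

/-! ### Upper half: the random schedule compared with the relaxation. -/

noncomputable section

namespace DataBroadcast

open Finset MeasureTheory ProbabilityTheory

/-! ### A law of large numbers for weakly correlated nonnegative variables -/

section LLN

variable {Ω : Type*} [MeasurableSpace Ω] {μ : Measure Ω} [IsProbabilityMeasure μ]

/-- The summand `Y n` adds its variance and twice its covariances with the earlier summands. The
distances `n - s` are distinct, so this is at most twice a partial sum of `γ`. -/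
theorem variance_sum_le {Y : ℕ → Ω → ℝ} (hY : ∀ s, MemLp (Y s) 2 μ) {γ : ℕ → ℝ}
    (hγ0 : ∀ d, 0 ≤ γ d)
    (hcov : ∀ s d, μ[Y s * Y (s + d)] ≤ μ[Y s] * μ[Y (s + d)] + γ d) {Γ : ℝ}
    (hγ : ∀ n, ∑ d ∈ range n, γ d ≤ Γ) (n : ℕ) :
    Var[fun ω => ∑ s ∈ range n, Y s ω; μ] ≤ 2 * n * Γ := by
  have hc : ∀ s d, cov[Y s, Y (s + d); μ] ≤ γ d := by
    intro s d
    rw [covariance_eq_sub (hY s) (hY _)]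
    linarith [hcov s d]
  have hS : ∀ n, MemLp (fun ω => ∑ s ∈ range n, Y s ω) 2 μ := fun n =>
    memLp_finsetSum (range n) (fun s _ => hY s)
  induction n with
  | zero =>
    simp only [range_zero, sum_empty]
    rw [show (fun _ : Ω => (0 : ℝ)) = 0 from rfl, variance_zero]
    simp
  | succ n ih =>
    have h1 : (fun ω => ∑ s ∈ range (n + 1), Y s ω) =
        (fun ω => ∑ s ∈ range n, Y s ω) + Y n := by
      funext ω; simp [sum_range_succ]
    rw [h1, variance_add (hS n) (hY n), covariance_fun_sum_left' (fun s _ => hY s) (hY n)]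
    have h2 : ∑ s ∈ range n, cov[Y s, Y n; μ] ≤ ∑ s ∈ range n, γ (n - s) := by
      apply sum_le_sum
      intro s hs
      have := hc s (n - s)
      rwa [Nat.add_sub_cancel' (mem_range.1 hs).le] at this
    have h3 : ∑ s ∈ range n, γ (n - s) + γ 0 = ∑ d ∈ range (n + 1), γ d := by
      rw [← sum_range_reflect (fun d => γ d) (n + 1), sum_range_succ]
      simp
    have h4 : Var[Y n; μ] ≤ γ 0 := by
      rw [← covariance_self (hY n).aemeasurable]
      exact hc n 0
    have := hγ (n + 1)
    have := hγ0 0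
    push_cast
    linarith

/-- Chebyshev's inequality and the Borel-Cantelli lemma give the bound along the squares, where the
error probabilities are summable. The partial sums are monotone and the ratio of consecutive squares
tends to `1`, so the bound extends to all `n`. -/
theorem ae_eventually_mean_le {Y : ℕ → Ω → ℝ} (hY : ∀ s, MemLp (Y s) 2 μ)
    (h0 : ∀ s ω, 0 ≤ Y s ω) {γ : ℕ → ℝ} (hγ0 : ∀ d, 0 ≤ γ d)
    (hcov : ∀ s d, μ[Y s * Y (s + d)] ≤ μ[Y s] * μ[Y (s + d)] + γ d) {Γ : ℝ}
    (hγ : ∀ n, ∑ d ∈ range n, γ d ≤ Γ) {v D : ℝ} (hv : 0 ≤ v)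
    (hE : ∀ n : ℕ, ∑ s ∈ range n, μ[Y s] ≤ n * v + D) :
    ∀ᵐ ω ∂μ, ∀ δ > 0, ∀ᶠ n : ℕ in Filter.atTop, (∑ s ∈ range n, Y s ω) / n ≤ v + δ := by
  have hS : ∀ n, MemLp (fun ω => ∑ s ∈ range n, Y s ω) 2 μ := fun n =>
    memLp_finsetSum (range n) (fun s _ => hY s)
  have hmean : ∀ n : ℕ, μ[fun ω => ∑ s ∈ range n, Y s ω] ≤ n * v + D := by
    intro n
    rw [integral_finsetSum _ (fun s _ => (hY s).integrable (by norm_num))]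
    exact hE n
  have hΓ : 0 ≤ Γ := by simpa using hγ 0
  have hsub : ∀ δ > 0, ∀ᵐ ω ∂μ, ∀ᶠ k : ℕ in Filter.atTop,
      ∑ s ∈ range ((k + 1) ^ 2), Y s ω ≤ ((k + 1) ^ 2 : ℝ) * (v + δ) + D := by
    intro δ hδ
    set A : ℕ → Set Ω := fun k => {ω | δ * ((k : ℝ) + 1) ^ 2 ≤
      |(∑ s ∈ range ((k + 1) ^ 2), Y s ω) - μ[fun ω => ∑ s ∈ range ((k + 1) ^ 2), Y s ω]|}
    have hA : ∀ k, μ (A k) ≤ ENNReal.ofReal (2 * Γ / δ ^ 2 * (1 / ((k + 1 : ℕ) : ℝ) ^ 2)) := by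
      intro k
      have hc : 0 < δ * ((k : ℝ) + 1) ^ 2 := by positivity
      refine (meas_ge_le_variance_div_sq (hS ((k + 1) ^ 2)) hc).trans
        (ENNReal.ofReal_le_ofReal ?_)
      have := variance_sum_le hY hγ0 hcov hγ ((k + 1) ^ 2)
      rw [div_le_iff₀ (by positivity)]
      refine this.trans (le_of_eq ?_)
      push_cast
      field_simp
    have hsum : ∑' k, μ (A k) ≠ ∞ := by
      refine ne_top_of_le_ne_top ?_ (ENNReal.tsum_le_tsum hA)
      apply Summable.tsum_ofReal_ne_top
      apply Summable.mul_left
      exact (summable_nat_add_iff 1).2 (Real.summable_one_div_nat_pow.2 (by norm_num))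
    filter_upwards [ae_eventually_notMem hsum] with ω hω
    filter_upwards [hω] with k hk
    simp only [A, Set.mem_ofPred_eq, not_le] at hk
    have h1 := (abs_lt.1 hk).2
    have h2 := hmean ((k + 1) ^ 2)
    push_cast at h2
    nlinarith
  -- The tolerances `1 / (j + 1)` leave only countably many null sets.
  have hall : ∀ᵐ ω ∂μ, ∀ j : ℕ, ∀ᶠ k : ℕ in Filter.atTop,
      ∑ s ∈ range ((k + 1) ^ 2), Y s ω ≤ ((k + 1) ^ 2 : ℝ) * (v + 1 / ((j : ℝ) + 1)) + D :=
    ae_all_iff.2 (fun j => hsub _ (by positivity))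
  filter_upwards [hall] with ω hω δ hδ
  obtain ⟨j, hj⟩ := exists_nat_one_div_lt (half_pos hδ)
  set η := 1 / ((j : ℝ) + 1) with hη
  have hη0 : 0 < η := by positivity
  obtain ⟨k₀, hk₀⟩ := Filter.eventually_atTop.1 (hω j)
  -- For `r ≥ R`, the loss `(v + η) (2 r + 1) + D` of passing from `r ^ 2` to the next square is at
  -- most `δ / 2 * r ^ 2`.
  obtain ⟨R, hR⟩ := exists_nat_ge ((3 * (v + η) + |D|) / (δ / 2))
  filter_upwards [Filter.eventually_ge_atTop ((k₀ + R + 1) ^ 2)] with n hn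
  have hr1 : k₀ + R + 1 ≤ n.sqrt := by rwa [Nat.le_sqrt']
  have hr2 : n.sqrt ^ 2 ≤ n := Nat.sqrt_le' n
  have hr3 : n ≤ (n.sqrt + 1) ^ 2 := (Nat.lt_succ_sqrt' n).le
  have hk := hk₀ n.sqrt (by omega)
  have hmono : ∑ s ∈ range n, Y s ω ≤ ∑ s ∈ range ((n.sqrt + 1) ^ 2), Y s ω :=
    sum_le_sum_of_subset_of_nonneg (range_subset_range.2 hr3) (fun s _ _ => h0 s ω)
  have hnpos : (0 : ℝ) < n := by
    have : 0 < n := lt_of_lt_of_le (by positivity) hn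
    exact_mod_cast this
  rw [div_le_iff₀ hnpos]
  refine (hmono.trans hk).trans ?_
  have hr2' : (n.sqrt : ℝ) ^ 2 ≤ n := by exact_mod_cast hr2
  have hr1' : (k₀ : ℝ) + R + 1 ≤ n.sqrt := by exact_mod_cast hr1
  set r : ℝ := (n.sqrt : ℝ)
  rw [div_le_iff₀ (half_pos hδ)] at hR
  have hk0 : (0 : ℝ) ≤ k₀ := Nat.cast_nonneg _
  have hR0 : (0 : ℝ) ≤ R := Nat.cast_nonneg _
  have hr : 1 ≤ r := by linarith
  have e1 : 3 * (v + η) + |D| ≤ r * (δ / 2) := hR.trans (by nlinarith)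
  have e2 : (v + η) * (2 * r + 1) + D ≤ (3 * (v + η) + |D|) * r := by
    have := le_abs_self D
    have := abs_nonneg D
    have : 0 ≤ v + η := by linarith
    nlinarith
  have e3 : (3 * (v + η) + |D|) * r ≤ (δ / 2) * r ^ 2 := by nlinarith
  have e4 : (v + η + δ / 2) * r ^ 2 ≤ (v + η + δ / 2) * n := by
    apply mul_le_mul_of_nonneg_left hr2'; linarith
  nlinarith

end LLN

end DataBroadcast

end

noncomputable section

namespace DataBroadcast

open Finset MeasureTheory ProbabilityTheory

/-! ### The expected number of missing draws -/

/-- The expectation of `max (c - B) 0` for a binomial variable `B` with parameters `M`, `q`. -/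
def missing (q : ℝ) : ℕ → ℕ → ℝ
  | 0, c => c
  | _ + 1, 0 => 0
  | M + 1, c + 1 => q * missing q M c + (1 - q) * missing q M (c + 1)

section Missing

variable {q : ℝ}

theorem missing_zero_right (q : ℝ) (M : ℕ) : missing q M 0 = 0 := by
  cases M <;> simp [missing]

theorem missing_succ (q : ℝ) (M c : ℕ) :
    missing q (M + 1) (c + 1) = q * missing q M c + (1 - q) * missing q M (c + 1) := rfl

theorem missing_nonneg (h0 : 0 ≤ q) (h1 : q ≤ 1) (M c : ℕ) : 0 ≤ missing q M c := by
  induction M generalizing c with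
  | zero => simp [missing]
  | succ M ih =>
    cases c with
    | zero => rw [missing_zero_right]
    | succ c =>
      rw [missing_succ]
      have := mul_nonneg h0 (ih c)
      have := mul_nonneg (sub_nonneg.2 h1) (ih (c + 1))
      linarith

theorem missing_le_succ (h0 : 0 ≤ q) (h1 : q ≤ 1) (M c : ℕ) :
    missing q M c ≤ missing q M (c + 1) := by
  induction M generalizing c with
  | zero => simp [missing]
  | succ M ih =>
    cases c with
    | zero => rw [missing_zero_right]; exact missing_nonneg h0 h1 _ _
    | succ c =>
      rw [missing_succ, missing_succ]
      have := mul_le_mul_of_nonneg_left (ih c) h0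
      have := mul_le_mul_of_nonneg_left (ih (c + 1)) (sub_nonneg.2 h1)
      linarith

theorem missing_antitone (h0 : 0 ≤ q) (h1 : q ≤ 1) (c : ℕ) :
    Antitone (fun M => missing q M c) := by
  apply antitone_nat_of_succ_le
  intro M
  cases c with
  | zero => rw [missing_zero_right, missing_zero_right]
  | succ c =>
    rw [missing_succ]
    have := mul_le_mul_of_nonneg_left (missing_le_succ h0 h1 M c) h0
    linarith

/-- The reason is `max (c - B) 0 ≤ c * 2 ^ (c - B)`, where `2 ^ (-B)` has expectation `(1 - q / 2) ^
M`. -/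
theorem missing_le_geom (h0 : 0 ≤ q) (h1 : q ≤ 1) (M c : ℕ) :
    missing q M c ≤ c * 2 ^ c * (1 - q / 2) ^ M := by
  induction M generalizing c with
  | zero =>
    simp only [missing, pow_zero, mul_one]
    have : (1 : ℝ) ≤ 2 ^ c := one_le_pow₀ (by norm_num)
    nlinarith [(Nat.cast_nonneg c : (0 : ℝ) ≤ c)]
  | succ M ih =>
    cases c with
    | zero => simp [missing_zero_right]
    | succ c =>
      rw [missing_succ]
      have hr : 0 ≤ (1 - q / 2) ^ M := pow_nonneg (by linarith) _
      have e1 := mul_le_mul_of_nonneg_left (ih c) h0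
      have e2 := mul_le_mul_of_nonneg_left (ih (c + 1)) (sub_nonneg.2 h1)
      have e3 : (c : ℝ) * 2 ^ c ≤ ((c + 1 : ℕ) : ℝ) * 2 ^ (c + 1) / 2 := by
        push_cast
        rw [pow_succ]
        have : (0 : ℝ) ≤ 2 ^ c := by positivity
        nlinarith
      have e4 : q * ((c : ℝ) * 2 ^ c * (1 - q / 2) ^ M) ≤
          q * (((c + 1 : ℕ) : ℝ) * 2 ^ (c + 1) / 2 * (1 - q / 2) ^ M) :=
        mul_le_mul_of_nonneg_left (mul_le_mul_of_nonneg_right e3 hr) h0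
      refine (add_le_add (e1.trans e4) e2).trans (le_of_eq ?_)
      rw [pow_succ (1 - q / 2) M]
      ring

/-- Over all `M`, the shortages count for each `i = 1, …, c` the numbers of trials with fewer than
`i` successes; on average there are `i / q` of them. -/
theorem sum_missing_le (h0 : 0 < q) (h1 : q ≤ 1) (n c : ℕ) :
    ∑ M ∈ range n, missing q M c ≤ c * (c + 1) / (2 * q) := by
  induction n generalizing c with
  | zero => simp only [range_zero, sum_empty]; positivity
  | succ n ih =>
    cases c with
    | zero => simp [missing_zero_right]
    | succ c =>
      rw [sum_range_succ']
      simp only [missing_succ]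
      rw [sum_add_distrib, ← mul_sum, ← mul_sum]
      have e1 := mul_le_mul_of_nonneg_left (ih c) h0.le
      have e2 := mul_le_mul_of_nonneg_left (ih (c + 1)) (sub_nonneg.2 h1)
      simp only [missing]
      refine (add_le_add_left (add_le_add e1 e2) _).trans (le_of_eq ?_)
      push_cast
      field_simp
      ring

theorem sum_range_div_le {f : ℕ → ℝ} (hf : ∀ k, 0 ≤ f k) {P : ℕ} (hP : 0 < P) (n : ℕ) :
    ∑ d ∈ range n, f (d / P) ≤ P * ∑ k ∈ range n, f k := by
  have h1 : ∑ d ∈ range n, f (d / P) ≤ ∑ d ∈ range (n * P), f (d / P) := by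
    apply sum_le_sum_of_subset_of_nonneg
    · apply range_subset_range.2
      exact Nat.le_mul_of_pos_right n hP
    · intro d _ _; exact hf _
  refine h1.trans (le_of_eq ?_)
  rw [sum_range_mul_eq (fun d => f (d / P)), mul_sum]
  apply sum_congr rfl
  intro k _
  rw [sum_congr rfl (g := fun _ => f k)]
  · simp
  · intro e he
    congr 1
    rw [mul_comm, Nat.mul_add_div hP, Nat.div_eq_of_lt (mem_range.1 he), add_zero]

/-- By antitonicity every term with `k > 0` is at most the mean over the `E` values of `M` just
before `k * E`; the term `k = 0` is `c`. -/
theorem sum_missing_mul_le (h0 : 0 < q) (h1 : q ≤ 1) {E : ℕ} (hE : 0 < E) (n c : ℕ) :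
    ∑ k ∈ range n, missing q (k * E) c ≤ c + c * (c + 1) / (2 * q) / E := by
  have hE' : (0 : ℝ) < E := by exact_mod_cast hE
  cases n with
  | zero => simp only [range_zero, sum_empty]; positivity
  | succ n =>
    rw [sum_range_succ']
    simp only [zero_mul, missing]
    have : ∑ k ∈ range n, missing q ((k + 1) * E) c ≤ c * (c + 1) / (2 * q) / E := by
      rw [le_div_iff₀ hE']
      refine le_trans ?_ (sum_missing_le h0 h1 (n * E) c)
      rw [sum_range_mul_eq (fun M => missing q M c), sum_mul]
      apply sum_le_sum
      intro k _
      calc missing q ((k + 1) * E) c * E = ∑ e ∈ range E, missing q ((k + 1) * E) c := by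
            simp [mul_comm]
        _ ≤ _ := by
            apply sum_le_sum
            intro e he
            apply missing_antitone h0.le h1
            have := mem_range.1 he
            nlinarith
    linarith

theorem sum_missing_div_le (h0 : 0 < q) (h1 : q ≤ 1) {E P : ℕ} (hE : 0 < E) (hP : 0 < P)
    (n c : ℕ) :
    ∑ d ∈ range n, missing q (d / P * E) c ≤ P * (c + c * (c + 1) / (2 * q) / E) :=
  (sum_range_div_le (f := fun k => missing q (k * E) c)
    (fun _ => missing_nonneg h0.le h1 _ _) hP n).trans
    (mul_le_mul_of_nonneg_left (sum_missing_mul_le h0 h1 hE n c) (Nat.cast_nonneg P))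

/-- The weights are those of `sq_sum_le_of_le`, and the sum bounds the second moments of the age
sums. Its size is irrelevant, because second moments enter the law of large numbers but not the
cost. -/
theorem exists_sum_mul_missing_le (h0 : 0 < q) (h1 : q ≤ 1) {E P : ℕ} (hE : 0 < E) (hP : 0 < P)
    (c : ℕ) :
    ∃ B, ∀ n, ∑ d ∈ range n, (2 * d + 1 : ℝ) * missing q (d / P * E) c ≤ B := by
  set r := 1 - q / 2 with hr
  have hr0 : 0 ≤ r := by rw [hr]; linarith
  have hr1 : r < 1 := by rw [hr]; linarith
  have hsum : Summable (fun k : ℕ => (k : ℝ) * r ^ k + r ^ k) := by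
    apply Summable.add
    · have := summable_pow_mul_geometric_of_norm_lt_one (R := ℝ) 1 (r := r)
        (by rw [Real.norm_of_nonneg hr0]; exact hr1)
      simpa using this
    · exact summable_geometric_of_lt_one hr0 hr1
  refine ⟨P * (2 * P * (c * 2 ^ c) * ∑' k : ℕ, ((k : ℝ) * r ^ k + r ^ k)), fun n => ?_⟩
  have hstep : ∀ d : ℕ, (2 * d + 1 : ℝ) * missing q (d / P * E) c ≤
      2 * P * (c * 2 ^ c) * (((d / P : ℕ) : ℝ) * r ^ (d / P) + r ^ (d / P)) := by
    intro d
    have e1 : missing q (d / P * E) c ≤ c * 2 ^ c * r ^ (d / P) :=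
      (missing_antitone h0.le h1 c (Nat.le_mul_of_pos_right _ hE)).trans
        (missing_le_geom h0.le h1 _ _)
    have e2 : (2 * d + 1 : ℝ) ≤ 2 * P * (((d / P : ℕ) : ℝ) + 1) := by
      have : d + 1 ≤ P * (d / P + 1) := Nat.lt_mul_div_succ d hP
      have : (d : ℝ) + 1 ≤ P * (((d / P : ℕ) : ℝ) + 1) := by exact_mod_cast this
      linarith
    calc _ ≤ (2 * P * (((d / P : ℕ) : ℝ) + 1)) * (c * 2 ^ c * r ^ (d / P)) :=
          mul_le_mul e2 e1 (missing_nonneg h0.le h1 _ _) (by positivity)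
      _ = _ := by ring
  refine (sum_le_sum (fun d _ => hstep d)).trans ?_
  refine (sum_range_div_le (f := fun k => 2 * P * (c * 2 ^ c) * ((k : ℝ) * r ^ k + r ^ k))
    (fun k => by positivity) hP n).trans ?_
  apply mul_le_mul_of_nonneg_left _ (Nat.cast_nonneg P)
  rw [← mul_sum]
  apply mul_le_mul_of_nonneg_left _ (by positivity)
  exact hsum.sum_le_tsum _ (fun _ _ => by positivity)

end Missing

/-! ### Independent draws -/

section Draws

/-- A function of finitely many draws factors through the countable space `S → ℕ`, where
measurability is automatic. -/
theorem exists_factor_of_dependsOn {ι Ω : Type*} {ξ : ι → Ω → ℕ} {S : Finset ι}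
    {F : (ι → ℕ) → ℝ} (hF : ∀ z z', (∀ σ ∈ S, z σ = z' σ) → F z = F z') :
    ∃ φ : (S → ℕ) → ℝ, Measurable φ ∧
      (fun ω => F (fun σ => ξ σ ω)) = φ ∘ (fun ω (σ : S) => ξ σ ω) := by
  classical
  refine ⟨fun x => F (fun σ => if h : σ ∈ S then x ⟨σ, h⟩ else 0), measurable_of_countable _, ?_⟩
  funext ω
  apply hF
  intro σ hσ
  simp [hσ]

variable {ι : Type*} {Ω : Type*} [MeasurableSpace Ω] {μ : Measure Ω} {ξ : ι → Ω → ℕ}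

theorem measurable_comp_draws (hξ : ∀ σ, Measurable (ξ σ)) {S : Finset ι}
    {F : (ι → ℕ) → ℝ} (hF : ∀ z z', (∀ σ ∈ S, z σ = z' σ) → F z = F z') :
    Measurable (fun ω => F (fun σ => ξ σ ω)) := by
  obtain ⟨φ, h1, h2⟩ := exists_factor_of_dependsOn (ξ := ξ) hF
  rw [h2]
  exact h1.comp (measurable_pi_lambda _ (fun σ => hξ σ))

theorem integral_mul_of_disjoint (hξ : ∀ σ, Measurable (ξ σ)) (hind : iIndepFun ξ μ)
    {S T : Finset ι} (hST : Disjoint S T) {F G : (ι → ℕ) → ℝ}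
    (hF : ∀ z z', (∀ σ ∈ S, z σ = z' σ) → F z = F z')
    (hG : ∀ z z', (∀ σ ∈ T, z σ = z' σ) → G z = G z') :
    ∫ ω, F (fun σ => ξ σ ω) * G (fun σ => ξ σ ω) ∂μ =
      (∫ ω, F (fun σ => ξ σ ω) ∂μ) * ∫ ω, G (fun σ => ξ σ ω) ∂μ := by
  obtain ⟨φ, h1, h2⟩ := exists_factor_of_dependsOn (ξ := ξ) hF
  obtain ⟨ψ, h3, h4⟩ := exists_factor_of_dependsOn (ξ := ξ) hG
  have h : IndepFun (fun ω => F (fun σ => ξ σ ω)) (fun ω => G (fun σ => ξ σ ω)) μ := by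
    rw [h2, h4]
    exact (hind.indepFun_finset S T hST hξ).comp h1 h3
  exact h.integral_mul_eq_mul_integral (measurable_comp_draws hξ hF).aestronglyMeasurable
    (measurable_comp_draws hξ hG).aestronglyMeasurable

theorem integrable_comp_draws [IsProbabilityMeasure μ] (hξ : ∀ σ, Measurable (ξ σ)) {S : Finset ι}
    {F : (ι → ℕ) → ℝ} (hF : ∀ z z', (∀ σ ∈ S, z σ = z' σ) → F z = F z') {b : ℝ}
    (hb : ∀ ω, |F (fun σ => ξ σ ω)| ≤ b) : Integrable (fun ω => F (fun σ => ξ σ ω)) μ :=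
  Integrable.of_bound (measurable_comp_draws hξ hF).aestronglyMeasurable b
    (Filter.Eventually.of_forall hb)

variable {q : ℝ}

/-- Conditioning on a single draw reproduces the recursion of `missing`. -/
theorem integral_missing [IsProbabilityMeasure μ] (hξ : ∀ σ, Measurable (ξ σ)) (hind : iIndepFun ξ μ)
    (h01 : ∀ σ ω, ξ σ ω ≤ 1) (hq : ∀ σ, ∫ ω, (ξ σ ω : ℝ) ∂μ = q) (Λ : Finset ι) (c : ℕ) :
    ∫ ω, ((c - ∑ σ ∈ Λ, ξ σ ω : ℕ) : ℝ) ∂μ = missing q Λ.card c := by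
  classical
  have hdep : ∀ (Λ : Finset ι) (c : ℕ) (z z' : ι → ℕ), (∀ σ ∈ Λ, z σ = z' σ) →
      ((c - ∑ σ ∈ Λ, z σ : ℕ) : ℝ) = ((c - ∑ σ ∈ Λ, z' σ : ℕ) : ℝ) := by
    intro Λ c z z' h
    rw [sum_congr rfl h]
  have hbd : ∀ (Λ : Finset ι) (c : ℕ) (z : ι → ℕ), |((c - ∑ σ ∈ Λ, z σ : ℕ) : ℝ)| ≤ c := by
    intro Λ c z
    rw [abs_of_nonneg (Nat.cast_nonneg _)]
    exact_mod_cast Nat.sub_le _ _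
  induction Λ using Finset.induction_on generalizing c with
  | empty => simp [missing]
  | insert τ Λ hτ ih =>
    rw [card_insert_of_notMem hτ]
    cases c with
    | zero => simp [missing_zero_right]
    | succ c =>
      rw [missing_succ, ← ih c, ← ih (c + 1)]
      have h1 : ∀ ω, ((c + 1 - ∑ σ ∈ insert τ Λ, ξ σ ω : ℕ) : ℝ) =
          (ξ τ ω : ℝ) * ((c - ∑ σ ∈ Λ, ξ σ ω : ℕ) : ℝ) +
          (1 - (ξ τ ω : ℝ)) * ((c + 1 - ∑ σ ∈ Λ, ξ σ ω : ℕ) : ℝ) := by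
        intro ω
        rw [sum_insert hτ]
        have := h01 τ ω
        interval_cases h : ξ τ ω
        · simp
        · have : c + 1 - (1 + ∑ σ ∈ Λ, ξ σ ω) = c - ∑ σ ∈ Λ, ξ σ ω := by omega
          rw [this]; simp
      have hd : Disjoint ({τ} : Finset ι) Λ := by simpa using hτ
      have hF : ∀ z z' : ι → ℕ, (∀ σ ∈ ({τ} : Finset ι), z σ = z' σ) →
          ((z τ : ℕ) : ℝ) = z' τ := fun z z' h => by rw [h τ (by simp)]
      have hF' : ∀ z z' : ι → ℕ, (∀ σ ∈ ({τ} : Finset ι), z σ = z' σ) →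
          1 - ((z τ : ℕ) : ℝ) = 1 - z' τ := fun z z' h => by rw [h τ (by simp)]
      have e1 := integral_mul_of_disjoint hξ hind hd (F := fun z => (z τ : ℝ)) hF (hdep Λ c)
      have e2 := integral_mul_of_disjoint hξ hind hd (F := fun z => 1 - (z τ : ℝ)) hF'
        (hdep Λ (c + 1))
      have habs : ∀ ω, |(ξ τ ω : ℝ)| ≤ 1 ∧ |1 - (ξ τ ω : ℝ)| ≤ 1 := by
        intro ω
        have := h01 τ ω
        interval_cases h : ξ τ ω <;> simp
      have hi0 : Integrable (fun ω => (ξ τ ω : ℝ)) μ :=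
        integrable_comp_draws hξ (F := fun z => (z τ : ℝ)) hF (fun ω => (habs ω).1)
      have e3 : ∫ ω, (1 - (ξ τ ω : ℝ)) ∂μ = 1 - q := by
        rw [integral_sub (integrable_const 1) hi0, hq]
        simp
      rw [e3] at e2
      rw [hq] at e1
      simp only [h1]
      have hmul : ∀ {x y b : ℝ}, |x| ≤ 1 → |y| ≤ b → |x * y| ≤ b := by
        intro x y b hx hy
        rw [abs_mul]
        calc |x| * |y| ≤ 1 * |y| := mul_le_mul_of_nonneg_right hx (abs_nonneg y)
          _ ≤ b := by rw [one_mul]; exact hy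
      have hdep2 : ∀ (z z' : ι → ℕ), (∀ σ ∈ insert τ Λ, z σ = z' σ) →
          z τ = z' τ ∧ ∀ σ ∈ Λ, z σ = z' σ := fun z z' h =>
        ⟨h τ (mem_insert_self _ _), fun σ hσ => h σ (mem_insert_of_mem hσ)⟩
      rw [integral_add, e1, e2]
      · refine integrable_comp_draws hξ (S := insert τ Λ)
          (F := fun z => (z τ : ℝ) * ((c - ∑ σ ∈ Λ, z σ : ℕ) : ℝ)) ?_
          (fun ω => hmul (habs ω).1 (hbd Λ c _))
        intro z z' h
        obtain ⟨ha, hb⟩ := hdep2 z z' h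
        simp only [ha, hdep Λ c z z' hb]
      · refine integrable_comp_draws hξ (S := insert τ Λ)
          (F := fun z => (1 - (z τ : ℝ)) * ((c + 1 - ∑ σ ∈ Λ, z σ : ℕ) : ℝ)) ?_
          (fun ω => hmul (habs ω).2 (hbd Λ (c + 1) _))
        intro z z' h
        obtain ⟨ha, hb⟩ := hdep2 z z' h
        simp only [ha, hdep Λ (c + 1) z z' hb]

end Draws

end DataBroadcast

end

noncomputable section

namespace DataBroadcast

open Finset MeasureTheory ProbabilityTheory

/-! ### The ages of the messages of a group -/

section Ages

variable {ι : Type*}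

/-- The number of draws in the time slots `t + 1, …, s`, if `Λ u` are the random slots of time
`u`. -/
def drawsBetween (Λ : ℕ → Finset ι) (t s : ℕ) (z : ι → ℕ) : ℕ :=
  ∑ u ∈ Ioc t s, ∑ σ ∈ Λ u, z σ

/-- How many of `g` draws are missing in the time slots `t + 1, …, s`. -/
def shortage (Λ : ℕ → Finset ι) (g t s : ℕ) (z : ι → ℕ) : ℝ :=
  ((g - drawsBetween Λ t s z : ℕ) : ℝ)

/-- The sum of the shortages between earlier time slots and `s`. -/
def ageSum (Λ : ℕ → Finset ι) (g s : ℕ) (z : ι → ℕ) : ℝ :=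
  ∑ t ∈ range (s + 1), shortage Λ g t s z

variable {Λ : ℕ → Finset ι} {g : ℕ}

theorem drawsBetween_add (z : ι → ℕ) {t s r : ℕ} (h1 : t ≤ s) (h2 : s ≤ r) :
    drawsBetween Λ t r z = drawsBetween Λ t s z + drawsBetween Λ s r z := by
  unfold drawsBetween
  rw [← Ioc_union_Ioc_eq_Ioc h1 h2, sum_union]
  exact Ioc_disjoint_Ioc_of_le le_rfl

theorem shortage_nonneg (t s : ℕ) (z : ι → ℕ) : 0 ≤ shortage Λ g t s z := Nat.cast_nonneg _

theorem shortage_le (t s : ℕ) (z : ι → ℕ) : shortage Λ g t s z ≤ g := by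
  unfold shortage; exact_mod_cast Nat.sub_le _ _

theorem ageSum_nonneg (s : ℕ) (z : ι → ℕ) : 0 ≤ ageSum Λ g s z :=
  sum_nonneg (fun _ _ => shortage_nonneg _ _ _)

theorem ageSum_le (s : ℕ) (z : ι → ℕ) : ageSum Λ g s z ≤ (s + 1) * g := by
  refine (sum_le_sum (fun t _ => shortage_le t s z)).trans ?_
  simp

/-- Either the draws in `(s, r]` complete a round and the left side vanishes, or the second factor
is at least `1`. -/
theorem shortage_le_mul (z : ι → ℕ) {t s r : ℕ} (h1 : t ≤ s) (h2 : s ≤ r) :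
    shortage Λ g t r z ≤ shortage Λ g t s z * shortage Λ g s r z := by
  unfold shortage
  rw [drawsBetween_add z h1 h2, ← Nat.cast_mul, Nat.cast_le]
  generalize drawsBetween Λ t s z = x
  generalize drawsBetween Λ s r z = y
  rcases Nat.lt_or_ge y g with h | h
  · calc g - (x + y) ≤ (g - x) * 1 := by omega
      _ ≤ (g - x) * (g - y) := Nat.mul_le_mul_left _ (by omega)
  · have : g - (x + y) = 0 := by omega
    rw [this]; exact Nat.zero_le _

/-- The factor `shortage` and the last sum depend only on draws after `s` and so are independent of
`ageSum Λ g s z`. This makes the covariances decay like the expected shortage. -/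
theorem ageSum_add_le (z : ι → ℕ) (s d : ℕ) :
    ageSum Λ g (s + d) z ≤ ageSum Λ g s z * shortage Λ g s (s + d) z +
      ∑ t ∈ Ico (s + 1) (s + d + 1), shortage Λ g t (s + d) z := by
  unfold ageSum
  rw [← sum_range_add_sum_Ico _ (show s + 1 ≤ s + d + 1 by omega), sum_mul]
  gcongr with t ht
  exact shortage_le_mul z (by have := mem_range.1 ht; omega) (by omega)

theorem sum_Ico_shortage_le (z : ι → ℕ) (s d : ℕ) :
    ∑ t ∈ Ico (s + 1) (s + d + 1), shortage Λ g t (s + d) z ≤ ageSum Λ g (s + d) z := by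
  unfold ageSum
  rw [← sum_range_add_sum_Ico _ (show s + 1 ≤ s + d + 1 by omega)]
  have : 0 ≤ ∑ t ∈ range (s + 1), shortage Λ g t (s + d) z :=
    sum_nonneg (fun _ _ => shortage_nonneg _ _ _)
  linarith

theorem ageSum_eq_reflect (s : ℕ) (z : ι → ℕ) :
    ageSum Λ g s z = ∑ d ∈ range (s + 1), shortage Λ g (s - d) s z := by
  unfold ageSum
  rw [← sum_range_reflect (fun t => shortage Λ g t s z)]
  apply sum_congr rfl
  intro d _
  simp

/-- The term `f n` adds `f n ^ 2 + 2 * f n * ∑ d < n, f d ≤ b * (2 n + 1) * f n` to the square. -/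
theorem sq_sum_le_of_le {f : ℕ → ℝ} {b : ℝ} (h0 : ∀ d, 0 ≤ f d) (hb : ∀ d, f d ≤ b) (n : ℕ) :
    (∑ d ∈ range n, f d) ^ 2 ≤ b * ∑ d ∈ range n, (2 * d + 1) * f d := by
  induction n with
  | zero => simp
  | succ n ih =>
    rw [sum_range_succ, sum_range_succ]
    have h1 : ∑ d ∈ range n, f d ≤ n * b := by
      refine (sum_le_sum (fun d _ => hb d)).trans ?_
      simp
    have := h0 n
    have := hb n
    have e1 : (∑ d ∈ range n, f d) * f n ≤ n * b * f n := mul_le_mul_of_nonneg_right h1 (h0 n)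
    have e2 : f n * f n ≤ b * f n := mul_le_mul_of_nonneg_right (hb n) (h0 n)
    nlinarith

variable [DecidableEq ι]

/-- The random slots of the time slots `t + 1, …, s`. -/
def slotsBetween (Λ : ℕ → Finset ι) (t s : ℕ) : Finset ι := (Ioc t s).biUnion Λ

theorem drawsBetween_congr {a b t s : ℕ} (h : Ioc t s ⊆ Ioc a b) {z z' : ι → ℕ}
    (hz : ∀ σ ∈ slotsBetween Λ a b, z σ = z' σ) :
    drawsBetween Λ t s z = drawsBetween Λ t s z' := by
  unfold drawsBetween
  apply sum_congr rfl; intro u hu; apply sum_congr rfl; intro σ hσ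
  exact hz σ (mem_biUnion.2 ⟨u, h hu, hσ⟩)

theorem shortage_congr {a b t s : ℕ} (h : Ioc t s ⊆ Ioc a b) {z z' : ι → ℕ}
    (hz : ∀ σ ∈ slotsBetween Λ a b, z σ = z' σ) :
    shortage Λ g t s z = shortage Λ g t s z' := by
  unfold shortage; rw [drawsBetween_congr h hz]

theorem ageSum_congr {s : ℕ} {z z' : ι → ℕ} (hz : ∀ σ ∈ slotsBetween Λ 0 s, z σ = z' σ) :
    ageSum Λ g s z = ageSum Λ g s z' := by
  unfold ageSum
  apply sum_congr rfl; intro t _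
  exact shortage_congr (Ioc_subset_Ioc_left (Nat.zero_le t)) hz

theorem drawsBetween_eq (hd : Pairwise (fun u v => Disjoint (Λ u) (Λ v)))
    (t s : ℕ) (z : ι → ℕ) :
    drawsBetween Λ t s z = ∑ σ ∈ slotsBetween Λ t s, z σ := by
  unfold drawsBetween slotsBetween
  rw [sum_biUnion (fun u _ v _ huv => hd huv)]

theorem card_slotsBetween (hd : Pairwise (fun u v => Disjoint (Λ u) (Λ v))) (t s : ℕ) :
    (slotsBetween Λ t s).card = ∑ u ∈ Ioc t s, (Λ u).card := by
  unfold slotsBetween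
  rw [card_biUnion (fun u _ v _ huv => hd huv)]

theorem disjoint_slotsBetween (hd : Pairwise (fun u v => Disjoint (Λ u) (Λ v)))
    (t s r : ℕ) :
    Disjoint (slotsBetween Λ t s) (slotsBetween Λ s r) := by
  unfold slotsBetween
  rw [disjoint_biUnion_left]
  intro u hu
  rw [disjoint_biUnion_right]
  intro v hv
  apply hd
  rw [mem_Ioc] at hu hv
  omega

end Ages

section Random

variable {ι : Type*} {Ω : Type*} [MeasurableSpace Ω] {μ : Measure Ω}
  [IsProbabilityMeasure μ] {ξ : ι → Ω → ℕ} {q : ℝ} {Λ : ℕ → Finset ι}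

theorem memLp_comp_draws (hξ : ∀ σ, Measurable (ξ σ)) {S : Finset ι}
    {F : (ι → ℕ) → ℝ} (hF : ∀ z z', (∀ σ ∈ S, z σ = z' σ) → F z = F z') {b : ℝ}
    (hb : ∀ ω, |F (fun σ => ξ σ ω)| ≤ b) : MemLp (fun ω => F (fun σ => ξ σ ω)) 2 μ :=
  MemLp.of_bound (measurable_comp_draws hξ hF).aestronglyMeasurable b
    (Filter.Eventually.of_forall hb)

/-- The mean of the age sums is almost surely at most its expected value. -/
theorem ae_ageSum_mean_le [DecidableEq ι] (hξ : ∀ σ, Measurable (ξ σ)) (hind : iIndepFun ξ μ)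
    (h01 : ∀ σ ω, ξ σ ω ≤ 1) (hq : ∀ σ, ∫ ω, (ξ σ ω : ℝ) ∂μ = q) (hq0 : 0 < q) (hq1 : q ≤ 1)
    (hd : Pairwise (fun u v => Disjoint (Λ u) (Λ v))) {E P : ℕ} (hE : 0 < E) (hP : 0 < P)
    (hcard : ∀ t d, d / P * E ≤ ∑ u ∈ Ioc t (t + d), (Λ u).card) (g : ℕ) :
    ∀ᵐ ω ∂μ, ∀ δ > 0, ∀ᶠ n : ℕ in Filter.atTop,
      (∑ s ∈ range n, ageSum Λ g s (fun σ => ξ σ ω)) / n ≤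
        P * (g + g * (g + 1) / (2 * q) / E) + δ := by
  set γ : ℕ → ℝ := fun d => missing q (d / P * E) g with hγ
  have hshort : ∀ t d, ∫ ω, shortage Λ g t (t + d) (fun σ => ξ σ ω) ∂μ ≤ γ d := by
    intro t d
    unfold shortage
    simp only [drawsBetween_eq hd]
    rw [integral_missing hξ hind h01 hq, card_slotsBetween hd]
    exact missing_antitone hq0.le hq1 g (hcard t d)
  have hsdep : ∀ t s (z z' : ι → ℕ), (∀ σ ∈ slotsBetween Λ t s, z σ = z' σ) →
      shortage Λ g t s z = shortage Λ g t s z' := fun t s z z' h =>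
    shortage_congr (Subset.refl _) h
  have habs : ∀ t s (z : ι → ℕ), |shortage Λ g t s z| ≤ g := fun t s z => by
    rw [abs_of_nonneg (shortage_nonneg _ _ _)]; exact shortage_le _ _ _
  have hsint : ∀ t s, Integrable (fun ω => shortage Λ g t s (fun σ => ξ σ ω)) μ := fun t s =>
    integrable_comp_draws hξ (hsdep t s) (fun ω => habs t s _)
  have hAdep : ∀ s (z z' : ι → ℕ), (∀ σ ∈ slotsBetween Λ 0 s, z σ = z' σ) →
      ageSum Λ g s z = ageSum Λ g s z' := fun s z z' h => ageSum_congr h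
  have hAabs : ∀ s (z : ι → ℕ), |ageSum Λ g s z| ≤ (s + 1) * g := fun s z => by
    rw [abs_of_nonneg (ageSum_nonneg _ _)]; exact ageSum_le _ _
  have hA2 : ∀ s, MemLp (fun ω => ageSum Λ g s (fun σ => ξ σ ω)) 2 μ := fun s =>
    memLp_comp_draws hξ (hAdep s) (fun ω => hAabs s _)
  have hAint : ∀ s, Integrable (fun ω => ageSum Λ g s (fun σ => ξ σ ω)) μ := fun s =>
    (hA2 s).integrable (by norm_num)
  have hEA : ∀ s, ∫ ω, ageSum Λ g s (fun σ => ξ σ ω) ∂μ ≤ ∑ d ∈ range (s + 1), γ d := by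
    intro s
    simp only [ageSum_eq_reflect]
    rw [integral_finsetSum _ (fun d _ => hsint _ _)]
    apply sum_le_sum
    intro d hd'
    have := hshort (s - d) d
    rwa [Nat.sub_add_cancel (by have := mem_range.1 hd'; omega)] at this
  obtain ⟨B, hB⟩ := exists_sum_mul_missing_le hq0 hq1 hE hP g
  have hEA2 : ∀ s, ∫ ω, ageSum Λ g s (fun σ => ξ σ ω) ^ 2 ∂μ ≤ g * B := by
    intro s
    have h1 : ∀ ω, ageSum Λ g s (fun σ => ξ σ ω) ^ 2 ≤
        g * ∑ d ∈ range (s + 1), (2 * d + 1) * shortage Λ g (s - d) s (fun σ => ξ σ ω) := by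
      intro ω
      rw [ageSum_eq_reflect]
      exact sq_sum_le_of_le (fun d => shortage_nonneg _ _ _) (fun d => shortage_le _ _ _) _
    refine (integral_mono (hA2 s).integrable_sq ?_ h1).trans ?_
    · exact (integrable_finsetSum _ (fun d _ => (hsint _ _).const_mul _)).const_mul _
    · rw [integral_const_mul, integral_finsetSum _ (fun d _ => (hsint _ _).const_mul _)]
      apply mul_le_mul_of_nonneg_left _ (Nat.cast_nonneg g)
      refine le_trans ?_ (hB (s + 1))
      apply sum_le_sum
      intro d hd'
      rw [integral_const_mul]
      apply mul_le_mul_of_nonneg_left _ (by positivity)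
      have := hshort (s - d) d
      rwa [Nat.sub_add_cancel (by have := mem_range.1 hd'; omega)] at this
  have hγ0 : ∀ d, 0 ≤ γ d := fun d => missing_nonneg hq0.le hq1 _ _
  have hgB : 0 ≤ g * B := (integral_nonneg (fun ω => sq_nonneg _)).trans (hEA2 0)
  have hγsum : ∀ n, ∑ d ∈ range n, γ d ≤ P * (g + g * (g + 1) / (2 * q) / E) := fun n =>
    sum_missing_div_le hq0 hq1 hE hP n g
  have hE' : (0 : ℝ) < E := by exact_mod_cast hE
  -- The second moments are at most `g * B` by `hEA2`, and the expected shortage over `d` time slots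
  -- is at most `γ d`.
  refine ae_eventually_mean_le (Y := fun s ω => ageSum Λ g s (fun σ => ξ σ ω))
    (γ := fun d => g * B * γ d) (Γ := g * B * (P * (g + g * (g + 1) / (2 * q) / E))) (D := 0)
    hA2 (fun s ω => ageSum_nonneg _ _)
    (fun d => mul_nonneg hgB (hγ0 d)) ?_ ?_ (by positivity) ?_
  · intro s d
    set A' : (ι → ℕ) → ℝ := fun z => ∑ t ∈ Ico (s + 1) (s + d + 1), shortage Λ g t (s + d) z
    have hA'dep : ∀ z z' : ι → ℕ, (∀ σ ∈ slotsBetween Λ s (s + d), z σ = z' σ) →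
        A' z = A' z' := by
      intro z z' h
      apply sum_congr rfl
      intro t ht
      apply shortage_congr _ h
      apply Ioc_subset_Ioc_left
      have := (mem_Ico.1 ht).1
      omega
    have hA'0 : ∀ z, 0 ≤ A' z := fun z => sum_nonneg (fun _ _ => shortage_nonneg _ _ _)
    have hA'le : ∀ z, A' z ≤ ageSum Λ g (s + d) z := fun z => sum_Ico_shortage_le z s d
    have hA'int : MemLp (fun ω => A' (fun σ => ξ σ ω)) 2 μ :=
      memLp_comp_draws hξ hA'dep (b := (s + d + 1) * g) (fun ω => by
        rw [abs_of_nonneg (hA'0 _)]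
        refine (hA'le _).trans ((ageSum_le _ _).trans (le_of_eq ?_))
        push_cast; ring)
    have hsh2 : MemLp (fun ω => shortage Λ g s (s + d) (fun σ => ξ σ ω)) 2 μ :=
      memLp_comp_draws hξ (hsdep s (s + d)) (fun ω => habs _ _ _)
    have hpt : ∀ ω, ageSum Λ g s (fun σ => ξ σ ω) * ageSum Λ g (s + d) (fun σ => ξ σ ω) ≤
        ageSum Λ g s (fun σ => ξ σ ω) ^ 2 * shortage Λ g s (s + d) (fun σ => ξ σ ω) +
        ageSum Λ g s (fun σ => ξ σ ω) * A' (fun σ => ξ σ ω) := by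
      intro ω
      have := mul_le_mul_of_nonneg_left (ageSum_add_le (Λ := Λ) (g := g) (fun σ => ξ σ ω) s d)
        (ageSum_nonneg (Λ := Λ) (g := g) s (fun σ => ξ σ ω))
      refine this.trans (le_of_eq ?_)
      ring
    have hdisj := disjoint_slotsBetween hd 0 s (s + d)
    have hi1 : ∫ ω, ageSum Λ g s (fun σ => ξ σ ω) ^ 2 *
        shortage Λ g s (s + d) (fun σ => ξ σ ω) ∂μ =
        (∫ ω, ageSum Λ g s (fun σ => ξ σ ω) ^ 2 ∂μ) *
          ∫ ω, shortage Λ g s (s + d) (fun σ => ξ σ ω) ∂μ :=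
      integral_mul_of_disjoint hξ hind hdisj (F := fun z => ageSum Λ g s z ^ 2)
        (fun z z' h => by simp only [hAdep s z z' h]) (hsdep s (s + d))
    have hi2 : ∫ ω, ageSum Λ g s (fun σ => ξ σ ω) * A' (fun σ => ξ σ ω) ∂μ =
        (∫ ω, ageSum Λ g s (fun σ => ξ σ ω) ∂μ) * ∫ ω, A' (fun σ => ξ σ ω) ∂μ :=
      integral_mul_of_disjoint hξ hind hdisj (hAdep s) hA'dep
    have hint1 : Integrable (fun ω => ageSum Λ g s (fun σ => ξ σ ω) ^ 2 *
        shortage Λ g s (s + d) (fun σ => ξ σ ω)) μ :=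
      (hA2 s).integrable_sq.mul_bdd (c := g) hsh2.aestronglyMeasurable
        (Filter.Eventually.of_forall (fun ω => habs _ _ _))
    have hint2 : Integrable (fun ω => ageSum Λ g s (fun σ => ξ σ ω) * A' (fun σ => ξ σ ω)) μ :=
      (hA2 s).integrable_mul hA'int
    simp only [Pi.mul_apply]
    refine (integral_mono ((hA2 s).integrable_mul (hA2 (s + d))) (hint1.add hint2) hpt).trans ?_
    simp only [Pi.add_apply]
    rw [integral_add hint1 hint2, hi1, hi2]
    have e1 : (∫ ω, ageSum Λ g s (fun σ => ξ σ ω) ^ 2 ∂μ) *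
        ∫ ω, shortage Λ g s (s + d) (fun σ => ξ σ ω) ∂μ ≤ g * B * γ d :=
      mul_le_mul (hEA2 s) (hshort s d) (integral_nonneg (fun ω => shortage_nonneg _ _ _)) hgB
    have e2 : ∫ ω, A' (fun σ => ξ σ ω) ∂μ ≤
        ∫ ω, ageSum Λ g (s + d) (fun σ => ξ σ ω) ∂μ :=
      integral_mono (hA'int.integrable (by norm_num)) (hAint _) (fun ω => hA'le _)
    have e3 := mul_le_mul_of_nonneg_left e2
      (integral_nonneg (μ := μ) (fun ω => ageSum_nonneg (Λ := Λ) (g := g) s (fun σ => ξ σ ω)))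
    linarith
  · intro n
    rw [← mul_sum]
    exact mul_le_mul_of_nonneg_left (hγsum n) hgB
  · intro n
    refine (sum_le_sum (fun s _ => (hEA s).trans (hγsum (s + 1)))).trans ?_
    simp

/-- The mean number of draws is almost surely at most its expected value. -/
theorem ae_draws_mean_le (hξ : ∀ σ, Measurable (ξ σ)) (hind : iIndepFun ξ μ)
    (h01 : ∀ σ ω, ξ σ ω ≤ 1) (hq : ∀ σ, ∫ ω, (ξ σ ω : ℝ) ∂μ = q)
    (hd : Pairwise (fun u v => Disjoint (Λ u) (Λ v))) {v D : ℝ} (hv : 0 ≤ v)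
    (hcard : ∀ n : ℕ, q * (∑ u ∈ range n, (Λ u).card : ℕ) ≤ n * v + D) {m : ℕ}
    (hm : ∀ u, (Λ u).card ≤ m) :
    ∀ᵐ ω ∂μ, ∀ δ > 0, ∀ᶠ n : ℕ in Filter.atTop,
      (∑ s ∈ range n, ((∑ σ ∈ Λ s, ξ σ ω : ℕ) : ℝ)) / n ≤ v + δ := by
  have hdep : ∀ s (z z' : ι → ℕ), (∀ σ ∈ Λ s, z σ = z' σ) →
      ((∑ σ ∈ Λ s, z σ : ℕ) : ℝ) = ((∑ σ ∈ Λ s, z' σ : ℕ) : ℝ) := fun s z z' h => by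
    rw [sum_congr rfl h]
  have hbd : ∀ s ω, ∑ σ ∈ Λ s, ξ σ ω ≤ m := fun s ω => by
    refine (sum_le_sum (fun σ _ => h01 σ ω)).trans ?_
    simpa using hm s
  have hY : ∀ s, MemLp (fun ω => ((∑ σ ∈ Λ s, ξ σ ω : ℕ) : ℝ)) 2 μ := fun s =>
    memLp_comp_draws hξ (hdep s) (b := m) (fun ω => by
      rw [abs_of_nonneg (Nat.cast_nonneg _)]
      exact_mod_cast hbd s ω)
  have hξint : ∀ σ, Integrable (fun ω => (ξ σ ω : ℝ)) μ := fun σ =>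
    integrable_comp_draws hξ (S := {σ}) (F := fun z => (z σ : ℝ))
      (fun z z' h => by rw [h σ (by simp)]) (b := 1) (fun ω => by
        rw [abs_of_nonneg (Nat.cast_nonneg _)]
        exact_mod_cast h01 σ ω)
  -- Different time slots use disjoint sets of draws, so only `d = 0` contributes a covariance.
  refine ae_eventually_mean_le (Y := fun s ω => ((∑ σ ∈ Λ s, ξ σ ω : ℕ) : ℝ))
    (γ := fun d => if d = 0 then (m : ℝ) ^ 2 else 0) (Γ := (m : ℝ) ^ 2) hY
    (fun s ω => Nat.cast_nonneg _) (fun d => by positivity) ?_ ?_ hv (D := D) ?_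
  · intro s d
    simp only [Pi.mul_apply]
    rcases Nat.eq_zero_or_pos d with rfl | hpos
    · simp only [add_zero, if_true]
      have h1 : ∫ ω, ((∑ σ ∈ Λ s, ξ σ ω : ℕ) : ℝ) * ((∑ σ ∈ Λ s, ξ σ ω : ℕ) : ℝ) ∂μ ≤
          ∫ _, (m : ℝ) ^ 2 ∂μ := by
        apply integral_mono ((hY s).integrable_mul (hY s)) (integrable_const _)
        intro ω
        have : ((∑ σ ∈ Λ s, ξ σ ω : ℕ) : ℝ) ≤ m := by exact_mod_cast hbd s ω
        have h0 : (0 : ℝ) ≤ ((∑ σ ∈ Λ s, ξ σ ω : ℕ) : ℝ) := Nat.cast_nonneg _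
        simp only [Pi.mul_apply]
        nlinarith
      rw [integral_const] at h1
      simp only [probReal_univ, one_smul] at h1
      nlinarith [mul_self_nonneg (∫ ω, ((∑ σ ∈ Λ s, ξ σ ω : ℕ) : ℝ) ∂μ)]
    · rw [if_neg hpos.ne', add_zero]
      exact (integral_mul_of_disjoint hξ hind (hd (by omega : s ≠ s + d))
        (F := fun z => ((∑ σ ∈ Λ s, z σ : ℕ) : ℝ)) (G := fun z => ((∑ σ ∈ Λ (s + d), z σ : ℕ) : ℝ))
        (hdep s) (hdep (s + d))).le
  · intro n
    rw [sum_ite_eq']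
    split_ifs
    · exact le_rfl
    · positivity
  · intro n
    refine le_trans (le_of_eq ?_) (hcard n)
    push_cast
    rw [mul_sum]
    apply sum_congr rfl
    intro s _
    rw [integral_finsetSum _ (fun σ _ => hξint σ), sum_congr rfl (fun σ _ => hq σ)]
    simp [mul_comm]

end Random

end DataBroadcast

end

noncomputable section

namespace DataBroadcast

open Finset MeasureTheory ProbabilityTheory

/-! ### Round-robin broadcasts of a group -/

theorem exists_cnt_eq {P : ℕ → Prop} {a b v : ℕ} (h1 : cnt P a ≤ v) (h2 : v < cnt P b) :
    ∃ x, a ≤ x ∧ x < b ∧ P x ∧ cnt P x = v := by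
  induction b with
  | zero => simp [cnt_zero] at h2
  | succ b ih =>
    by_cases h : v < cnt P b
    · obtain ⟨x, hx⟩ := ih h
      exact ⟨x, hx.1, by omega, hx.2.2⟩
    · rw [cnt_succ] at h2
      split_ifs at h2 with hb
      · have hv : cnt P b = v := by omega
        refine ⟨b, ?_, by omega, hb, hv⟩
        by_contra hab
        have := cnt_strict hb (not_le.1 hab)
        omega
      · omega

theorem min_le_card_image_mod (x y g : ℕ) :
    min g (y - x) ≤ ((Ico x y).image (fun v => v % g)).card := by
  have hsub : Ico x (x + min g (y - x)) ⊆ Ico x y := by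
    intro v
    simp only [mem_Ico]
    omega
  refine le_trans ?_ (card_le_card (image_subset_image hsub))
  rw [card_image_of_injOn, Nat.card_Ico]
  · omega
  · have key : ∀ a b, a ∈ Ico x (x + min g (y - x)) → b ∈ Ico x (x + min g (y - x)) → a ≤ b →
        a % g = b % g → a = b := by
      intro a b ha hb hab h
      rw [mem_Ico] at ha hb
      have hdvd : g ∣ b - a := (Nat.modEq_iff_dvd' hab).1 h
      have := Nat.eq_zero_of_dvd_of_lt hdvd (by omega)
      omega
    intro a ha b hb h
    rcases le_total a b with hab | hab
    · exact key a b ha hb hab h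
    · exact (key b a hb ha hab h.symm).symm

namespace Phase1

variable {I : Input} {W N : ℕ} (R : Phase1 I W N)

theorem W_pos (R : Phase1 I W N) : 0 < W := by
  have h : 0 < W * N := lt_of_le_of_lt (Nat.zero_le _) R.x₀_lt
  exact Nat.pos_of_mul_pos_right h

/-- The empty slots of `schedA` at time `u`. -/
def emptySlots (u : ℕ) : Finset (ℕ × Fin W) :=
  (univ.filter (fun k => R.schedA u k = none)).image (fun k => (u, k))

/-- The indicator of the event that group `j` is drawn for slot `σ`. -/
def drawn (j : Fin I.q) (σ : ℕ × Fin W) (X : ℕ × Fin W → Option (Fin I.q)) : ℕ :=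
  if X σ = some j then 1 else 0

theorem sum_emptySlots (f : ℕ × Fin W → ℕ) (u : ℕ) :
    ∑ σ ∈ R.emptySlots u, f σ = ∑ k, if R.schedA u k = none then f (u, k) else 0 := by
  unfold emptySlots
  rw [sum_image (fun a _ b _ h => (Prod.mk.inj h).2), sum_filter]

theorem pairwise_disjoint_emptySlots :
    Pairwise (fun u v => Disjoint (R.emptySlots u) (R.emptySlots v)) := by
  intro u v huv
  rw [disjoint_left]
  intro σ h1 h2
  simp only [emptySlots, mem_image] at h1 h2
  obtain ⟨k, -, rfl⟩ := h1
  obtain ⟨l, -, h⟩ := h2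
  exact huv (Prod.mk.inj h).1.symm

/-- Slot number `x`, in the order of time and of the channels, is empty in `schedA` and gets
group `j`. -/
def drawnAt (X : ℕ × Fin W → Option (Fin I.q)) (j : Fin I.q) (x : ℕ) : Prop :=
  R.schedA (x / W) ⟨x % W, Nat.mod_lt _ R.W_pos⟩ = none ∧
    X (x / W, ⟨x % W, Nat.mod_lt _ R.W_pos⟩) = some j

theorem drawnAt_mul_add (X : ℕ × Fin W → Option (Fin I.q)) (j : Fin I.q) (t : ℕ) (k : Fin W) :
    R.drawnAt X j (t * W + k) ↔ R.schedA t k = none ∧ X (t, k) = some j := by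
  unfold drawnAt
  have h1 : (t * W + k) / W = t := by
    rw [mul_comm, Nat.mul_add_div R.W_pos, Nat.div_eq_of_lt k.2, add_zero]
  have h2 : (⟨(t * W + k) % W, Nat.mod_lt _ R.W_pos⟩ : Fin W) = k := by
    apply Fin.ext
    simp [Nat.mod_eq_of_lt k.2]
  rw [h1, h2]

/-- Numbering slot `(t, k)` by `t * W + k` realizes the order of time and channels, so the
round-robin counter becomes a counting function on `ℕ`. -/
theorem drawCount_eq (X : ℕ × Fin W → Option (Fin I.q)) (j : Fin I.q) (t : ℕ) (k : Fin W) :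
    R.drawCount X j t k = cnt (R.drawnAt X j) (t * W + k) := by
  unfold drawCount cnt
  rw [@Nat.count_eq_card_filter_range _ (Classical.decPred _)]
  refine card_bij (fun σ _ => σ.1 * W + σ.2) ?_ ?_ ?_
  · rintro ⟨s, l⟩ h
    simp only [mem_filter, mem_product, mem_range, mem_univ, and_true] at h ⊢
    refine ⟨?_, (R.drawnAt_mul_add X j s l).2 h.2.2⟩
    have hl := l.2
    rcases Nat.lt_or_ge s t with hst | hst
    · calc s * W + l < s * W + W := by omega
        _ = (s + 1) * W := by ring
        _ ≤ t * W := Nat.mul_le_mul_right _ hst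
        _ ≤ _ := Nat.le_add_right _ _
    · have : s = t := by omega
      subst this
      have : l < k := by
        rcases h.2.1 with h | h
        · omega
        · exact h
      have : (l : ℕ) < k := this
      omega
  · rintro ⟨s, l⟩ _ ⟨s', l'⟩ _ heq
    simp only at heq
    have h1 : s = s' := by
      have e : ∀ (a : ℕ) (b : Fin W), (a * W + b) / W = a := fun a b => by
        rw [mul_comm, Nat.mul_add_div R.W_pos, Nat.div_eq_of_lt b.2, add_zero]
      rw [← e s l, heq, e]
    subst h1
    have : l = l' := Fin.ext (by omega)
    rw [this]
  · intro x hx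
    simp only [mem_filter, mem_range] at hx
    have hdm : x / W * W + x % W = x := Nat.div_add_mod' x W
    have hlt := Nat.mod_lt x R.W_pos
    refine ⟨(x / W, ⟨x % W, hlt⟩), ?_, hdm⟩
    simp only [mem_filter, mem_product, mem_range, mem_univ, and_true]
    have hxt : x / W ≤ t := by
      by_contra hc
      have : (t + 1) * W ≤ x / W * W := Nat.mul_le_mul_right _ (by omega)
      have hk := k.2
      have : (t + 1) * W = t * W + W := by ring
      omega
    refine ⟨by omega, ?_, hx.2⟩
    rcases Nat.lt_or_ge (x / W) t with h | h
    · exact Or.inl h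
    · right
      have : x / W = t := by omega
      rw [Fin.lt_def]
      simp only
      rw [this] at hdm
      omega

theorem cnt_drawnAt_mul (X : ℕ × Fin W → Option (Fin I.q)) (j : Fin I.q) (n : ℕ) :
    cnt (R.drawnAt X j) (n * W) = ∑ u ∈ range n, ∑ σ ∈ R.emptySlots u, drawn j σ X := by
  classical
  unfold cnt
  rw [@Nat.count_eq_card_filter_range _ (Classical.decPred _), card_filter,
    sum_range_mul_eq (fun x => @ite ℕ (R.drawnAt X j x) (Classical.decPred _ _) 1 0)]
  apply sum_congr rfl
  intro u _
  rw [R.sum_emptySlots (fun σ => drawn j σ X), Finset.sum_range]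
  apply sum_congr rfl
  intro k _
  unfold drawn
  by_cases h1 : R.schedA u k = none <;> by_cases h2 : X (u, k) = some j <;>
    simp [R.drawnAt_mul_add, h1, h2]

theorem cnt_drawnAt_add_drawsBetween (X : ℕ × Fin W → Option (Fin I.q)) (j : Fin I.q) {t s : ℕ}
    (h : t ≤ s) :
    cnt (R.drawnAt X j) ((t + 1) * W) +
      drawsBetween R.emptySlots t s (fun σ => drawn j σ X) =
      cnt (R.drawnAt X j) ((s + 1) * W) := by
  rw [cnt_drawnAt_mul, cnt_drawnAt_mul]
  unfold drawsBetween
  have : Ioc t s = Ico (t + 1) (s + 1) := by ext; simp only [mem_Ioc, mem_Ico]; omega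
  rw [this, sum_range_add_sum_Ico _ (by omega)]

theorem broadcasts_of_drawnAt {X : ℕ × Fin W → Option (Fin I.q)} {j : Fin I.q} {x : ℕ}
    (h : R.drawnAt X j x) :
    Broadcasts (R.output X) (x / W)
      (Sum.inr ⟨j, ⟨cnt (R.drawnAt X j) x % I.g j, Nat.mod_lt _ (I.g_pos j)⟩⟩) := by
  refine ⟨⟨x % W, Nat.mod_lt _ R.W_pos⟩, ?_⟩
  unfold output
  rw [h.1]
  simp only
  rw [h.2]
  simp only [drawCount_eq, Nat.div_add_mod']

/-- The draws of group `j` in the time slots `(t, s]` run through consecutive counter values, so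
they broadcast at least `min g (y - x)` different messages. -/
theorem card_not_broadcast_le (X : ℕ × Fin W → Option (Fin I.q)) (j : Fin I.q) {t s : ℕ}
    (h : t ≤ s) (F : Finset (Fin (I.g j)))
    (hF : ∀ k ∈ F, ∀ u, t + 1 ≤ u → u < s + 1 → ¬ Broadcasts (R.output X) u (Sum.inr ⟨j, k⟩)) :
    (F.card : ℝ) ≤ shortage R.emptySlots (I.g j) t s (fun σ => drawn j σ X) := by
  unfold shortage
  rw [Nat.cast_le]
  set x := cnt (R.drawnAt X j) ((t + 1) * W)
  set y := cnt (R.drawnAt X j) ((s + 1) * W)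
  have hxy := R.cnt_drawnAt_add_drawsBetween X j h
  have hg := I.g_pos j
  have hcard := min_le_card_image_mod x y (I.g j)
  have hsub : (F.image Fin.val) ∪ ((Ico x y).image (fun v => v % I.g j)) ⊆ range (I.g j) := by
    intro v
    simp only [mem_union, mem_image, mem_range]
    rintro (⟨k, -, rfl⟩ | ⟨v, -, rfl⟩)
    · exact k.2
    · exact Nat.mod_lt _ hg
  have hdis : Disjoint (F.image Fin.val) ((Ico x y).image (fun v => v % I.g j)) := by
    rw [disjoint_left]
    intro v h1 h2
    simp only [mem_image] at h1 h2
    obtain ⟨k, hk, rfl⟩ := h1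
    obtain ⟨v, hv, hvk⟩ := h2
    rw [mem_Ico] at hv
    obtain ⟨z, hz1, hz2, hz3, hz4⟩ := exists_cnt_eq hv.1 hv.2
    have hb := R.broadcasts_of_drawnAt hz3
    have hk' : (⟨cnt (R.drawnAt X j) z % I.g j, Nat.mod_lt _ (I.g_pos j)⟩ : Fin (I.g j)) = k :=
      Fin.ext (by simp only [hz4]; exact hvk)
    rw [hk'] at hb
    refine hF k hk (z / W) ?_ ?_ hb
    · rwa [Nat.le_div_iff_mul_le R.W_pos]
    · rwa [Nat.div_lt_iff_lt_mul R.W_pos]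
  have h3 := card_le_card hsub
  rw [card_union_of_disjoint hdis, card_image_of_injective _ Fin.val_injective, card_range] at h3
  omega

/-- The waiting times of the messages of a group, in terms of the draws. -/
theorem sum_pairs_group_le (X : ℕ × Fin W → Option (Fin I.q)) (j : Fin I.q) (n : ℕ) :
    ∑ k, (pairs (fun u => Broadcasts (R.output X) u (Sum.inr ⟨j, k⟩)) n : ℝ) / 2 ≤
      ∑ s ∈ range n, ageSum R.emptySlots (I.g j) s (fun σ => drawn j σ X) := by
  classical
  set P : Fin (I.g j) → ℕ → Prop := fun k u => Broadcasts (R.output X) u (Sum.inr ⟨j, k⟩)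
  have h1 : ∀ k, (pairs (P k) n : ℝ) / 2 ≤ ∑ t ∈ range n, ∑ s ∈ range n,
      if t ≤ s ∧ cnt (P k) (t + 1) = cnt (P k) (s + 1) then (1 : ℝ) else 0 := by
    intro k
    have h := pairs_add_eq (P k) n
    have h' : (pairs (P k) n : ℝ) + n = 2 * ∑ t ∈ range n, ∑ s ∈ range n,
        if t ≤ s ∧ cnt (P k) (t + 1) = cnt (P k) (s + 1) then (1 : ℝ) else 0 := by
      simp only [card_filter] at h
      exact_mod_cast h
    have : (0 : ℝ) ≤ n := Nat.cast_nonneg n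
    linarith
  refine (sum_le_sum (fun k _ => h1 k)).trans ?_
  have h2 : (∑ k, ∑ t ∈ range n, ∑ s ∈ range n,
      if t ≤ s ∧ cnt (P k) (t + 1) = cnt (P k) (s + 1) then (1 : ℝ) else 0) =
      ∑ s ∈ range n, ∑ t ∈ range n, ∑ k,
      if t ≤ s ∧ cnt (P k) (t + 1) = cnt (P k) (s + 1) then (1 : ℝ) else 0 := by
    rw [sum_comm, sum_comm (s := range n) (t := range n)]
    apply sum_congr rfl; intro t _
    rw [sum_comm]
  rw [h2]
  apply sum_le_sum
  intro s hs
  unfold ageSum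
  have hsub : range (s + 1) ⊆ range n := range_subset_range.2 (mem_range.1 hs)
  rw [← sum_subset hsub]
  · apply sum_le_sum
    intro t ht
    have hts : t ≤ s := by have := mem_range.1 ht; omega
    rw [← sum_filter, sum_const, nsmul_eq_mul, mul_one]
    apply R.card_not_broadcast_le X j hts
    intro k hk u h1 h2
    simp only [mem_filter, mem_univ, true_and] at hk
    exact (cnt_eq_iff (by omega)).1 hk.2 u h1 h2
  · intro t _ ht
    apply sum_eq_zero
    intro k _
    rw [if_neg]
    simp only [mem_range] at ht
    omega

theorem sum_occ_group (X : ℕ × Fin W → Option (Fin I.q)) (j : Fin I.q) (n : ℕ) :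
    ∑ k, occ (R.output X) n (Sum.inr ⟨j, k⟩) =
      ∑ s ∈ range n, ∑ σ ∈ R.emptySlots s, drawn j σ X := by
  classical
  unfold occ
  rw [sum_comm]
  apply sum_congr rfl; intro t _
  rw [sum_comm, R.sum_emptySlots (fun σ => drawn j σ X)]
  apply sum_congr rfl; intro k _
  unfold output drawn
  cases h1 : R.schedA t k with
  | some i => simp
  | none =>
    cases h2 : X (t, k) with
    | none => simp
    | some j' =>
      simp only
      by_cases hj : j' = j
      · subst hj
        simp [Finset.sum_ite_eq]
      · have : ∀ l : Fin (I.g j), (some (Sum.inr ⟨j', ⟨R.drawCount X j' t k % I.g j',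
            Nat.mod_lt _ (I.g_pos j')⟩⟩) : Option I.Msg) ≠ some (Sum.inr ⟨j, l⟩) := by
          intro l h
          simp only [Option.some.injEq, Sum.inr.injEq, Sigma.mk.injEq] at h
          exact hj h.1
        simp [this, hj]

theorem broadcasts_inl_iff (X : ℕ × Fin W → Option (Fin I.q)) (t : ℕ) (i : Fin I.a) :
    Broadcasts (R.output X) t (Sum.inl i) ↔ Broadcasts R.schedA t i := by
  have : ∀ k, R.output X t k = some (Sum.inl i) ↔ R.schedA t k = some i := by
    intro k
    unfold output
    cases h1 : R.schedA t k with
    | some i => simp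
    | none => cases h2 : X (t, k) <;> simp
  simp only [Broadcasts, this]

theorem occ_inl (X : ℕ × Fin W → Option (Fin I.q)) (n : ℕ) (i : Fin I.a) :
    occ (R.output X) n (Sum.inl i) = occ R.schedA n i := by
  classical
  unfold occ
  apply sum_congr rfl; intro t _; apply sum_congr rfl; intro k _
  have : R.output X t k = some (Sum.inl i) ↔ R.schedA t k = some i := by
    unfold output
    cases h1 : R.schedA t k with
    | some i => simp
    | none => cases h2 : X (t, k) <;> simp
  by_cases h : R.schedA t k = some i
  · rw [if_pos h, if_pos (this.2 h)]
  · rw [if_neg h, if_neg (fun h2 => h (this.1 h2))]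

theorem total_output_le (X : ℕ × Fin W → Option (Fin I.q)) (n : ℕ) :
    total I.prob I.bcost (R.output X) n ≤ total I.pA I.cA R.schedA n +
      ∑ j, (I.pB j * ∑ s ∈ range n, ageSum R.emptySlots (I.g j) s (fun σ => drawn j σ X) +
        I.cB j * ∑ s ∈ range n, ((∑ σ ∈ R.emptySlots s, drawn j σ X : ℕ) : ℝ)) := by
  unfold total
  rw [Fintype.sum_sum_type]
  apply add_le_add
  · apply le_of_eq
    apply sum_congr rfl
    intro i _
    simp only [broadcasts_inl_iff, occ_inl]
    rfl
  · rw [Fintype.sum_sigma]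
    apply sum_le_sum
    intro j _
    simp only [Input.prob, Input.bcost, Sum.elim_inr]
    rw [sum_add_distrib, ← mul_sum, ← mul_sum]
    apply add_le_add
    · exact mul_le_mul_of_nonneg_left (R.sum_pairs_group_le X j n) (I.pB_pos j).le
    · apply le_of_eq
      congr 1
      have := R.sum_occ_group X j n
      exact_mod_cast this

end Phase1

end DataBroadcast

end

noncomputable section

namespace DataBroadcast

open Finset MeasureTheory ProbabilityTheory

/-! ### The expected cost of the algorithm -/

namespace Phase1

variable {I : Input} {W N : ℕ} (R : Phase1 I W N)

instance : IsProbabilityMeasure R.drawMeasure := by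
  unfold drawMeasure; infer_instance

theorem measurable_drawn (j : Fin I.q) (σ : ℕ × Fin W) :
    Measurable (fun X : ℕ × Fin W → Option (Fin I.q) => drawn j σ X) := by
  have h : Measurable (fun o : Option (Fin I.q) => if o = some j then 1 else 0 : _ → ℕ) :=
    measurable_from_top
  exact h.comp (measurable_pi_apply σ)

theorem iIndepFun_drawn (j : Fin I.q) : iIndepFun (fun σ X => drawn j σ X) R.drawMeasure :=
  iIndepFun_infinitePi (P := fun _ : ℕ × Fin W => R.draw.toMeasure)
    (X := fun _ o => if o = some j then 1 else 0) (fun _ => measurable_from_top)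

theorem integral_drawn (j : Fin I.q) (σ : ℕ × Fin W) :
    ∫ X, (drawn j σ X : ℝ) ∂(R.drawMeasure) = R.drawProb (some j) := by
  have h1 : ∫ X, (drawn j σ X : ℝ) ∂(R.drawMeasure) =
      ∫ o, (if o = some j then (1 : ℝ) else 0) ∂(R.draw.toMeasure) := by
    have hm := measurePreserving_eval_infinitePi (fun _ : ℕ × Fin W => R.draw.toMeasure) σ
    rw [← hm.map_eq, integral_map hm.measurable.aemeasurable]
    · apply integral_congr_ae
      refine Filter.Eventually.of_forall (fun X => ?_)
      simp only [drawn, Function.eval]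
      split_ifs <;> simp
    · exact (measurable_from_top (f := fun o : Option (Fin I.q) =>
        if o = some j then (1 : ℝ) else 0)).aestronglyMeasurable
  rw [h1, PMF.integral_eq_sum]
  simp only [smul_eq_mul, mul_ite, mul_one, mul_zero, sum_ite_eq', mem_univ, if_true]
  unfold draw
  rw [PMF.ofFintype_apply, ENNReal.toReal_ofReal (R.drawProb_nonneg _)]

theorem drawn_le_one (j : Fin I.q) (σ : ℕ × Fin W) (X : ℕ × Fin W → Option (Fin I.q)) :
    drawn j σ X ≤ 1 := by
  unfold drawn; split_ifs <;> omega

theorem drawProb_le_one (o : Option (Fin I.q)) : R.drawProb o ≤ 1 := by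
  rw [← R.drawProb_sum]
  exact single_le_sum (fun o _ => R.drawProb_nonneg o) (mem_univ o)

theorem drawProb_some_pos (j : Fin I.q) : 0 < R.drawProb (some j) := by
  have h1 := R.freeRate_pos
  have h2 := R.τ_feasible.1 j
  simp only [drawProb]
  positivity

theorem card_emptySlots (u : ℕ) : (R.emptySlots u).card + ∑ k, (R.schedA u k).elim 0 (fun _ => 1)
    = W := by
  have h1 : (R.emptySlots u).card = ∑ k, if R.schedA u k = none then 1 else 0 := by
    rw [card_eq_sum_ones, R.sum_emptySlots (fun _ => 1)]
  rw [h1, ← sum_add_distrib]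
  have : ∀ k, (if R.schedA u k = none then 1 else 0) + (R.schedA u k).elim 0 (fun _ => 1) = 1 := by
    intro k
    cases R.schedA u k <;> simp
  simp [this]

/-- A period of `schedA` and the number of its empty slots. -/
theorem exists_period : ∃ P E : ℕ, 0 < P ∧ P ≤ N ∧ 0 < E ∧ (E : ℝ) = (1 - R.α₀) * W * P ∧
    ∀ t k, ∑ u ∈ range (k * P), (R.emptySlots (t + u)).card = k * E := by
  obtain ⟨P, hP1, hPN, hper, hdens⟩ := (R.sched_optimal R.x₀ R.one_le_x₀ R.x₀_lt).1
  have hP : 0 < P := hP1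
  set f : ℕ → ℕ := fun u => (R.emptySlots u).card with hf
  have hfper : ∀ u, f (u + P) = f u := by
    intro u
    have h1 := R.card_emptySlots (u + P)
    have h2 := R.card_emptySlots u
    have : R.schedA (u + P) = R.schedA u := hper u
    rw [this] at h1
    simp only [hf]
    omega
  have hshift : ∀ t, ∑ u ∈ range P, f (t + u) = ∑ u ∈ range P, f u := by
    intro t
    induction t with
    | zero => simp
    | succ t ih =>
      rw [← ih]
      have h1 := sum_range_succ (fun u => f (t + u)) P
      have h2 := sum_range_succ' (fun u => f (t + u)) P
      rw [h1] at h2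
      simp only [add_zero, hfper] at h2
      have h3 : ∑ u ∈ range P, f (t + 1 + u) = ∑ u ∈ range P, f (t + (u + 1)) := by
        apply sum_congr rfl; intro u _; congr 1; ring
      rw [h3]
      omega
  set E := ∑ u ∈ range P, f u with hE
  have hPr : (0 : ℝ) < P := by exact_mod_cast hP
  have hWr : (0 : ℝ) < W := by exact_mod_cast R.W_pos
  have hEeq : (E : ℝ) = (1 - R.α₀) * W * P := by
    have hα : R.α₀ = finDensity R.schedA P := by rw [α₀, ← hdens]; rfl
    have h1 : (E : ℝ) + ∑ t ∈ range P, ∑ k, (R.schedA t k).elim (0 : ℝ) (fun _ => 1) = W * P := by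
      have h2 : ∀ u, (f u : ℝ) + ∑ k, (R.schedA u k).elim (0 : ℝ) (fun _ => 1) = W := by
        intro u
        have h3 : ((f u + ∑ k, (R.schedA u k).elim 0 (fun _ => 1) : ℕ) : ℝ) = W := by
          exact_mod_cast R.card_emptySlots u
        rw [← h3]
        push_cast
        congr 1
        apply sum_congr rfl
        intro k _
        cases R.schedA u k <;> simp
      rw [hE]
      push_cast
      rw [← sum_add_distrib, sum_congr rfl (fun u _ => h2 u)]
      simp [mul_comm]
    rw [hα, finDensity]
    field_simp
    linarith
  refine ⟨P, E, hP, hPN, ?_, hEeq, ?_⟩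
  · have : (0 : ℝ) < E := by rw [hEeq]; exact mul_pos R.freeRate_pos hPr
    exact_mod_cast this
  · intro t k
    rw [sum_range_mul_eq]
    have : ∀ i ∈ range k, ∑ u ∈ range P, (R.emptySlots (t + (i * P + u))).card = E := by
      intro i _
      rw [← hshift (t + i * P)]
      apply sum_congr rfl; intro u _
      simp only [hf, add_assoc]
    rw [sum_congr rfl this]
    simp

/-- If the groups are large, the random slots of `B` cost at most `1 + η` times the value of the
relaxation. -/
theorem expectedCost_le {η : ℝ} (hg : ∀ j, 2 * (N : ℝ) * W + 1 ≤ η * I.g j) :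
    R.expectedCost ≤ cost I.pA I.cA R.schedA +
      ENNReal.ofReal ((1 + η) * I.lb W (1 - R.α₀)) := by
  obtain ⟨P, E, hP, hPN, hE, hEeq, hEmpty⟩ := R.exists_period
  have hfree := R.freeRate_pos
  have hPr : (0 : ℝ) < P := by exact_mod_cast hP
  have hWr : (0 : ℝ) < W := by exact_mod_cast R.W_pos
  have hPN' : (P : ℝ) ≤ N := by exact_mod_cast hPN
  have hτ := R.τ_feasible.1
  -- The draw probabilities are calibrated for this: the `E` empty slots of a period yield `P / τ j`
  -- draws of group `j` on average.
  have hqE : ∀ j, R.drawProb (some j) * E = P / R.τ j := by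
    intro j
    have := hτ j
    have h1 : (1 - R.α₀) ≠ 0 := by
      intro h; rw [h, zero_mul] at hfree; exact lt_irrefl _ hfree
    rw [hEeq]
    simp only [drawProb]
    field_simp
  have hcard : ∀ t d, d / P * E ≤ ∑ u ∈ Ioc t (t + d), (R.emptySlots u).card := by
    intro t d
    have h1 : Ioc t (t + d) = Ico (t + 1) (t + 1 + d) := by
      ext; simp only [mem_Ioc, mem_Ico]; omega
    rw [h1, sum_Ico_eq_sum_range, Nat.add_sub_cancel_left, ← hEmpty (t + 1)]
    exact sum_le_sum_of_subset (range_subset_range.2 (Nat.div_mul_le_self d P))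
  have hage : ∀ j, ∀ᵐ X ∂(R.drawMeasure), ∀ δ > 0, ∀ᶠ n : ℕ in Filter.atTop,
      (∑ s ∈ range n, ageSum R.emptySlots (I.g j) s (fun σ => drawn j σ X)) / n ≤
        P * (I.g j + I.g j * (I.g j + 1) / (2 * R.drawProb (some j)) / E) + δ := fun j =>
    ae_ageSum_mean_le (measurable_drawn j) (R.iIndepFun_drawn j) (drawn_le_one j)
      (R.integral_drawn j) (R.drawProb_some_pos j) (R.drawProb_le_one _)
      R.pairwise_disjoint_emptySlots hE hP hcard (I.g j)
  have hcount : ∀ j, ∀ᵐ X ∂(R.drawMeasure), ∀ δ > 0, ∀ᶠ n : ℕ in Filter.atTop,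
      (∑ s ∈ range n, ((∑ σ ∈ R.emptySlots s, drawn j σ X : ℕ) : ℝ)) / n ≤ 1 / R.τ j + δ := by
    intro j
    refine ae_draws_mean_le (measurable_drawn j) (R.iIndepFun_drawn j) (drawn_le_one j)
      (R.integral_drawn j) R.pairwise_disjoint_emptySlots (by have := hτ j; positivity)
      (D := P / R.τ j) ?_ (m := W) (fun u => by have := R.card_emptySlots u; omega)
    intro n
    have h1 : ∑ u ∈ range n, (R.emptySlots u).card ≤ (n / P + 1) * E := by
      rw [← hEmpty 0]
      simp only [zero_add]
      apply sum_le_sum_of_subset (range_subset_range.2 _)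
      have := Nat.lt_mul_div_succ n hP
      rw [mul_comm]; omega
    have h1' : ((∑ u ∈ range n, (R.emptySlots u).card : ℕ) : ℝ) ≤ ((n / P : ℕ) + 1) * E := by
      exact_mod_cast h1
    have h2 : (((n / P : ℕ) : ℝ)) * P ≤ n := by exact_mod_cast Nat.div_mul_le_self n P
    have h3 := mul_le_mul_of_nonneg_left h1' (R.drawProb_some_pos j).le
    have hj := hτ j
    calc _ ≤ R.drawProb (some j) * (((n / P : ℕ) + 1) * E) := h3
      _ = ((n / P : ℕ) + 1) * (R.drawProb (some j) * E) := by ring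
      _ = ((n / P : ℕ) * P + P) / R.τ j := by rw [hqE]; ring
      _ ≤ (n + P) / R.τ j := by gcongr
      _ = n * (1 / R.τ j) + P / R.τ j := by ring
  -- The expected age sum `P g + τ g (g + 1) / 2` exceeds `τ g ^ 2 / 2` by at most `τ g (2 N W + 1)
  -- / 2`, because `P ≤ N` and `1 ≤ τ W`. This is the form in which `hg` bounds the excess.
  have hbound : ∀ j, I.pB j * (P * (I.g j + I.g j * (I.g j + 1) / (2 * R.drawProb (some j)) / E)) +
      I.cB j * (1 / R.τ j) ≤
      (1 + η) * (I.pB j * (I.g j : ℝ) ^ 2 * R.τ j / 2 + I.cB j / R.τ j) := by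
    intro j
    have hj := hτ j
    have hgj : (0 : ℝ) < I.g j := by exact_mod_cast I.g_pos j
    have hN0 : (0 : ℝ) ≤ N := Nat.cast_nonneg N
    have hη : 0 ≤ η := by
      by_contra hneg
      have := hg j
      have : 0 ≤ 2 * (N : ℝ) * W := by positivity
      nlinarith
    have hE0 : (E : ℝ) ≠ 0 := by exact_mod_cast hE.ne'
    have hq0 := (R.drawProb_some_pos j).ne'
    have e1 : P * (I.g j + I.g j * (I.g j + 1) / (2 * R.drawProb (some j)) / E) =
        P * I.g j + R.τ j * (I.g j * (I.g j + 1)) / 2 := by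
      have : I.g j * (I.g j + 1) / (2 * R.drawProb (some j)) / (E : ℝ) =
          I.g j * (I.g j + 1) / (2 * (R.drawProb (some j) * E)) := by
        rw [div_div, mul_assoc]
      rw [this, hqE]
      field_simp
    have hτW : 1 ≤ R.τ j * W := by
      have h1 : 1 / R.τ j ≤ (1 - R.α₀) * W := I.inv_le_of_feasible R.τ_feasible j
      have h2 : 0 ≤ R.α₀ := by unfold α₀; positivity
      rw [div_le_iff₀ hj] at h1
      nlinarith [mul_nonneg h2 (mul_nonneg hWr.le hj.le)]
    have e2 : P * I.g j + R.τ j * (I.g j * (I.g j + 1)) / 2 ≤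
        (1 + η) * ((I.g j : ℝ) ^ 2 * R.τ j / 2) := by
      have h1 : P * I.g j ≤ N * (R.τ j * W) * I.g j := by
        apply mul_le_mul_of_nonneg_right _ hgj.le
        nlinarith
      have h2 := mul_le_mul_of_nonneg_left (hg j) (mul_pos hj hgj).le
      nlinarith
    rw [e1, mul_add]
    have e3 := mul_le_mul_of_nonneg_left e2 (I.pB_pos j).le
    have e4 : 0 ≤ I.cB j / R.τ j := div_nonneg (I.cB_nonneg j) hj.le
    have e5 := mul_nonneg hη e4
    rw [mul_one_div]
    nlinarith
  set Bn : (ℕ × Fin W → Option (Fin I.q)) → ℕ → ℝ := fun X n =>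
    ∑ j, (I.pB j * ∑ s ∈ range n, ageSum R.emptySlots (I.g j) s (fun σ => drawn j σ X) +
        I.cB j * ∑ s ∈ range n, ((∑ σ ∈ R.emptySlots s, drawn j σ X : ℕ) : ℝ)) with hBn
  -- The bound is deterministic and holds almost surely, so it passes to the expectation without any
  -- measurability of the cost.
  have hae : ∀ᵐ X ∂(R.drawMeasure), cost I.prob I.bcost (R.output X) ≤
      cost I.pA I.cA R.schedA + ENNReal.ofReal ((1 + η) * I.lb W (1 - R.α₀)) := by
    filter_upwards [ae_all_iff.2 hage, ae_all_iff.2 hcount] with X hX1 hX2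
    unfold cost
    simp only [fin_cost_eq]
    have h1 : ∀ n, ENNReal.ofReal (total I.prob I.bcost (R.output X) n / n) ≤
        ENNReal.ofReal (total I.pA I.cA R.schedA n / n) + ENNReal.ofReal (Bn X n / n) := by
      intro n
      refine le_trans (ENNReal.ofReal_le_ofReal ?_) ENNReal.ofReal_add_le
      rw [← add_div]
      exact div_le_div_of_nonneg_right (R.total_output_le X n) (Nat.cast_nonneg n)
    refine (Filter.limsup_le_limsup (Filter.Eventually.of_forall h1)).trans ?_
    apply limsup_add_ofReal_le
    intro δ hδ
    have hD0 : 0 ≤ ∑ j, (I.pB j + I.cB j) :=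
      sum_nonneg (fun j _ => add_nonneg (I.pB_pos j).le (I.cB_nonneg j))
    set δ' := δ / (1 + ∑ j, (I.pB j + I.cB j)) with hδ'
    have hδ'0 : 0 < δ' := by positivity
    filter_upwards [Filter.eventually_all.2 (fun j => hX1 j δ' hδ'0),
      Filter.eventually_all.2 (fun j => hX2 j δ' hδ'0)] with n hn1 hn2
    have hlb : I.lb W (1 - R.α₀) = I.lbObj R.τ := I.lb_eq R.τ_feasible R.τ_optimal
    rw [hlb]
    have e1 : Bn X n / n = ∑ j, (I.pB j * ((∑ s ∈ range n,
        ageSum R.emptySlots (I.g j) s (fun σ => drawn j σ X)) / n) +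
        I.cB j * ((∑ s ∈ range n, ((∑ σ ∈ R.emptySlots s, drawn j σ X : ℕ) : ℝ)) / n)) := by
      simp only [hBn]
      rw [sum_div]
      apply sum_congr rfl
      intro j _
      ring
    rw [e1]
    have e2 : ∀ j, I.pB j * ((∑ s ∈ range n,
        ageSum R.emptySlots (I.g j) s (fun σ => drawn j σ X)) / n) +
        I.cB j * ((∑ s ∈ range n, ((∑ σ ∈ R.emptySlots s, drawn j σ X : ℕ) : ℝ)) / n) ≤
        (1 + η) * (I.pB j * (I.g j : ℝ) ^ 2 * R.τ j / 2 + I.cB j / R.τ j) +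
        (I.pB j + I.cB j) * δ' := by
      intro j
      have f1 := mul_le_mul_of_nonneg_left (hn1 j) (I.pB_pos j).le
      have f2 := mul_le_mul_of_nonneg_left (hn2 j) (I.cB_nonneg j)
      have f3 := hbound j
      linarith
    refine (sum_le_sum (fun j _ => e2 j)).trans ?_
    rw [sum_add_distrib, ← mul_sum, ← sum_mul]
    have e3 : (∑ j, (I.pB j + I.cB j)) * δ' ≤ δ := by
      rw [hδ', mul_div_assoc', div_le_iff₀ (by positivity)]
      nlinarith
    unfold Input.lbObj
    linarith
  unfold expectedCost
  refine (lintegral_mono_ae hae).trans ?_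
  rw [lintegral_const, measure_univ, mul_one]

end Phase1

end DataBroadcast

end

/-! ### Lower half: an arbitrary schedule compared with the candidates of the algorithm. -/

noncomputable section

namespace DataBroadcast

open Finset

/-! ### Pairs of slots without a broadcast in between -/

theorem card_pairs_eq_sum_sq (T V : Finset ℕ) (c : ℕ → ℕ) (h : ∀ t ∈ T, c t ∈ V) :
    ((T ×ˢ T).filter (fun x => c x.1 = c x.2)).card =
      ∑ v ∈ V, (T.filter (fun t => c t = v)).card ^ 2 := by
  rw [card_eq_sum_card_fiberwise (f := fun x => c x.1) (t := V)]
  · apply sum_congr rfl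
    intro v _
    rw [sq, ← card_product]
    congr 1
    ext x
    simp only [mem_filter, mem_product]
    constructor
    · rintro ⟨⟨⟨h1, h2⟩, h3⟩, h4⟩
      exact ⟨⟨h1, h4⟩, h2, by rw [← h3, h4]⟩
    · rintro ⟨⟨h1, h2⟩, h3, h4⟩
      exact ⟨⟨⟨h1, h3⟩, by rw [h2, h4]⟩, h2⟩
  · intro x hx
    simp only [coe_filter, mem_product, Set.mem_ofPred_eq] at hx
    exact h _ hx.1.1

/-- Cauchy-Schwarz: the `P`-slots cut the `n` slots into at most `cnt P n + 1` classes, and `pairs`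
is the sum of the squared class sizes. -/
theorem sq_le_mul_pairs (P : ℕ → Prop) (n : ℕ) : n ^ 2 ≤ (cnt P n + 1) * pairs P n := by
  unfold pairs
  have hV : ∀ t ∈ range n, cnt P (t + 1) ∈ range (cnt P n + 1) := by
    intro t ht
    rw [mem_range] at ht ⊢
    exact Nat.lt_succ_of_le (cnt_mono P ht)
  rw [card_pairs_eq_sum_sq (range n) (range (cnt P n + 1)) (fun t => cnt P (t + 1)) hV]
  have h1 := card_eq_sum_card_fiberwise hV
  rw [card_range] at h1
  have h2 := sq_sum_le_card_mul_sum_sq (s := range (cnt P n + 1))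
    (f := fun v => ((range n).filter (fun t => cnt P (t + 1) = v)).card)
  rw [card_range] at h2
  rw [← h1] at h2
  simpa using h2

theorem pairs_add_le (P : ℕ → Prop) (a b : ℕ) :
    pairs P a + pairs (fun u => P (a + u)) b ≤ pairs P (a + b) := by
  unfold pairs
  set F := (range b ×ˢ range b).filter
    (fun x => cnt (fun u => P (a + u)) (x.1 + 1) = cnt (fun u => P (a + u)) (x.2 + 1))
  have hinj : Function.Injective (fun x : ℕ × ℕ => (a + x.1, a + x.2)) := by
    rintro ⟨x1, x2⟩ ⟨y1, y2⟩ h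
    simp only [Prod.mk.injEq] at h ⊢
    omega
  rw [← card_image_of_injective F hinj, ← card_union_of_disjoint]
  · apply card_le_card
    intro x
    simp only [mem_union, mem_filter, mem_product, mem_range, mem_image, F]
    rintro (⟨⟨h1, h2⟩, h3⟩ | ⟨y, ⟨⟨h1, h2⟩, h3⟩, rfl⟩)
    · exact ⟨⟨by omega, by omega⟩, h3⟩
    · refine ⟨⟨by simpa using h1, by simpa using h2⟩, ?_⟩
      simp only [add_assoc, cnt_add, h3]
  · rw [disjoint_left]
    rintro x hx hx'
    simp only [mem_filter, mem_product, mem_range, mem_image] at hx hx'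
    obtain ⟨y, _, rfl⟩ := hx'
    simp only at hx
    omega

theorem sum_pairs_le (P : ℕ → Prop) (m Q : ℕ) :
    ∑ w ∈ range Q, pairs (fun u => P (w * m + u)) m ≤ pairs P (Q * m) := by
  induction Q with
  | zero => simp
  | succ Q ih =>
    rw [sum_range_succ, Nat.add_mul, one_mul]
    exact (Nat.add_le_add_right ih _).trans (pairs_add_le P (Q * m) m)

/-! ### Inserting empty slots -/

/-- After every `h` slots of the first `r * h` slots an empty slot is inserted, namely after those
at positions congruent to `θ`. The new slot `x` shows the old slot `source h r θ x`. -/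
def source (h r θ x : ℕ) : ℕ :=
  if x < r * (h + 1) then
    x / (h + 1) * h + if x % (h + 1) ≤ θ then x % (h + 1) else x % (h + 1) - 1
  else x - r

/-- The new slot `x` is an inserted one. -/
def Inserted (h r θ x : ℕ) : Prop := x < r * (h + 1) ∧ x % (h + 1) = θ + 1

instance (h r θ x : ℕ) : Decidable (Inserted h r θ x) :=
  inferInstanceAs (Decidable (_ ∧ _))

section Stretch

variable {h r θ : ℕ}

theorem block_div_mod {y z : ℕ} (hz : z < h + 1) :
    (y * (h + 1) + z) / (h + 1) = y ∧ (y * (h + 1) + z) % (h + 1) = z := by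
  constructor
  · rw [mul_comm, Nat.mul_add_div (by omega), Nat.div_eq_of_lt hz, add_zero]
  · rw [mul_comm, Nat.mul_add_mod, Nat.mod_eq_of_lt hz]

theorem block_lt {y z : ℕ} (hy : y < r) (hz : z < h + 1) : y * (h + 1) + z < r * (h + 1) := by
  calc y * (h + 1) + z < y * (h + 1) + (h + 1) := by omega
    _ = (y + 1) * (h + 1) := by ring
    _ ≤ r * (h + 1) := Nat.mul_le_mul_right _ hy

theorem source_block {y z : ℕ} (hy : y < r) (hz : z < h + 1) :
    source h r θ (y * (h + 1) + z) = y * h + if z ≤ θ then z else z - 1 := by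
  unfold source
  rw [if_pos (block_lt hy hz), (block_div_mod hz).1, (block_div_mod hz).2]

theorem inserted_block {y z : ℕ} (hy : y < r) (hz : z < h + 1) :
    Inserted h r θ (y * (h + 1) + z) ↔ z = θ + 1 := by
  unfold Inserted
  rw [(block_div_mod hz).2]
  exact ⟨fun h => h.2, fun h => ⟨block_lt hy hz, h⟩⟩

theorem source_tail (e : ℕ) : source h r θ (r * (h + 1) + e) = r * h + e := by
  unfold source
  rw [if_neg (by omega), Nat.mul_succ]
  omega

theorem not_inserted_tail (e : ℕ) : ¬ Inserted h r θ (r * (h + 1) + e) := by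
  unfold Inserted; omega

theorem source_zero : source h r θ 0 = 0 := by
  unfold source
  simp

theorem not_inserted_zero : ¬ Inserted h r θ 0 := by
  unfold Inserted; simp

theorem source_succ (hθ : θ < h) (x : ℕ) :
    source h r θ (x + 1) = source h r θ x + if Inserted h r θ (x + 1) then 0 else 1 := by
  rcases Nat.lt_or_ge x (r * (h + 1)) with hx | hx
  · obtain ⟨y, z, hz, rfl⟩ : ∃ y z, z < h + 1 ∧ x = y * (h + 1) + z :=
      ⟨x / (h + 1), x % (h + 1), Nat.mod_lt _ (by omega), (Nat.div_add_mod' _ _).symm⟩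
    have hy : y < r := by
      by_contra hc
      have : r * (h + 1) ≤ y * (h + 1) := Nat.mul_le_mul_right _ (not_lt.1 hc)
      omega
    rw [source_block hy hz]
    rcases Nat.lt_or_ge (z + 1) (h + 1) with hz1 | hz1
    · rw [add_assoc, source_block hy hz1]
      simp only [inserted_block hy hz1]
      split_ifs <;> omega
    · have hzh : z = h := by omega
      subst hzh
      have e1 : y * (z + 1) + z + 1 = (y + 1) * (z + 1) + 0 := by ring
      rw [e1]
      rcases Nat.lt_or_ge (y + 1) r with hy1 | hy1
      · rw [source_block hy1 (by omega)]
        simp only [inserted_block hy1 (show 0 < z + 1 by omega)]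
        rw [if_pos (Nat.zero_le _), if_neg (by omega), if_neg (by omega), Nat.succ_mul]
        omega
      · have : y + 1 = r := by omega
        rw [this, source_tail, if_neg (not_inserted_tail 0), if_neg (by omega), ← this,
          Nat.succ_mul]
        omega
  · obtain ⟨e, rfl⟩ := Nat.exists_eq_add_of_le hx
    rw [add_assoc, source_tail, source_tail, if_neg (not_inserted_tail _)]
    omega

/-- The slots of `P` after the insertion. -/
def stretched (h r θ : ℕ) (P : ℕ → Prop) (x : ℕ) : Prop :=
  ¬ Inserted h r θ x ∧ P (source h r θ x)

/-- `source` advances exactly at the slots that are not inserted, so counting commutes with it. -/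
theorem cnt_stretched (hθ : θ < h) (P : ℕ → Prop) (x : ℕ) :
    cnt (stretched h r θ P) (x + 1) = cnt P (source h r θ x + 1) := by
  classical
  induction x with
  | zero =>
    rw [source_zero, cnt_succ, cnt_succ, cnt_zero, cnt_zero]
    unfold stretched
    simp [not_inserted_zero, source_zero]
  | succ x ih =>
    rw [cnt_succ, ih, source_succ hθ]
    unfold stretched
    by_cases hi : Inserted h r θ (x + 1)
    · simp [hi]
    · rw [source_succ hθ]
      simp only [hi, not_false_eq_true, true_and, if_false]
      rw [cnt_succ P (source h r θ x + 1)]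

/-- Every old slot is the source of one slot that is not inserted, and the `r` slots `y * h + θ` are
also sources of inserted ones. The choice `f' = f` serves for pairs, `f' = 0` for broadcasts. -/
theorem sum_stretched {β : Type*} [AddCommMonoid β] (hθ : θ < h) (s : ℕ) (f f' : ℕ → β) :
    (∑ x ∈ range (r * (h + 1) + s),
      if Inserted h r θ x then f' (source h r θ x) else f (source h r θ x)) =
      ∑ u ∈ range (r * h + s), f u + ∑ y ∈ range r, f' (y * h + θ) := by
  rw [sum_range_add, sum_range_add]
  simp only [source_tail, not_inserted_tail, if_false]
  rw [sum_range_mul_eq, sum_range_mul_eq, add_right_comm]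
  congr 1
  rw [← sum_add_distrib]
  apply sum_congr rfl
  intro y hy
  have hy := mem_range.1 hy
  obtain ⟨l, rfl⟩ : ∃ l, h = (θ + 1) + l := ⟨h - (θ + 1), by omega⟩
  have e1 : ∀ z ∈ range (θ + 1 + l + 1),
      (if Inserted (θ + 1 + l) r θ (y * (θ + 1 + l + 1) + z) then
        f' (source (θ + 1 + l) r θ (y * (θ + 1 + l + 1) + z)) else
        f (source (θ + 1 + l) r θ (y * (θ + 1 + l + 1) + z))) =
      if z = θ + 1 then f' (y * (θ + 1 + l) + θ) else
        f (y * (θ + 1 + l) + if z ≤ θ then z else z - 1) := by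
    intro z hz
    rw [source_block hy (mem_range.1 hz)]
    simp only [inserted_block hy (mem_range.1 hz)]
    split_ifs with h1 h2 h3
    · omega
    · subst h1; rfl
    · rfl
    · rfl
  rw [sum_congr rfl e1, show θ + 1 + l + 1 = (θ + 1) + (1 + l) by omega, sum_range_add _ (θ + 1) (1 + l),
    sum_range_add _ 1 l, sum_range_add _ (θ + 1) l, sum_range_one,
    add_assoc (∑ x ∈ range (θ + 1), f (y * (θ + 1 + l) + x))]
  congr 1
  · apply sum_congr rfl
    intro z hz
    have := mem_range.1 hz
    rw [if_neg (by omega), if_pos (by omega)]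
  · rw [add_zero, if_pos rfl, add_comm]
    congr 1
    apply sum_congr rfl
    intro z _
    rw [if_neg (by omega), if_neg (by omega)]
    congr 2
    omega

/-- The new pairs are pairs of sources, with the `r` slots `y * h + θ` doubled. For different `θ`
these are different slots, so over all `θ` the pairs with one doubled member sum to at most `2 *
pairs`, and those with two to at most `pairs`. -/
theorem sum_pairs_stretched_le (h r s : ℕ) (P : ℕ → Prop) :
    ∑ θ ∈ range h, pairs (stretched h r θ P) (r * (h + 1) + s) ≤
      (h + 3) * pairs P (r * h + s) := by
  set m := r * h + s
  set f : ℕ → ℕ → ℕ := fun u v => if cnt P (u + 1) = cnt P (v + 1) then 1 else 0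
  have hsum : ∀ φ : ℕ → ℕ, ∀ θ ∈ range h,
      ∑ x ∈ range (r * (h + 1) + s), φ (source h r θ x) =
      ∑ u ∈ range m, φ u + ∑ y ∈ range r, φ (y * h + θ) := by
    intro φ θ hθ
    have := sum_stretched (r := r) (mem_range.1 hθ) s φ φ
    simpa using this
  have hsub : ∀ φ : ℕ → ℕ, ∑ θ ∈ range h, ∑ y ∈ range r, φ (y * h + θ) ≤ ∑ u ∈ range m, φ u := by
    intro φ
    rw [sum_comm, ← sum_range_mul_eq]
    exact sum_le_sum_of_subset (range_subset_range.2 (Nat.le_add_right _ _))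
  have hpair : pairs P m = ∑ u ∈ range m, ∑ v ∈ range m, f u v := pairs_eq_sum P m
  have hθ : ∀ θ ∈ range h, pairs (stretched h r θ P) (r * (h + 1) + s) ≤
      pairs P m + 3 * ∑ y ∈ range r, ∑ u ∈ range m, f u (y * h + θ) := by
    intro θ hθ
    rw [pairs_eq_sum]
    simp only [cnt_stretched (mem_range.1 hθ)]
    have e1 : (∑ t ∈ range (r * (h + 1) + s), ∑ t' ∈ range (r * (h + 1) + s),
        if cnt P (source h r θ t + 1) = cnt P (source h r θ t' + 1) then 1 else 0) =
        (∑ u ∈ range m, (∑ v ∈ range m, f u v + ∑ y ∈ range r, f u (y * h + θ))) +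
        ∑ y' ∈ range r, (∑ v ∈ range m, f (y' * h + θ) v +
          ∑ y ∈ range r, f (y' * h + θ) (y * h + θ)) := by
      rw [← hsum (fun u => ∑ v ∈ range m, f u v + ∑ y ∈ range r, f u (y * h + θ)) θ hθ]
      apply sum_congr rfl
      intro t _
      exact hsum (fun v => f (source h r θ t) v) θ hθ
    rw [e1, sum_add_distrib, sum_add_distrib, ← hpair]
    have e2 : ∑ u ∈ range m, ∑ y ∈ range r, f u (y * h + θ) =
        ∑ y ∈ range r, ∑ u ∈ range m, f u (y * h + θ) := sum_comm
    have e3 : ∑ y' ∈ range r, ∑ v ∈ range m, f (y' * h + θ) v =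
        ∑ y ∈ range r, ∑ u ∈ range m, f u (y * h + θ) := by
      apply sum_congr rfl; intro y _; apply sum_congr rfl; intro u _
      simp only [f, eq_comm]
    have e4 : ∑ y' ∈ range r, ∑ y ∈ range r, f (y' * h + θ) (y * h + θ) ≤
        ∑ y ∈ range r, ∑ u ∈ range m, f u (y * h + θ) := by
      rw [sum_comm]
      apply sum_le_sum
      intro y _
      refine le_trans ?_ (hsub (fun u => f u (y * h + θ)))
      exact single_le_sum (f := fun θ' => ∑ y' ∈ range r, f (y' * h + θ') (y * h + θ))
        (fun _ _ => Nat.zero_le _) hθ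
    rw [e2, e3]
    omega
  refine (sum_le_sum hθ).trans ?_
  rw [sum_add_distrib, ← mul_sum]
  have := hsub (fun v => ∑ u ∈ range m, f u v)
  rw [sum_comm (s := range m) (t := range m)] at hpair
  rw [← hpair] at this
  simp only [sum_const, card_range, smul_eq_mul]
  nlinarith

end Stretch

end DataBroadcast

end

noncomputable section

namespace DataBroadcast

open Finset

/-! ### Mixing two of many candidates -/

theorem sum_range_ite {β : Type*} [AddCommMonoid β] (k l : ℕ) (x y : β) :
    ∑ b ∈ range (k + l), (if b < k then x else y) = k • x + l • y := by
  rw [sum_range_add]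
  congr 1
  · rw [sum_congr rfl (g := fun _ => x)]
    · simp
    · intro b hb; rw [if_pos (mem_range.1 hb)]
  · simp

/-- Among finitely many candidates with two quantities, `K` can be chosen with repetitions such
that the sum of the first quantity is at most `K` times its mean, and the second one exceeds it by
at most the spread `D`. -/
theorem exists_mixture {ι : Type*} {s : Finset ι} (hs : s.Nonempty) (c d : ι → ℝ) {c₀ d₀ D : ℝ}
    (hc : ∑ i ∈ s, c i ≤ s.card * c₀) (hd : ∑ i ∈ s, d i ≤ s.card * d₀)
    (hD : ∀ i j, d i - d j ≤ D) (K : ℕ) :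
    ∃ f : ℕ → ι, (∀ b, f b ∈ s) ∧ ∑ b ∈ range K, c (f b) ≤ K * c₀ ∧
      ∑ b ∈ range K, d (f b) ≤ K * d₀ + D := by
  have hD0 : 0 ≤ D := by obtain ⟨i, _⟩ := hs; simpa using hD i i
  have hx : ∑ i ∈ s, (c i - c₀) ≤ 0 := by
    rw [sum_sub_distrib, sum_const, nsmul_eq_mul]; linarith
  have hy : ∑ i ∈ s, (d i - d₀) ≤ 0 := by
    rw [sum_sub_distrib, sum_const, nsmul_eq_mul]; linarith
  by_cases hgood : ∃ i ∈ s, c i ≤ c₀ ∧ d i ≤ d₀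
  · obtain ⟨i, hi, h1, h2⟩ := hgood
    refine ⟨fun _ => i, fun _ => hi, ?_, ?_⟩
    · simp only [sum_const, card_range, nsmul_eq_mul]
      exact mul_le_mul_of_nonneg_left h1 (Nat.cast_nonneg K)
    · simp only [sum_const, card_range, nsmul_eq_mul]
      have := mul_le_mul_of_nonneg_left h2 (Nat.cast_nonneg (α := ℝ) K)
      linarith
  · push Not at hgood
    have hL : (s.filter (fun i => c i ≤ c₀)).Nonempty := by
      by_contra hne
      rw [not_nonempty_iff_eq_empty, filter_eq_empty_iff] at hne
      have := sum_pos (f := fun i => c i - c₀) (fun i hi => sub_pos.2 (not_le.1 (hne hi))) hs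
      linarith
    have hH : (s.filter (fun i => d i ≤ d₀)).Nonempty := by
      by_contra hne
      rw [not_nonempty_iff_eq_empty, filter_eq_empty_iff] at hne
      have := sum_pos (f := fun i => d i - d₀) (fun i hi => sub_pos.2 (not_le.1 (hne hi))) hs
      linarith
    -- No candidate is good in both quantities. Of those good in one, `u` and `v` gain most per unit
    -- lost in the other.
    obtain ⟨u, hu, humax⟩ := exists_max_image _ (fun i => (c₀ - c i) / (d i - d₀)) hL
    obtain ⟨v, hv, hvmax⟩ := exists_max_image _ (fun i => (d₀ - d i) / (c i - c₀)) hH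
    rw [mem_filter] at hu hv
    have hyu : 0 < d u - d₀ := sub_pos.2 (hgood u hu.1 hu.2)
    have hxv : 0 < c v - c₀ := by
      by_contra hcon
      have := hgood v hv.1 (by linarith)
      linarith [hv.2]
    -- Otherwise the functional `(c - c₀) + lam * (d - d₀)` would be nonnegative on all candidates
    -- and positive at `v`, against the bounds on the means.
    have hprod : (c v - c₀) * (d u - d₀) ≤ (c₀ - c u) * (d₀ - d v) := by
      by_contra hcon
      push Not at hcon
      set lam := (c₀ - c u) / (d u - d₀) with hlam
      set rho := (d₀ - d v) / (c v - c₀) with hrho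
      have hlam0 : 0 ≤ lam := div_nonneg (by linarith [hu.2]) hyu.le
      have hlr : lam * rho < 1 := by
        rw [hlam, hrho, div_mul_div_comm, div_lt_one (mul_pos hyu hxv)]
        linarith [mul_comm (c v - c₀) (d u - d₀)]
      have hnn : ∀ i ∈ s, 0 ≤ (c i - c₀) + lam * (d i - d₀) := by
        intro i hi
        by_cases h1 : c i ≤ c₀
        · have h2 := hgood i hi h1
          have h3 := humax i (mem_filter.2 ⟨hi, h1⟩)
          rw [div_le_iff₀ (by linarith)] at h3
          linarith
        · push Not at h1
          by_cases h2 : d i ≤ d₀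
          · have h3 := hvmax i (mem_filter.2 ⟨hi, h2⟩)
            rw [div_le_iff₀ (by linarith)] at h3
            have h4 := mul_le_mul_of_nonneg_left h3 hlam0
            nlinarith
          · push Not at h2
            have := mul_nonneg hlam0 (sub_pos.2 h2).le
            linarith
      have hpos : 0 < (c v - c₀) + lam * (d v - d₀) := by
        have h3 : d₀ - d v = rho * (c v - c₀) := by rw [hrho, div_mul_cancel₀ _ hxv.ne']
        have h4 : lam * (d v - d₀) = - (lam * rho) * (c v - c₀) := by
          rw [show d v - d₀ = -(d₀ - d v) by ring, h3]; ring
        rw [h4]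
        nlinarith
      have h5 := sum_pos' hnn ⟨v, hv.1, hpos⟩
      rw [sum_add_distrib, ← mul_sum] at h5
      have := mul_nonneg hlam0 (neg_nonneg.2 hy)
      linarith
    -- The mixture takes `v` as often as the first bound permits and `u` for the rest.
    set S := (range (K + 1)).filter (fun k : ℕ => (k : ℝ) * (c v - c₀) ≤ (K - k) * (c₀ - c u))
    have hS : S.Nonempty := ⟨0, by
      simp only [S, mem_filter, mem_range]
      refine ⟨by omega, ?_⟩
      have := hu.2
      push_cast
      have := mul_nonneg (Nat.cast_nonneg (α := ℝ) K) (sub_nonneg.2 hu.2)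
      linarith⟩
    set k := S.max' hS with hk
    have hkS : k ∈ S := S.max'_mem hS
    simp only [S, mem_filter, mem_range] at hkS
    obtain ⟨l, hl⟩ := Nat.exists_eq_add_of_le (Nat.lt_succ_iff.1 hkS.1)
    have hKl : (K : ℝ) = k + l := by exact_mod_cast hl
    have hk2 := hkS.2
    rw [hKl] at hk2
    refine ⟨fun b => if b < k then v else u, fun b => by dsimp only; split_ifs; exacts [hv.1, hu.1],
      ?_, ?_⟩
    · have e : ∀ b, c (if b < k then v else u) = if b < k then c v else c u := fun b => by
        split_ifs <;> rfl
      simp only [e]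
      conv_lhs => rw [hl, sum_range_ite]
      rw [hKl, nsmul_eq_mul, nsmul_eq_mul]
      linarith
    · have e : ∀ b, d (if b < k then v else u) = if b < k then d v else d u := fun b => by
        split_ifs <;> rfl
      simp only [e]
      conv_lhs => rw [hl, sum_range_ite]
      rw [hKl, nsmul_eq_mul, nsmul_eq_mul]
      rcases Nat.eq_zero_or_pos l with h0 | hpos
      · rw [h0]
        have := mul_le_mul_of_nonneg_left hv.2 (Nat.cast_nonneg (α := ℝ) k)
        push_cast
        linarith
      · have hnot : k + 1 ∉ S := by
          intro hmem
          have := S.le_max' _ hmem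
          omega
        simp only [S, mem_filter, mem_range, not_and, not_le] at hnot
        have h1 := hnot (by omega)
        rw [hKl] at h1
        push_cast at h1
        have hl1 : (0 : ℝ) ≤ (l : ℝ) - 1 := by
          have : (1 : ℝ) ≤ l := by exact_mod_cast hpos
          linarith
        -- One more `v` would violate the first bound; `hprod` transfers this to the second
        -- quantity, whose excess is then at most `d u - d v`.
        have h2 : ((l : ℝ) - 1) * (d u - d₀) ≤ (k + 1) * (d₀ - d v) := by
          have a1 := mul_le_mul_of_nonneg_left hprod hl1
          have a2 : 0 ≤ d₀ - d v := sub_nonneg.2 hv.2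
          have a3 := mul_le_mul_of_nonneg_right h1.le a2
          have a4 : (c v - c₀) * (((l : ℝ) - 1) * (d u - d₀)) ≤
              (c v - c₀) * ((k + 1) * (d₀ - d v)) := by nlinarith
          exact le_of_mul_le_mul_left a4 hxv
        have h3 := hD u v
        linarith

/-! ### Windows separated by complete broadcasts -/

section Lumps

variable {P : ℕ → Prop} {B : ℕ → ℕ} {m Z : ℕ}

/-- The slots below `B n` that belong to one of the windows of length `m` starting at the
`B b`. -/
def windowSlots (B : ℕ → ℕ) (m n : ℕ) : Finset ℕ :=
  (range n).biUnion (fun b => Ico (B b) (B b + m))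

/-- The slots below `B n` that do not belong to the windows. -/
def lumpSlots (B : ℕ → ℕ) (m n : ℕ) : Finset ℕ :=
  (range n).biUnion (fun b => Ico (B b + m) (B (b + 1)))

theorem range_subset_slots (h0 : B 0 = 0) (n : ℕ) :
    range (B n) ⊆ windowSlots B m n ∪ lumpSlots B m n := by
  induction n with
  | zero => simp [h0]
  | succ n ih =>
    intro t ht
    have ht := mem_range.1 ht
    by_cases h1 : t < B n
    · have := ih (mem_range.2 h1)
      simp only [windowSlots, lumpSlots, mem_union, mem_biUnion, mem_range] at this ⊢
      rcases this with ⟨b, hb, h⟩ | ⟨b, hb, h⟩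
      · exact Or.inl ⟨b, by omega, h⟩
      · exact Or.inr ⟨b, by omega, h⟩
    · simp only [windowSlots, lumpSlots, mem_union, mem_biUnion, mem_range, mem_Ico]
      by_cases h2 : t < B n + m
      · exact Or.inl ⟨n, by omega, by omega, h2⟩
      · exact Or.inr ⟨n, by omega, by omega, ht⟩

theorem cnt_lt_of_between {t s u : ℕ} (h1 : t < u) (h2 : u ≤ s) (hu : P u) :
    cnt P (t + 1) < cnt P (s + 1) :=
  lt_of_le_of_lt (cnt_mono P h1) (cnt_strict hu (Nat.lt_succ_of_le h2))

theorem card_window_pairs_le (hB : Monotone B)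
    (hP : ∀ b, ∃ u, B b + m ≤ u ∧ u < B (b + 1) ∧ P u) (n : ℕ) :
    ((windowSlots B m n ×ˢ windowSlots B m n).filter
      (fun x => cnt P (x.1 + 1) = cnt P (x.2 + 1))).card ≤
      ∑ b ∈ range n, pairs (fun u => P (B b + u)) m := by
  have key : ∀ b b' t s, b < b' → t < B b + m → B b' ≤ s → cnt P (t + 1) < cnt P (s + 1) := by
    intro b b' t s hbb ht hs
    obtain ⟨u, h1, h2, h3⟩ := hP b
    exact cnt_lt_of_between (by omega) (by have := hB (show b + 1 ≤ b' by omega); omega) h3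
  have hsub : (windowSlots B m n ×ˢ windowSlots B m n).filter
      (fun x => cnt P (x.1 + 1) = cnt P (x.2 + 1)) ⊆ (range n).biUnion (fun b =>
        ((range m ×ˢ range m).filter (fun x => cnt (fun u => P (B b + u)) (x.1 + 1) =
          cnt (fun u => P (B b + u)) (x.2 + 1))).image (fun x => (B b + x.1, B b + x.2))) := by
    rintro ⟨t, s⟩ h
    simp only [windowSlots, mem_filter, mem_product, mem_biUnion, mem_range, mem_Ico] at h
    obtain ⟨⟨⟨b, hb, ht1, ht2⟩, ⟨b', hb', hs1, hs2⟩⟩, heq⟩ := h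
    have hbb : b = b' := by
      rcases lt_trichotomy b b' with h | h | h
      · have := key b b' t s h ht2 hs1; omega
      · exact h
      · have := key b' b s t h hs2 ht1; omega
    subst hbb
    obtain ⟨x, rfl⟩ := Nat.exists_eq_add_of_le ht1
    obtain ⟨y, rfl⟩ := Nat.exists_eq_add_of_le hs1
    simp only [mem_biUnion, mem_image, mem_filter, mem_product, mem_range]
    refine ⟨b, hb, (x, y), ⟨⟨by omega, by omega⟩, ?_⟩, rfl⟩
    rw [add_assoc, add_assoc, cnt_add, cnt_add P (B b) (y + 1)] at heq
    exact Nat.add_left_cancel heq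
  refine (card_le_card hsub).trans (card_biUnion_le.trans ?_)
  apply sum_le_sum
  intro b _
  exact card_image_le

/-- Lumps whose indices differ by more than `1` are separated by the `P`-slot of a lump between
them. So each slot has partners in at most three lumps of at most `Z` slots. -/
theorem card_lump_pairs_le (hB : Monotone B) (hZ : ∀ b, B (b + 1) ≤ B b + m + Z)
    (hP : ∀ b, ∃ u, B b + m ≤ u ∧ u < B (b + 1) ∧ P u) (n : ℕ) :
    ((lumpSlots B m n ×ˢ lumpSlots B m n).filter
      (fun x => cnt P (x.1 + 1) = cnt P (x.2 + 1))).card ≤ n * (3 * Z ^ 2) := by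
  set L : ℕ → Finset ℕ := fun b => Ico (B b + m) (B (b + 1))
  have hL : ∀ b, (L b).card ≤ Z := fun b => by
    rw [Nat.card_Ico]; have := hZ b; omega
  have key : ∀ b b' t s, b + 1 < b' → t < B (b + 1) → B b' + m ≤ s →
      cnt P (t + 1) < cnt P (s + 1) := by
    intro b b' t s hbb ht hs
    obtain ⟨u, h1, h2, h3⟩ := hP (b + 1)
    exact cnt_lt_of_between (by omega) (by have := hB (show b + 1 + 1 ≤ b' by omega); omega) h3
  have hsub : (lumpSlots B m n ×ˢ lumpSlots B m n).filter
      (fun x => cnt P (x.1 + 1) = cnt P (x.2 + 1)) ⊆ (range n).biUnion (fun b =>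
        L b ×ˢ (L (b - 1) ∪ L b ∪ L (b + 1))) := by
    rintro ⟨t, s⟩ h
    simp only [lumpSlots, mem_filter, mem_product, mem_biUnion, mem_range, mem_Ico] at h
    obtain ⟨⟨⟨b, hb, ht1, ht2⟩, ⟨b', hb', hs1, hs2⟩⟩, heq⟩ := h
    simp only [mem_biUnion, mem_product, mem_union, mem_range, L, mem_Ico]
    refine ⟨b, hb, ⟨ht1, ht2⟩, ?_⟩
    have h1 : ¬ b + 1 < b' := fun h => by have := key b b' t s h ht2 hs1; omega
    have h2 : ¬ b' + 1 < b := fun h => by have := key b' b s t h hs2 ht1; omega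
    have : b' = b - 1 ∨ b' = b ∨ b' = b + 1 := by omega
    rcases this with rfl | rfl | rfl
    · exact Or.inl (Or.inl ⟨hs1, hs2⟩)
    · exact Or.inl (Or.inr ⟨hs1, hs2⟩)
    · exact Or.inr ⟨hs1, hs2⟩
  refine (card_le_card hsub).trans (card_biUnion_le.trans ?_)
  calc _ ≤ ∑ b ∈ range n, 3 * Z ^ 2 := by
        apply sum_le_sum
        intro b _
        rw [card_product]
        have h1 : (L (b - 1) ∪ L b ∪ L (b + 1)).card ≤ 3 * Z := by
          have := card_union_le (L (b - 1) ∪ L b) (L (b + 1))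
          have := card_union_le (L (b - 1)) (L b)
          have := hL (b - 1)
          have := hL b
          have := hL (b + 1)
          omega
        calc (L b).card * _ ≤ Z * (3 * Z) := Nat.mul_le_mul (hL b) h1
          _ = 3 * Z ^ 2 := by ring
    _ = n * (3 * Z ^ 2) := by simp

/-- In each class, window slots and lump slots are separated by `(x + y) ^ 2 ≤ (1 + η) x ^ 2 + (1 +
1 / η) y ^ 2`, so that pairs between a window and a lump need no count of their own. -/
theorem pairs_windows_le (h0 : B 0 = 0) (hB : Monotone B) (hZ : ∀ b, B (b + 1) ≤ B b + m + Z)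
    (hP : ∀ b, ∃ u, B b + m ≤ u ∧ u < B (b + 1) ∧ P u) (n : ℕ) {η : ℝ} (hη : 0 < η) :
    (pairs P (B n) : ℝ) ≤ (1 + η) * (∑ b ∈ range n, pairs (fun u => P (B b + u)) m : ℕ) +
      (1 + 1 / η) * (n * (3 * Z ^ 2) : ℕ) := by
  set N := B n with hN
  set V := (range N ∪ windowSlots B m n ∪ lumpSlots B m n).image (fun t => cnt P (t + 1))
  have hcov := range_subset_slots (m := m) h0 n
  have hV1 : ∀ t ∈ range N, cnt P (t + 1) ∈ V := fun t ht =>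
    mem_image_of_mem _ (by simp only [mem_union]; exact Or.inl (Or.inl ht))
  have hV2 : ∀ t ∈ windowSlots B m n, cnt P (t + 1) ∈ V := fun t ht =>
    mem_image_of_mem _ (by simp only [mem_union]; exact Or.inl (Or.inr ht))
  have hV3 : ∀ t ∈ lumpSlots B m n, cnt P (t + 1) ∈ V := fun t ht =>
    mem_image_of_mem _ (by simp only [mem_union]; exact Or.inr ht)
  have e1 : pairs P N = _ := card_pairs_eq_sum_sq _ V (fun t => cnt P (t + 1)) hV1
  have e2 := card_window_pairs_le hB hP n
  rw [card_pairs_eq_sum_sq _ V (fun t => cnt P (t + 1)) hV2] at e2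
  have e3 := card_lump_pairs_le hB hZ hP n
  rw [card_pairs_eq_sum_sq _ V (fun t => cnt P (t + 1)) hV3] at e3
  set x : ℕ → ℕ := fun v => ((windowSlots B m n).filter (fun t => cnt P (t + 1) = v)).card
  set y : ℕ → ℕ := fun v => ((lumpSlots B m n).filter (fun t => cnt P (t + 1) = v)).card
  have e4 : ∀ v, ((range N).filter (fun t => cnt P (t + 1) = v)).card ≤ x v + y v := by
    intro v
    refine le_trans (card_le_card ?_) (card_union_le _ _)
    rw [← filter_union]
    exact filter_subset_filter _ hcov
  have e2' : ∑ v ∈ V, (x v : ℝ) ^ 2 ≤ (∑ b ∈ range n, pairs (fun u => P (B b + u)) m : ℕ) := by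
    exact_mod_cast e2
  have e3' : ∑ v ∈ V, (y v : ℝ) ^ 2 ≤ (n * (3 * Z ^ 2) : ℕ) := by exact_mod_cast e3
  have e5 : (pairs P N : ℝ) ≤ ∑ v ∈ V, ((1 + η) * (x v : ℝ) ^ 2 + (1 + 1 / η) * (y v : ℝ) ^ 2) := by
    rw [e1]
    push_cast
    apply sum_le_sum
    intro v _
    have h1 : (((range N).filter (fun t => cnt P (t + 1) = v)).card : ℝ) ≤ x v + y v := by
      exact_mod_cast e4 v
    have h2 : (((range N).filter (fun t => cnt P (t + 1) = v)).card : ℝ) ^ 2 ≤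
        ((x v : ℝ) + y v) ^ 2 := pow_le_pow_left₀ (Nat.cast_nonneg _) h1 2
    refine h2.trans ?_
    have h3 : 0 ≤ (η * x v - y v) ^ 2 / η := by positivity
    have h4 : (η * x v - y v) ^ 2 / η = η * (x v : ℝ) ^ 2 - 2 * x v * y v + (y v : ℝ) ^ 2 / η := by
      field_simp
      ring
    rw [h4] at h3
    have h5 : (1 / η) * (y v : ℝ) ^ 2 = (y v : ℝ) ^ 2 / η := by ring
    nlinarith
  rw [sum_add_distrib, ← mul_sum, ← mul_sum] at e5
  refine e5.trans (add_le_add (mul_le_mul_of_nonneg_left e2' (by positivity))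
    (mul_le_mul_of_nonneg_left e3' (by positivity)))

end Lumps

end DataBroadcast

end

noncomputable section

namespace DataBroadcast

open Finset

theorem cnt_congr {P P' : ℕ → Prop} {n : ℕ} (h : ∀ u < n, P u ↔ P' u) : cnt P n = cnt P' n := by
  classical
  induction n with
  | zero => rw [cnt_zero, cnt_zero]
  | succ n ih =>
    rw [cnt_succ, cnt_succ, ih (fun u hu => h u (by omega))]
    simp only [h n (by omega)]

theorem pairs_congr {P P' : ℕ → Prop} {n : ℕ} (h : ∀ u < n, P u ↔ P' u) :
    pairs P n = pairs P' n := by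
  rw [pairs_eq_sum, pairs_eq_sum]
  apply sum_congr rfl; intro t ht; apply sum_congr rfl; intro s hs
  rw [cnt_congr (fun u hu => h u (by have := mem_range.1 ht; omega)),
    cnt_congr (n := s + 1) (fun u hu => h u (by have := mem_range.1 hs; omega))]

/-! ### A periodic schedule composed of windows -/

/-- The beginning of block `b`, if `N` slots are divided evenly into `K` blocks. -/
def blockStart (N K b : ℕ) : ℕ := b * N / K

/-- The block that contains slot `t`. -/
def blockOf (N K t : ℕ) : ℕ := ((t + 1) * K - 1) / N

section Blocks

variable {N K : ℕ}

theorem blockStart_zero : blockStart N K 0 = 0 := by simp [blockStart]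

theorem blockStart_mono : Monotone (blockStart N K) := by
  intro a b h
  exact Nat.div_le_div_right (Nat.mul_le_mul_right _ h)

theorem blockStart_mul (hK : 0 < K) (M : ℕ) : blockStart N K (M * K) = N * M := by
  unfold blockStart
  rw [show M * K * N = N * M * K by ring, Nat.mul_div_cancel _ hK]

theorem le_blockStart_succ (b : ℕ) : blockStart N K b + N / K ≤ blockStart N K (b + 1) := by
  unfold blockStart
  rw [Nat.succ_mul]
  exact Nat.div_add_div_le_add_div

theorem blockStart_succ_le (hK : 0 < K) (b : ℕ) :
    blockStart N K (b + 1) ≤ blockStart N K b + N / K + 1 := by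
  unfold blockStart
  rw [Nat.succ_mul, Nat.add_div hK]
  split_ifs <;> omega

/-- The two bounds on `t` mean `b * N < (t + 1) * K` and `(t + 1) * K ≤ (b + 1) * N`; hence the `+
1` and `- 1` in `blockOf`. -/
theorem blockOf_eq (hK : 0 < K) {b t : ℕ} (h1 : blockStart N K b ≤ t)
    (h2 : t < blockStart N K (b + 1)) : blockOf N K t = b := by
  unfold blockStart at h1 h2
  unfold blockOf
  have e1 : b * N < (t + 1) * K := by
    have := Nat.lt_mul_div_succ (b * N) hK
    have h3 : K * (b * N / K + 1) ≤ K * (t + 1) := Nat.mul_le_mul_left _ (by omega)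
    rw [mul_comm (t + 1)]; omega
  have e2 : (t + 1) * K ≤ (b + 1) * N := (Nat.le_div_iff_mul_le hK).1 h2
  have e3 : 0 < (t + 1) * K := by positivity
  rw [Nat.div_eq_iff]
  · rw [Nat.succ_mul b N] at e2
    constructor <;> omega
  · rcases Nat.eq_zero_or_pos N with rfl | h
    · simp at e2; omega
    · exact h

theorem blockOf_add (hN : 0 < N) (hK : 0 < K) (t : ℕ) : blockOf N K (t + N) = blockOf N K t + K := by
  unfold blockOf
  have e3 : 0 < (t + 1) * K := by positivity
  have : (t + N + 1) * K - 1 = ((t + 1) * K - 1) + N * K := by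
    rw [show t + N + 1 = (t + 1) + N by omega, Nat.add_mul]; omega
  rw [this, Nat.add_mul_div_left _ _ hN]

theorem blockStart_add (hK : 0 < K) (b : ℕ) : blockStart N K (b + K) = blockStart N K b + N := by
  unfold blockStart
  rw [Nat.add_mul, Nat.add_mul_div_left _ _ hK]

end Blocks

section Mixed

variable {W a : ℕ}

/-- In block `b`, a window of length `r * h + s` of `S` with inserted empty slots is followed by
one broadcast of each message; `φ b` gives the number of the window and the place of the inserted
slots. -/
def mixed (S : Schedule W (Fin a)) (N K h r s : ℕ) (φ : ℕ → ℕ × ℕ) : Schedule W (Fin a) :=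
  fun t k =>
    let b := blockOf N K t
    let x := t - blockStart N K b
    if x < r * (h + 1) + s then
      if Inserted h r (φ (b % K)).2 x then none
      else S ((φ (b % K)).1 * (r * h + s) + source h r (φ (b % K)).2 x) k
    else if hx : x - (r * (h + 1) + s) < a ∧ k.val = 0 then
      some ⟨x - (r * (h + 1) + s), hx.1⟩ else none

/-- The number of channels that broadcast `i` at time `t`. -/
def slotCount (S : Schedule W (Fin a)) (t : ℕ) (i : Fin a) : ℕ :=
  ∑ k, if S t k = some i then 1 else 0

theorem occ_eq_sum_slotCount (S : Schedule W (Fin a)) (n : ℕ) (i : Fin a) :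
    occ S n i = ∑ t ∈ range n, slotCount S t i := by
  unfold occ slotCount
  apply sum_congr rfl; intro t _; apply sum_congr rfl; intro k _
  congr

theorem sum_slotCount_le (S : Schedule W (Fin a)) (t : ℕ) : ∑ i, slotCount S t i ≤ W := by
  have h := sum_occ_le (fun u => S (t + u)) 1
  simpa [occ_eq_sum_slotCount, slotCount] using h

/-- The number of broadcasts of `i` in window number `w`. -/
def windowOcc (S : Schedule W (Fin a)) (m w : ℕ) (i : Fin a) : ℕ :=
  ∑ u ∈ range m, slotCount S (w * m + u) i

theorem sum_windowOcc_le (S : Schedule W (Fin a)) (m w : ℕ) : ∑ i, windowOcc S m w i ≤ W * m := by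
  unfold windowOcc
  rw [sum_comm]
  refine (sum_le_sum (fun u _ => sum_slotCount_le S _)).trans ?_
  simp [mul_comm]

theorem sum_windowOcc_eq (S : Schedule W (Fin a)) (m Q : ℕ) (i : Fin a) :
    ∑ w ∈ range Q, windowOcc S m w i = occ S (Q * m) i := by
  rw [occ_eq_sum_slotCount, sum_range_mul_eq]
  rfl

variable {S : Schedule W (Fin a)} {N K h r s : ℕ} {φ : ℕ → ℕ × ℕ}

theorem mixed_window (hK : 0 < K) (hlen : r * (h + 1) + s + a = N / K) {b x : ℕ}
    (hx : x < r * (h + 1) + s) (k : Fin W) :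
    mixed S N K h r s φ (blockStart N K b + x) k =
      if Inserted h r (φ (b % K)).2 x then none
      else S ((φ (b % K)).1 * (r * h + s) + source h r (φ (b % K)).2 x) k := by
  have hb : blockOf N K (blockStart N K b + x) = b :=
    blockOf_eq hK (Nat.le_add_right _ _) (by have := le_blockStart_succ (N := N) (K := K) b; omega)
  unfold mixed
  simp only [hb, Nat.add_sub_cancel_left]
  rw [if_pos hx]

theorem mixed_lump (hK : 0 < K) {b x : ℕ} (hx : r * (h + 1) + s ≤ x)
    (hx2 : blockStart N K b + x < blockStart N K (b + 1)) (k : Fin W) :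
    mixed S N K h r s φ (blockStart N K b + x) k =
      if hx : x - (r * (h + 1) + s) < a ∧ k.val = 0 then
        some ⟨x - (r * (h + 1) + s), hx.1⟩ else none := by
  have hb : blockOf N K (blockStart N K b + x) = b := blockOf_eq hK (Nat.le_add_right _ _) hx2
  unfold mixed
  simp only [hb, Nat.add_sub_cancel_left]
  rw [if_neg (not_lt.2 hx)]

theorem mixed_periodic (hN : 0 < N) (hK : 0 < K) (t : ℕ) :
    mixed S N K h r s φ (t + N) = mixed S N K h r s φ t := by
  funext k
  unfold mixed
  simp only [blockOf_add hN hK, blockStart_add hK, Nat.add_sub_add_right, Nat.add_mod_right]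

theorem broadcasts_mixed_iff (hK : 0 < K) (hlen : r * (h + 1) + s + a = N / K) {b x : ℕ}
    (hx : x < r * (h + 1) + s) (i : Fin a) :
    Broadcasts (mixed S N K h r s φ) (blockStart N K b + x) i ↔
      stretched h r (φ (b % K)).2
        (fun u => Broadcasts S ((φ (b % K)).1 * (r * h + s) + u) i) x := by
  unfold Broadcasts stretched
  simp only [mixed_window hK hlen hx]
  by_cases hi : Inserted h r (φ (b % K)).2 x
  · simp [hi]
  · simp [hi]

theorem exists_broadcast_mixed (hW : 0 < W) (hK : 0 < K) (hlen : r * (h + 1) + s + a = N / K)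
    (b : ℕ) (i : Fin a) :
    ∃ u, blockStart N K b + (r * (h + 1) + s) ≤ u ∧ u < blockStart N K (b + 1) ∧
      Broadcasts (mixed S N K h r s φ) u i := by
  have h1 := le_blockStart_succ (N := N) (K := K) b
  have hi := i.2
  refine ⟨blockStart N K b + (r * (h + 1) + s + i), by omega, by omega, ⟨0, hW⟩, ?_⟩
  rw [mixed_lump hK (Nat.le_add_right _ _) (by omega)]
  simp

theorem pairs_mixed_le (hW : 0 < W) (hK : 0 < K) (hlen : r * (h + 1) + s + a = N / K)
    (i : Fin a) (M : ℕ) {η : ℝ} (hη : 0 < η) :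
    (pairs (fun u => Broadcasts (mixed S N K h r s φ) u i) (N * M) : ℝ) ≤
      M * ((1 + η) * ∑ b ∈ range K, (pairs (stretched h r (φ b).2
        (fun u => Broadcasts S ((φ b).1 * (r * h + s) + u) i)) (r * (h + 1) + s) : ℝ) +
      (1 + 1 / η) * (K * (3 * ((a : ℝ) + 1) ^ 2))) := by
  -- A block has `N / K` or `N / K + 1` slots, which leaves `a` or `a + 1` for its lump.
  have hmain := pairs_windows_le (P := fun u => Broadcasts (mixed S N K h r s φ) u i)
    (B := blockStart N K) (m := r * (h + 1) + s) (Z := a + 1) blockStart_zero blockStart_mono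
    (fun b => by have := blockStart_succ_le (N := N) hK b; omega)
    (fun b => exists_broadcast_mixed hW hK hlen b i) (M * K) hη
  rw [blockStart_mul hK] at hmain
  have e1 : ∑ b ∈ range (M * K), pairs (fun u => Broadcasts (mixed S N K h r s φ)
      (blockStart N K b + u) i) (r * (h + 1) + s) = M * ∑ b ∈ range K,
      pairs (stretched h r (φ b).2 (fun u => Broadcasts S ((φ b).1 * (r * h + s) + u) i))
        (r * (h + 1) + s) := by
    rw [sum_range_mul_eq]
    rw [sum_congr rfl (g := fun _ => ∑ b ∈ range K, pairs (stretched h r (φ b).2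
      (fun u => Broadcasts S ((φ b).1 * (r * h + s) + u) i)) (r * (h + 1) + s))]
    · simp
    · intro t _
      apply sum_congr rfl
      intro b hb
      rw [pairs_congr (fun u hu => broadcasts_mixed_iff hK hlen hu i), Nat.mul_add_mod_self_right,
        Nat.mod_eq_of_lt (mem_range.1 hb)]
  rw [e1] at hmain
  refine hmain.trans (le_of_eq ?_)
  push_cast
  ring

theorem sum_range_blockStart {β : Type*} [AddCommMonoid β] (f : ℕ → β) (n : ℕ) :
    ∑ t ∈ range (blockStart N K n), f t = ∑ b ∈ range n,
      ∑ x ∈ range (blockStart N K (b + 1) - blockStart N K b), f (blockStart N K b + x) := by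
  induction n with
  | zero => simp [blockStart_zero]
  | succ n ih =>
    rw [sum_range_succ, ← ih, ← sum_range_add]
    congr 2
    have := blockStart_mono (N := N) (K := K) (Nat.le_add_right n 1)
    omega

theorem occ_mixed_le (hK : 0 < K) (hlen : r * (h + 1) + s + a = N / K)
    (hφ : ∀ b, (φ b).2 < h) (i : Fin a) (M : ℕ) :
    occ (mixed S N K h r s φ) (N * M) i ≤
      M * ∑ b ∈ range K, (windowOcc S (r * h + s) (φ b).1 i + 1) := by
  rw [occ_eq_sum_slotCount, ← blockStart_mul hK, sum_range_blockStart]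
  have hblock : ∀ b, ∑ x ∈ range (blockStart N K (b + 1) - blockStart N K b),
      slotCount (mixed S N K h r s φ) (blockStart N K b + x) i ≤
      windowOcc S (r * h + s) (φ (b % K)).1 i + 1 := by
    intro b
    have hle := le_blockStart_succ (N := N) (K := K) b
    obtain ⟨l, hl⟩ := Nat.exists_eq_add_of_le
      (show r * (h + 1) + s ≤ blockStart N K (b + 1) - blockStart N K b by omega)
    rw [hl, sum_range_add]
    apply add_le_add
    · apply le_of_eq
      have e1 := sum_stretched (h := h) (r := r) (hφ (b % K)) s
        (fun u => slotCount S ((φ (b % K)).1 * (r * h + s) + u) i) (fun _ => 0)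
      simp only [sum_const_zero, add_zero] at e1
      rw [windowOcc, ← e1]
      apply sum_congr rfl
      intro x hx
      unfold slotCount
      simp only [mixed_window hK hlen (mem_range.1 hx)]
      by_cases hi : Inserted h r (φ (b % K)).2 x
      · simp [hi]
      · simp only [if_neg hi]
    · have e2 : ∀ x ∈ range l, slotCount (mixed S N K h r s φ)
          (blockStart N K b + (r * (h + 1) + s + x)) i ≤ if x = i then 1 else 0 := by
        intro x hx
        have hx := mem_range.1 hx
        unfold slotCount
        simp only [mixed_lump (S := S) (φ := φ) hK (Nat.le_add_right (r * (h + 1) + s) x)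
          (show blockStart N K b + (r * (h + 1) + s + x) < blockStart N K (b + 1) by omega),
          Nat.add_sub_cancel_left]
        by_cases hxi : x = i
        · rw [if_pos hxi]
          calc _ ≤ ∑ k : Fin W, if k.val = 0 then 1 else 0 := by
                apply sum_le_sum
                intro k _
                by_cases hk : k.val = 0
                · rw [if_pos hk]; split_ifs <;> omega
                · rw [dif_neg (fun hh => hk hh.2)]
                  simp
            _ ≤ 1 := by
                rw [← card_filter]
                apply card_le_one.2
                intro k hk k' hk'
                simp only [mem_filter, mem_univ, true_and] at hk hk'
                exact Fin.ext (by omega)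
        · rw [if_neg hxi]
          apply le_of_eq
          apply sum_eq_zero
          intro k _
          rw [if_neg]
          split_ifs with hh
          · intro heq
            apply hxi
            have := Option.some.inj heq
            rw [← this]
          · simp
      refine (sum_le_sum e2).trans ?_
      rw [← card_filter]
      apply card_le_one.2
      intro x hx y hy
      simp only [mem_filter] at hx hy
      omega
  refine (sum_le_sum (fun b _ => hblock b)).trans (le_of_eq ?_)
  rw [sum_range_mul_eq]
  rw [sum_congr rfl (g := fun _ => ∑ b ∈ range K, (windowOcc S (r * h + s) (φ b).1 i + 1))]
  · simp
  · intro t _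
    apply sum_congr rfl
    intro b hb
    rw [Nat.mul_add_mod_self_right, Nat.mod_eq_of_lt (mem_range.1 hb)]

theorem occ_mixed_pos (hW : 0 < W) (hK : 0 < K)
    (hlen : r * (h + 1) + s + a = N / K) (i : Fin a) :
    0 < occ (mixed S N K h r s φ) N i := by
  classical
  obtain ⟨u, -, h2, k, hk⟩ := exists_broadcast_mixed (S := S) (φ := φ) hW hK hlen 0 i
  have hu : u < N := by
    have h3 := blockStart_mul (N := N) hK 1
    have h4 := blockStart_mono (N := N) (K := K) (show 0 + 1 ≤ 1 * K by omega)
    omega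
  unfold occ
  refine sum_pos' (fun _ _ => Nat.zero_le _) ⟨u, mem_range.2 hu, ?_⟩
  refine sum_pos' (fun _ _ => Nat.zero_le _) ⟨k, mem_univ _, ?_⟩
  rw [if_pos hk]
  exact one_pos

/-- From the first `Q` windows of an arbitrary schedule, a periodic schedule of almost the same
cost and density can be composed. -/
theorem exists_periodic_schedule (S : Schedule W (Fin a)) {p c : Fin a → ℝ} {C : ℝ}
    (hp : ∀ i, 0 ≤ p i) (hc : ∀ i, 0 ≤ c i) (hcC : ∀ i, c i ≤ C) (ha : 1 ≤ a) (hW : 0 < W)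
    (hN : 0 < N) (hK : 0 < K) (hlen : r * (h + 1) + s + a = N / K) (hh : 0 < h) {Q : ℕ}
    (hQ : 0 < Q) {η κ : ℝ} (hη : 0 < η)
    (hκ : (1 + 1 / η) * (3 * ((a : ℝ) + 1) ^ 2) ≤ κ * (r * (h + 1) + s : ℕ)) :
    ∃ S' : Schedule W (Fin a), (∀ t, S' (t + N) = S' t) ∧
      cost p c S' ≤ ENNReal.ofReal (((1 + η + κ) *
        (K * ((h + 3) / (h * Q) * total p c S (Q * (r * h + s)))) + K * (a * C)) / N) ∧
      1 ≤ ∑ i, occ S' N i ∧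
      ((∑ i, occ S' N i : ℕ) : ℝ) ≤
        K * ((∑ i, occ S (Q * (r * h + s)) i : ℕ) / Q) + W * (r * h + s : ℕ) + K * a := by
  set m := r * h + s with hm
  set m' := r * (h + 1) + s with hm'
  have hhr : (0 : ℝ) < h := by exact_mod_cast hh
  have hQr : (0 : ℝ) < Q := by exact_mod_cast hQ
  have hNr : (0 : ℝ) < N := by exact_mod_cast hN
  set pr : ℕ × ℕ → Fin a → ℕ := fun j i =>
    pairs (stretched h r j.2 (fun u => Broadcasts S (j.1 * m + u) i)) m'
  set cc : ℕ × ℕ → ℝ := fun j => ∑ i, (p i * ((pr j i : ℝ) / 2) + c i * windowOcc S m j.1 i)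
  set dd : ℕ × ℕ → ℝ := fun j => ((∑ i, windowOcc S m j.1 i : ℕ) : ℝ)
  have hcc : ∑ j ∈ range Q ×ˢ range h, cc j ≤
      (range Q ×ˢ range h).card * ((h + 3) / (h * Q) * total p c S (Q * m)) := by
    have e1 : ((range Q ×ˢ range h).card : ℝ) * ((h + 3) / (h * Q) * total p c S (Q * m)) =
        (h + 3) * total p c S (Q * m) := by
      rw [card_product, card_range, card_range]
      push_cast
      field_simp
    rw [e1]
    simp only [cc]
    rw [sum_comm, total, mul_sum]
    apply sum_le_sum
    intro i _
    rw [sum_add_distrib, ← mul_sum, ← mul_sum, ← sum_div, mul_add]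
    apply add_le_add
    · have h1 : ∑ j ∈ range Q ×ˢ range h, pr j i ≤
          (h + 3) * pairs (fun u => Broadcasts S u i) (Q * m) := by
        rw [sum_product]
        calc _ ≤ ∑ w ∈ range Q, (h + 3) * pairs (fun u => Broadcasts S (w * m + u) i) m := by
              apply sum_le_sum
              intro w _
              exact sum_pairs_stretched_le h r s (fun u => Broadcasts S (w * m + u) i)
          _ ≤ _ := by
              rw [← mul_sum]
              exact Nat.mul_le_mul_left _ (sum_pairs_le (fun u => Broadcasts S u i) m Q)
      have h1' : ∑ j ∈ range Q ×ˢ range h, (pr j i : ℝ) ≤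
          (h + 3) * pairs (fun u => Broadcasts S u i) (Q * m) := by exact_mod_cast h1
      have := mul_le_mul_of_nonneg_left h1' (hp i)
      linarith
    · have h1 : ∑ j ∈ range Q ×ˢ range h, windowOcc S m j.1 i = h * occ S (Q * m) i := by
        rw [sum_product, ← sum_windowOcc_eq, mul_sum]
        apply sum_congr rfl
        intro w _
        simp
      have h1' : ∑ j ∈ range Q ×ˢ range h, (windowOcc S m j.1 i : ℝ) = h * occ S (Q * m) i := by
        exact_mod_cast h1
      rw [h1']
      have h2 : (0 : ℝ) ≤ c i * occ S (Q * m) i := mul_nonneg (hc i) (Nat.cast_nonneg _)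
      nlinarith
  have hdd : ∑ j ∈ range Q ×ˢ range h, dd j ≤
      (range Q ×ˢ range h).card * (((∑ i, occ S (Q * m) i : ℕ) : ℝ) / Q) := by
    have h1 : ∑ j ∈ range Q ×ˢ range h, (∑ i, windowOcc S m j.1 i) =
        h * ∑ i, occ S (Q * m) i := by
      rw [sum_product, mul_sum]
      simp only [← sum_windowOcc_eq]
      simp only [sum_const, card_range, smul_eq_mul]
      rw [← mul_sum, sum_comm, mul_sum]
    apply le_of_eq
    simp only [dd]
    rw [card_product, card_range, card_range, ← Nat.cast_sum, h1]
    push_cast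
    field_simp
  have hDD : ∀ i j, dd i - dd j ≤ W * (m : ℝ) := by
    intro i j
    have h1 : dd i ≤ W * (m : ℝ) := by
      simp only [dd]
      exact_mod_cast sum_windowOcc_le S m i.1
    have h2 : 0 ≤ dd j := Nat.cast_nonneg _
    linarith
  -- A candidate is a window together with a place of insertion. Averaging over the places controls
  -- the stretched pairs, averaging over the windows brings in the prefix; the occupancy `dd` does
  -- not depend on the place.
  obtain ⟨φ, hφs, hφc, hφd⟩ := exists_mixture (s := range Q ×ˢ range h)
    ⟨(0, 0), by simp [hQ, hh]⟩ cc dd hcc hdd hDD K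
  have hφ : ∀ b, (φ b).2 < h := fun b => mem_range.1 (mem_product.1 (hφs b)).2
  have hC : 0 ≤ C := (hc ⟨0, ha⟩).trans (hcC _)
  refine ⟨mixed S N K h r s φ, mixed_periodic hN hK, ?_, ?_, ?_⟩
  · apply cost_le_of_multiples hp hc _ hN
    intro M
    have e1 : (N : ℝ) * M * (((1 + η + κ) *
        (K * ((h + 3) / (h * Q) * total p c S (Q * m))) + K * (a * C)) / N) =
        M * ((1 + η + κ) * (K * ((h + 3) / (h * Q) * total p c S (Q * m))) + K * (a * C)) := by
      field_simp
    rw [e1]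
    have hm'0 : (0 : ℝ) ≤ (m' : ℝ) := Nat.cast_nonneg _
    have e2 : ∀ i, p i * ((pairs (fun u => Broadcasts (mixed S N K h r s φ) u i) (N * M) : ℝ) / 2)
        + c i * occ (mixed S N K h r s φ) (N * M) i ≤
        M * ((1 + η + κ) * ∑ b ∈ range K, (p i * ((pr (φ b) i : ℝ) / 2) +
          c i * windowOcc S m (φ b).1 i) + K * C) := by
      intro i
      have f1 := pairs_mixed_le (S := S) (φ := φ) hW hK hlen i M hη
      have f2 : (occ (mixed S N K h r s φ) (N * M) i : ℝ) ≤
          M * ∑ b ∈ range K, ((windowOcc S m (φ b).1 i : ℝ) + 1) := by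
        exact_mod_cast occ_mixed_le (S := S) (φ := φ) hK hlen hφ i M
      -- The diagonal alone gives `m'` pairs per window; to these the waiting pairs of the lumps are
      -- charged.
      have f3 : (K : ℝ) * m' ≤ ∑ b ∈ range K, (pr (φ b) i : ℝ) := by
        calc (K : ℝ) * m' = ∑ b ∈ range K, (m' : ℝ) := by simp
          _ ≤ _ := by
            apply sum_le_sum
            intro b _
            exact_mod_cast le_pairs _ _
      have hκ0 : 0 ≤ κ := by
        by_contra hneg
        push Not at hneg
        have g1 : 0 < (1 + 1 / η) * (3 * ((a : ℝ) + 1) ^ 2) := by positivity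
        have g2 : κ * m' ≤ 0 := mul_nonpos_of_nonpos_of_nonneg hneg.le hm'0
        linarith
      have f4 : (1 + 1 / η) * (K * (3 * ((a : ℝ) + 1) ^ 2)) ≤
          κ * ∑ b ∈ range K, (pr (φ b) i : ℝ) := by
        have g1 := mul_le_mul_of_nonneg_left hκ (Nat.cast_nonneg (α := ℝ) K)
        have g2 := mul_le_mul_of_nonneg_left f3 hκ0
        nlinarith
      have f5 : (pairs (fun u => Broadcasts (mixed S N K h r s φ) u i) (N * M) : ℝ) ≤
          M * ((1 + η + κ) * ∑ b ∈ range K, (pr (φ b) i : ℝ)) := by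
        refine f1.trans (mul_le_mul_of_nonneg_left ?_ (Nat.cast_nonneg M))
        have : (1 + η + κ) * ∑ b ∈ range K, (pr (φ b) i : ℝ) =
          (1 + η) * ∑ b ∈ range K, (pr (φ b) i : ℝ) + κ * ∑ b ∈ range K, (pr (φ b) i : ℝ) := by
          ring
        rw [this]
        exact add_le_add le_rfl f4
      have f6 := mul_le_mul_of_nonneg_left f5 (hp i)
      have f7 := mul_le_mul_of_nonneg_left f2 (hc i)
      rw [sum_add_distrib, sum_const, card_range, nsmul_eq_mul, mul_one] at f7
      rw [sum_add_distrib, ← mul_sum, ← mul_sum, ← sum_div]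
      set X := ∑ b ∈ range K, (pr (φ b) i : ℝ)
      set Y := ∑ b ∈ range K, (windowOcc S m (φ b).1 i : ℝ)
      have hM0 : (0 : ℝ) ≤ M := Nat.cast_nonneg M
      have hK0 : (0 : ℝ) ≤ K := Nat.cast_nonneg K
      have hY0 : 0 ≤ Y := sum_nonneg (fun _ _ => Nat.cast_nonneg _)
      have f8 : 0 ≤ M * ((η + κ) * (c i * Y)) := by
        have := hc i
        positivity
      have f9 : M * (K * c i) ≤ M * (K * C) :=
        mul_le_mul_of_nonneg_left (mul_le_mul_of_nonneg_left (hcC i) hK0) hM0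
      nlinarith
    unfold total
    refine (sum_le_sum (fun i _ => e2 i)).trans ?_
    rw [← mul_sum, sum_add_distrib, ← mul_sum, sum_comm]
    apply mul_le_mul_of_nonneg_left _ (Nat.cast_nonneg M)
    have hκη : 0 ≤ 1 + η + κ := by
      have g1 : 0 < (1 + 1 / η) * (3 * ((a : ℝ) + 1) ^ 2) := by positivity
      have : 0 ≤ κ := by
        by_contra hneg
        push Not at hneg
        have g2 : κ * m' ≤ 0 := mul_nonpos_of_nonpos_of_nonneg hneg.le hm'0
        linarith
      positivity
    have g3 := mul_le_mul_of_nonneg_left hφc hκη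
    simp only [sum_const, card_univ, Fintype.card_fin, nsmul_eq_mul]
    simp only [cc, total] at g3
    linarith
  · have h1 := occ_mixed_pos (S := S) (φ := φ) hW hK hlen (⟨0, ha⟩ : Fin a)
    have h2 := single_le_sum (f := fun i => occ (mixed S N K h r s φ) N i)
      (fun _ _ => Nat.zero_le _) (mem_univ (⟨0, ha⟩ : Fin a))
    omega
  · have h1 : ∑ i, occ (mixed S N K h r s φ) N i ≤
        ∑ b ∈ range K, (∑ i, windowOcc S m (φ b).1 i) + K * a := by
      have h2 : ∀ i, occ (mixed S N K h r s φ) N i ≤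
          ∑ b ∈ range K, (windowOcc S m (φ b).1 i + 1) := by
        intro i
        simpa using occ_mixed_le (S := S) (φ := φ) hK hlen hφ i 1
      refine (sum_le_sum (fun i _ => h2 i)).trans (le_of_eq ?_)
      rw [sum_comm]
      rw [sum_congr rfl (fun b _ => sum_add_distrib), sum_add_distrib]
      rw [sum_const, card_range, sum_const, card_univ, Fintype.card_fin, smul_eq_mul, smul_eq_mul,
        mul_one]
    have h1' : ((∑ i, occ (mixed S N K h r s φ) N i : ℕ) : ℝ) ≤
        ∑ b ∈ range K, dd (φ b) + K * a := by
      simp only [dd]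
      exact_mod_cast h1
    linarith

end Mixed

end DataBroadcast

end

noncomputable section

namespace DataBroadcast

open Finset

/-! ### The contributions of the two kinds of messages -/

theorem cnt_le_occ {W : ℕ} {M : Type} (S : Schedule W M) (n : ℕ) (i : M) :
    cnt (fun u => Broadcasts S u i) n ≤ occ S n i := by
  classical
  induction n with
  | zero => rw [cnt_zero]; exact Nat.zero_le _
  | succ n ih =>
    rw [cnt_succ]
    unfold occ at ih ⊢
    rw [sum_range_succ]
    refine add_le_add ih ?_
    split_ifs with h
    · obtain ⟨k, hk⟩ := h
      refine le_trans ?_ (single_le_sum (fun _ _ => Nat.zero_le _) (mem_univ k))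
      rw [if_pos hk]
    · exact Nat.zero_le _

theorem sq_div_le_pairs {W : ℕ} {M : Type} (S : Schedule W M) (n : ℕ) (i : M) :
    (n : ℝ) ^ 2 * (1 / ((occ S n i : ℝ) + 1)) ≤ pairs (fun u => Broadcasts S u i) n := by
  have h1 := sq_le_mul_pairs (fun u => Broadcasts S u i) n
  have h2 : n ^ 2 ≤ (occ S n i + 1) * pairs (fun u => Broadcasts S u i) n :=
    h1.trans (Nat.mul_le_mul_right _ (Nat.succ_le_succ (cnt_le_occ S n i)))
  have h3 : (n : ℝ) ^ 2 ≤ ((occ S n i : ℝ) + 1) * pairs (fun u => Broadcasts S u i) n := by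
    exact_mod_cast h2
  rw [mul_one_div, div_le_iff₀ (by positivity)]
  linarith

namespace Input

variable (I : Input) {W : ℕ}

/-- The part of the schedule that broadcasts messages of `A`. -/
def restrictA (S : Schedule W I.Msg) : Schedule W (Fin I.a) :=
  fun t k => (S t k).bind Sum.getLeft?

theorem restrictA_eq_some (S : Schedule W I.Msg) (t : ℕ) (k : Fin W) (i : Fin I.a) :
    I.restrictA S t k = some i ↔ S t k = some (Sum.inl i) := by
  unfold restrictA
  rcases S t k with - | (x | x) <;> simp

/-- The contribution of the messages of `B` to `total`. -/
def totalB (S : Schedule W I.Msg) (n : ℕ) : ℝ :=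
  ∑ j, ∑ k, (I.pB j * ((pairs (fun u => Broadcasts S u (Sum.inr ⟨j, k⟩)) n : ℝ) / 2) +
    I.cB j * occ S n (Sum.inr ⟨j, k⟩))

theorem occ_restrictA (S : Schedule W I.Msg) (n : ℕ) (i : Fin I.a) :
    occ (I.restrictA S) n i = occ S n (Sum.inl i) := by
  unfold occ
  refine sum_congr rfl (fun t _ => sum_congr rfl (fun k _ => ?_))
  simp only [restrictA_eq_some]
  congr

theorem total_eq (S : Schedule W I.Msg) (n : ℕ) :
    total I.prob I.bcost S n = total I.pA I.cA (I.restrictA S) n + I.totalB S n := by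
  unfold total totalB
  rw [Fintype.sum_sum_type, Fintype.sum_sigma]
  simp only [occ_restrictA, Broadcasts, restrictA_eq_some]
  rfl

theorem prob_nonneg (i : I.Msg) : 0 ≤ I.prob i := by
  rcases i with i | i
  · exact I.pA_nonneg i
  · exact (I.pB_pos i.1).le

theorem bcost_nonneg (i : I.Msg) : 0 ≤ I.bcost i := by
  rcases i with i | i
  · exact I.cA_nonneg i
  · exact I.cB_nonneg i.1

theorem sum_prob_eq_one : ∑ i, I.prob i = 1 := by
  rw [Fintype.sum_sum_type, Fintype.sum_sigma, ← I.sum_prob]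
  simp [prob]

/-- Every request waits half a slot on average, and the probabilities sum to `1`. This makes it
possible to charge the fixed broadcast cost of the lumps to the total. -/
theorem half_le_total (S : Schedule W I.Msg) (n : ℕ) :
    (n : ℝ) / 2 ≤ total I.prob I.bcost S n := by
  calc (n : ℝ) / 2 = ∑ i, I.prob i * ((n : ℝ) / 2) := by
        rw [← sum_mul, sum_prob_eq_one, one_mul]
    _ ≤ _ := by
        unfold total
        apply sum_le_sum
        intro i _
        have h1 : (n : ℝ) ≤ pairs (fun u => Broadcasts S u i) n := by
          exact_mod_cast le_pairs _ n
        have h2 := mul_le_mul_of_nonneg_left h1 (I.prob_nonneg i)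
        have h3 : 0 ≤ I.bcost i * occ S n i :=
          mul_nonneg (I.bcost_nonneg i) (Nat.cast_nonneg _)
        linarith

theorem totalB_nonneg (S : Schedule W I.Msg) (n : ℕ) : 0 ≤ I.totalB S n := by
  apply sum_nonneg; intro j _; apply sum_nonneg; intro k _
  have := I.pB_pos j
  have := I.cB_nonneg j
  positivity

theorem sum_occ_add_le (S : Schedule W I.Msg) (n : ℕ) :
    ∑ i, occ (I.restrictA S) n i + ∑ j, ∑ k, occ S n (Sum.inr ⟨j, k⟩) ≤ W * n := by
  have h := sum_occ_le S n
  rw [Fintype.sum_sum_type, Fintype.sum_sigma] at h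
  simpa only [occ_restrictA] using h

/-- The relaxation bounds from below what any schedule pays for the messages of `B`. -/
theorem lb_le_totalB (S : Schedule W I.Msg) {n : ℕ} (hn : 0 < n) {f β : ℝ} (hf : 1 ≤ f)
    (hβ : ((∑ j, ∑ k, occ S n (Sum.inr ⟨j, k⟩) + ∑ j, I.g j : ℕ) : ℝ) ≤ f * n * (β * W)) :
    I.lb W β ≤ f / n * (I.totalB S n + ∑ j, I.cB j * I.g j) := by
  have hnr : (0 : ℝ) < n := by exact_mod_cast hn
  have hf0 : 0 < f := by linarith
  set D : Fin I.q → ℝ := fun j => ∑ k, ((occ S n (Sum.inr ⟨j, k⟩) : ℝ) + 1) with hD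
  have hDe : ∀ j, D j = ∑ k, (occ S n (Sum.inr ⟨j, k⟩) : ℝ) + I.g j := by
    intro j
    simp only [D]
    rw [sum_add_distrib, sum_const, card_univ, Fintype.card_fin, nsmul_eq_mul, mul_one]
  have hDpos : ∀ j, 0 < D j := by
    intro j
    rw [hDe]
    have : (0 : ℝ) < I.g j := by exact_mod_cast I.g_pos j
    have : (0 : ℝ) ≤ ∑ k, (occ S n (Sum.inr ⟨j, k⟩) : ℝ) := sum_nonneg (fun _ _ => Nat.cast_nonneg _)
    linarith
  -- The mean intervals of the schedule, stretched by `f`. The `+ 1` per message in `D` is the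
  -- number of classes exceeding the number of broadcasts.
  have hfeas : (fun j => f * n / D j) ∈ I.lbFeasible W β := by
    refine ⟨fun j => div_pos (by positivity) (hDpos j), ?_⟩
    simp only [one_div_div]
    rw [← sum_div, div_le_iff₀ (by positivity), sum_congr rfl (fun j _ => hDe j), sum_add_distrib]
    push_cast at hβ
    linarith
  refine (I.lb_le hfeas).trans ?_
  unfold lbObj totalB
  rw [← sum_add_distrib, mul_sum]
  apply sum_le_sum
  intro j _
  -- Cauchy-Schwarz over the messages of a group: sharing the broadcasts equally is best.
  have hsed := sq_sum_div_le_sum_sq_div univ (fun _ : Fin (I.g j) => (1 : ℝ))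
    (g := fun k => (occ S n (Sum.inr ⟨j, k⟩) : ℝ) + 1) (fun _ _ => by positivity)
  simp only [sum_const, card_univ, Fintype.card_fin, nsmul_eq_mul, mul_one, one_pow] at hsed
  change (I.g j : ℝ) ^ 2 / D j ≤ _ at hsed
  have h1 : (n : ℝ) ^ 2 * ((I.g j : ℝ) ^ 2 / D j) ≤
      ∑ k, (pairs (fun u => Broadcasts S u (Sum.inr ⟨j, k⟩)) n : ℝ) := by
    refine (mul_le_mul_of_nonneg_left hsed (by positivity)).trans ?_
    rw [mul_sum]
    exact sum_le_sum (fun k _ => sq_div_le_pairs S n _)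
  have hp := I.pB_pos j
  have hc := I.cB_nonneg j
  rw [sum_add_distrib, ← mul_sum, ← mul_sum, ← sum_div, add_assoc, mul_add]
  apply add_le_add
  · calc I.pB j * (I.g j : ℝ) ^ 2 * (f * n / D j) / 2
        = f / n * (I.pB j * ((n : ℝ) ^ 2 * ((I.g j : ℝ) ^ 2 / D j) / 2)) := by
          field_simp
      _ ≤ _ := by gcongr
  · have e : I.cB j * ∑ k, (occ S n (Sum.inr ⟨j, k⟩) : ℝ) + I.cB j * I.g j = I.cB j * D j := by
      rw [hDe]; ring
    rw [e, div_div_eq_mul_div, div_mul_eq_mul_div]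
    have h0 : 0 ≤ I.cB j * D j := mul_nonneg hc (hDpos j).le
    rw [div_le_div_iff₀ (by positivity) hnr]
    nlinarith [mul_nonneg h0 hnr.le, mul_le_mul hf hf zero_le_one hf0.le]

end Input

end DataBroadcast

end

noncomputable section

namespace DataBroadcast

open Finset

/-! ### The parameters -/

/-- Since `1 + 4 / ε ≥ 29 > e ^ 3`, the logarithm is at least `3`, and `120 = 40 * 3`. -/
theorem le_boundT {ε C : ℝ} (hε₀ : 0 < ε) (hε : ε < 1 / 7) :
    120 * max C 1 / ε ^ 4 ≤ boundT C ε := by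
  have h1 : 29 ≤ 1 + 4 / ε := by
    have : 28 ≤ 4 / ε := by rw [le_div_iff₀ hε₀]; linarith
    linarith
  have h2 : 3 ≤ Real.log (1 + 4 / ε) := by
    rw [Real.le_log_iff_exp_le (by linarith)]
    refine le_trans ?_ h1
    have h3 : Real.exp 3 = Real.exp 1 ^ 3 := by rw [← Real.exp_nat_mul]; norm_num
    rw [h3]
    calc Real.exp 1 ^ 3 ≤ 2.7182818286 ^ 3 := by
          gcongr
          exact Real.exp_one_lt_d9.le
      _ ≤ 29 := by norm_num
  unfold boundT
  have hM : 0 < max C 1 := lt_of_lt_of_le one_pos (le_max_right _ _)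
  rw [mul_div_right_comm]
  apply mul_le_mul_of_nonneg_right _ hM.le
  have h4 : 0 < 1 - ε / 6 := by linarith
  have h5 : ε ^ 4 * (1 - ε / 6) ≤ ε ^ 4 := mul_le_of_le_one_right (by positivity) (by linarith)
  calc 120 / ε ^ 4 ≤ 120 / (ε ^ 4 * (1 - ε / 6)) := by gcongr
    _ ≤ _ := by gcongr; linarith

/-- The difference between `120` and `119` pays for rounding the period bound down. -/
theorem le_periodBound {ε C : ℝ} {a : ℕ} (hε₀ : 0 < ε) (hε : ε < 1 / 7) (ha : 1 ≤ a) :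
    119 * max C 1 * (a : ℝ) ^ 2 ≤ ε ^ 4 * periodBound C ε a := by
  have h1 := le_boundT (C := C) hε₀ hε
  have h2 := Nat.lt_floor_add_one (boundT C ε * (a : ℝ) ^ 2)
  have har : (1 : ℝ) ≤ a := by exact_mod_cast ha
  have ha2 : (1 : ℝ) ≤ (a : ℝ) ^ 2 := one_le_pow₀ har
  have hM : 1 ≤ max C 1 := le_max_right _ _
  rw [div_le_iff₀ (by positivity)] at h1
  have h3 := mul_le_mul_of_nonneg_right h1 (by positivity : (0 : ℝ) ≤ (a : ℝ) ^ 2)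
  have h4 : ε ^ 4 ≤ 1 := pow_le_one₀ hε₀.le (by linarith)
  have h5 := mul_lt_mul_of_pos_left h2 (by positivity : (0 : ℝ) < ε ^ 4)
  have h6 : 1 ≤ max C 1 * (a : ℝ) ^ 2 := by nlinarith
  unfold periodBound
  linarith

/-- The length `r * h + s` of the windows, and the numbers of inserted slots and blocks. -/
theorem exists_parameters {ε C : ℝ} {a : ℕ} (hε₀ : 0 < ε) (hε : ε < 1 / 7) (ha : 1 ≤ a) :
    ∃ h r s : ℕ, 0 < h ∧ s < r ∧
      r * (h + 1) + s + a = periodBound C ε a / (h + 1) ∧ 1 ≤ ε * h ∧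
      (a : ℝ) + 1 ≤ ε / 10 * (r * h + s : ℕ) ∧
      (1 + 1 / (ε / 2)) * (3 * ((a : ℝ) + 1) ^ 2) ≤ ε / 20 * (r * (h + 1) + s : ℕ) ∧
      ((h + 1 : ℕ) : ℝ) * (a * max C 1) ≤ ε / 200 * periodBound C ε a := by
  have hN := le_periodBound (C := C) hε₀ hε ha
  set N := periodBound C ε a
  have har : (1 : ℝ) ≤ a := by exact_mod_cast ha
  have haa : (a : ℝ) ≤ (a : ℝ) ^ 2 := by nlinarith
  have hM : 1 ≤ max C 1 := le_max_right _ _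
  -- With `h` about `1 / ε`, one inserted slot per `h` slots lengthens a window by a factor of about
  -- `1 + ε`.
  set h := ⌈1 / ε⌉₊ with hh
  have hh1 : 1 / ε ≤ h := Nat.le_ceil _
  have hh2 : (h : ℝ) < 1 / ε + 1 := Nat.ceil_lt_add_one (by positivity)
  rw [div_le_iff₀ hε₀] at hh1
  have hKε : ((h : ℝ) + 1) * ε ≤ 9 / 7 := by
    have := mul_lt_mul_of_pos_right hh2 hε₀
    rw [add_mul, one_div_mul_cancel hε₀.ne'] at this
    linarith
  have h8 : (7 : ℝ) < h := by nlinarith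
  have h8' : 7 < h := by exact_mod_cast h8
  have hdiv : (N : ℝ) < (h + 1) * ((N / (h + 1) : ℕ) + 1) := by
    exact_mod_cast Nat.lt_mul_div_succ N (Nat.succ_pos h)
  -- Here `91 < 119 * 7 / 9`; the difference absorbs the rounding of `N / (h + 1)` and the `a` slots
  -- of a lump.
  have hq : 91 * (a : ℝ) ^ 2 + ε ^ 3 * a ≤ ε ^ 3 * (N / (h + 1) : ℕ) := by
    have e1 : ε ^ 4 * N ≤ 9 / 7 * (ε ^ 3 * ((N / (h + 1) : ℕ) + 1)) := by
      calc ε ^ 4 * N ≤ ε ^ 4 * ((h + 1) * ((N / (h + 1) : ℕ) + 1)) := by gcongr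
        _ = ((h + 1) * ε) * (ε ^ 3 * ((N / (h + 1) : ℕ) + 1)) := by ring
        _ ≤ _ := by gcongr
    have e2 : (a : ℝ) ^ 2 ≤ max C 1 * (a : ℝ) ^ 2 := le_mul_of_one_le_left (by positivity) hM
    have e3 : ε ^ 3 ≤ 1 / 7 := by
      calc ε ^ 3 ≤ (1 / 7) ^ 3 := by gcongr
        _ ≤ _ := by norm_num
    have e4 : ε ^ 3 * a ≤ 1 / 7 * (a : ℝ) ^ 2 := by gcongr
    nlinarith
  have hε3 : 0 < ε ^ 3 := by positivity
  have haN : a ≤ N / (h + 1) := by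
    have : (a : ℝ) ≤ (N / (h + 1) : ℕ) := by
      apply le_of_mul_le_mul_left _ hε3
      nlinarith
    exact_mod_cast this
  obtain ⟨m', hm'⟩ := Nat.exists_eq_add_of_le' haN
  rw [hm'] at hq
  have hm : 91 * (a : ℝ) ^ 2 ≤ ε ^ 3 * m' := by push_cast at hq; linarith
  have hm1 : 91 ≤ ε ^ 3 * m' := by nlinarith
  have hdm := Nat.div_add_mod m' (h + 1)
  have hlt := Nat.mod_lt m' (Nat.succ_pos h)
  set r := m' / (h + 1)
  set s := m' % (h + 1)
  have hrs : r * (h + 1) + s = m' := by rw [mul_comm]; exact hdm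
  have hsr : h + 1 ≤ r := by
    rw [Nat.le_div_iff_mul_le (Nat.succ_pos h)]
    have : ((h : ℝ) + 1) * (h + 1) ≤ m' := by
      apply le_of_mul_le_mul_left _ hε3
      calc ε ^ 3 * (((h : ℝ) + 1) * (h + 1)) = ε * (((h + 1) * ε) * ((h + 1) * ε)) := by ring
        _ ≤ 1 * (9 / 7 * (9 / 7)) := by gcongr; linarith
        _ ≤ _ := by linarith
    exact_mod_cast this
  have hmm : (7 / 8 : ℝ) * m' ≤ (r * h + s : ℕ) := by
    have : 7 * m' ≤ 8 * (r * h + s) := by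
      rw [← hrs]
      nlinarith [Nat.mul_le_mul_left r h8']
    have : (7 : ℝ) * m' ≤ 8 * (r * h + s : ℕ) := by exact_mod_cast this
    linarith
  refine ⟨h, r, s, by omega, by omega, by omega, by linarith, ?_, ?_, ?_⟩
  · have e1 : ε ^ 3 * (m' : ℝ) ≤ 1 / 49 * (ε * m') := by
      have : ε ^ 2 ≤ 1 / 49 := by
        calc ε ^ 2 ≤ (1 / 7) ^ 2 := by gcongr
          _ ≤ _ := by norm_num
      calc ε ^ 3 * (m' : ℝ) = ε ^ 2 * (ε * m') := by ring
        _ ≤ _ := by gcongr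
    have e2 := mul_le_mul_of_nonneg_left hmm (by positivity : 0 ≤ ε / 10)
    linarith
  · rw [hrs]
    have e1 : (1 + 1 / (ε / 2)) * ε ≤ 15 / 7 := by
      have : (1 + 1 / (ε / 2)) * ε = ε + 2 := by field_simp
      linarith
    have e2 : ((a : ℝ) + 1) ^ 2 ≤ 4 * (a : ℝ) ^ 2 := by nlinarith
    apply le_of_mul_le_mul_right _ hε₀
    calc (1 + 1 / (ε / 2)) * (3 * ((a : ℝ) + 1) ^ 2) * ε
        = ((1 + 1 / (ε / 2)) * ε) * (3 * ((a : ℝ) + 1) ^ 2) := by ring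
      _ ≤ 15 / 7 * (3 * (4 * (a : ℝ) ^ 2)) := by gcongr
      _ ≤ 7 / 20 * (91 * (a : ℝ) ^ 2) := by nlinarith
      _ ≤ 7 / 20 * (ε ^ 3 * m') := by gcongr
      _ = 7 / 20 * ε * (ε ^ 2 * m') := by ring
      _ ≤ 1 / 20 * (ε ^ 2 * m') := by gcongr; linarith
      _ = _ := by ring
  · push_cast
    apply le_of_mul_le_mul_left _ hε3
    have e1 : ε ^ 2 ≤ 1 / 49 := by
      calc ε ^ 2 ≤ (1 / 7) ^ 2 := by gcongr
        _ ≤ _ := by norm_num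
    calc ε ^ 3 * (((h : ℝ) + 1) * (a * max C 1))
        = ε ^ 2 * ((h + 1) * ε) * (a * max C 1) := by ring
      _ ≤ 1 / 49 * (9 / 7) * ((a : ℝ) ^ 2 * max C 1) := by gcongr
      _ ≤ 1 / 200 * (119 * max C 1 * (a : ℝ) ^ 2) := by nlinarith
      _ ≤ 1 / 200 * (ε ^ 4 * N) := by gcongr
      _ = _ := by ring

end DataBroadcast

end

noncomputable section

namespace DataBroadcast

open Finset

/-! ### The choice of the density is almost as good as an optimal schedule -/

namespace Input

variable (I : Input) {W : ℕ}

/-- The first `n = Q * (r * h + s)` slots of any schedule yield a candidate for the algorithm. -/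
theorem exists_candidate (S : Schedule W I.Msg) {C ε δ : ℝ} {N h r s Q : ℕ} (hW : 1 ≤ W)
    (ha : 1 ≤ I.a) (hC : ∀ i, I.cA i ≤ C) (hε₀ : 0 < ε) (hε : ε < 1 / 7) (hh : 0 < h) (hsr : s < r)
    (hlen : r * (h + 1) + s + I.a = N / (h + 1)) (hεh : 1 ≤ ε * h)
    (h1 : (I.a : ℝ) + 1 ≤ ε / 10 * (r * h + s : ℕ))
    (h2 : (1 + 1 / (ε / 2)) * (3 * ((I.a : ℝ) + 1) ^ 2) ≤ ε / 20 * (r * (h + 1) + s : ℕ))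
    (h3 : ((h + 1 : ℕ) : ℝ) * (I.a * C) ≤ ε / 200 * N)
    (hQ : 0 < Q) (hQB : (h + 1) * ∑ j, I.g j ≤ Q) (hδ₀ : 0 ≤ δ)
    (hδ : (∑ j, I.cB j * I.g j) / (Q * (r * h + s) : ℕ) ≤ δ) :
    ∃ x : ℕ, 1 ≤ x ∧ x < W * N ∧ ∃ S' : Schedule W (Fin I.a),
      IsPeriodicWithDensity N ((x : ℝ) / (W * N)) S' ∧
      cost I.pA I.cA S' + ENNReal.ofReal (I.lb W (1 - (x : ℝ) / (W * N))) ≤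
        ENNReal.ofReal ((1 + 3 * ε) *
          (total I.prob I.bcost S (Q * (r * h + s)) / (Q * (r * h + s) : ℕ)) + 2 * δ) := by
  have hKN : (h + 1) * (r * (h + 1) + s + I.a) ≤ N := by
    rw [hlen]; exact Nat.mul_div_le _ _
  have hNK : N < (h + 1) * (r * (h + 1) + s + I.a + 1) := by
    rw [hlen]; exact Nat.lt_mul_div_succ _ (Nat.succ_pos h)
  have hN : 0 < N := lt_of_lt_of_le (by positivity) hKN
  have hr : 0 < r := by omega
  have hm0 : 0 < r * h + s := by positivity
  obtain ⟨S', hper, hcost, hpos, hdens⟩ := exists_periodic_schedule (I.restrictA S)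
    I.pA_nonneg I.cA_nonneg hC ha hW hN (Nat.succ_pos h) hlen hh hQ (half_pos hε₀) h2
  have hcap := I.sum_occ_add_le S (Q * (r * h + s))
  have htot := I.half_le_total S (Q * (r * h + s))
  have hAB := I.total_eq S (Q * (r * h + s))
  have hB0 := I.totalB_nonneg S (Q * (r * h + s))
  have hA0 := total_nonneg I.pA_nonneg I.cA_nonneg (I.restrictA S) (Q * (r * h + s))
  have hdensity : IsPeriodicWithDensity N (((∑ i, occ S' N i : ℕ) : ℝ) / (W * N)) S' :=
    ⟨N, hN, le_rfl, hper, finDensity_eq S' N⟩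
  have hlbgen := fun hn f β => I.lb_le_totalB S (n := Q * (r * h + s)) hn (f := f) (β := β)
  set D := ∑ i, occ S' N i
  set OA := ∑ i, occ (I.restrictA S) (Q * (r * h + s)) i
  set OB := ∑ j, ∑ k, occ S (Q * (r * h + s)) (Sum.inr ⟨j, k⟩)
  set GB := ∑ j, I.g j
  set A := total I.pA I.cA (I.restrictA S) (Q * (r * h + s))
  set B := I.totalB S (Q * (r * h + s))
  set n := Q * (r * h + s) with hn
  have hnpos : 0 < n := Nat.mul_pos hQ hm0
  set m := r * h + s with hm
  have hmr : r * (h + 1) + s = m + r := by rw [hm]; ring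
  have hnr : (n : ℝ) = Q * m := by rw [hn]; push_cast; rfl
  set GC := ∑ j, I.cB j * I.g j
  clear_value D OA OB GB GC A B n m
  rw [hmr] at hKN hNK
  have hWr : (1 : ℝ) ≤ W := by exact_mod_cast hW
  have hQr : (0 : ℝ) < Q := by exact_mod_cast hQ
  have hNr : (0 : ℝ) < N := by exact_mod_cast hN
  have hhr : (0 : ℝ) < h := by exact_mod_cast hh
  have hmpos : (0 : ℝ) < m := by exact_mod_cast hm0
  have hnrpos : (0 : ℝ) < n := by exact_mod_cast hnpos
  -- Because `s < r`, the `(h + 1) * r` inserted time slots are at least `m + 1`. They cover the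
  -- occupancy error `W * m` of the mixture and leave one slot in reserve.
  have hslack : W * ((h + 1) * m) + 1 + W * m + (h + 1) * I.a ≤ W * N := by
    have e1 : m + 1 ≤ (h + 1) * r := by rw [hm]; nlinarith only [hsr]
    have e2 := Nat.mul_le_mul_left W hKN
    have e3 := Nat.mul_le_mul_left W e1
    have e4 : (h + 1) * I.a ≤ W * ((h + 1) * I.a) := Nat.le_mul_of_pos_left _ hW
    nlinarith only [e2, e3, e4, hW]
  have hslackr : (W : ℝ) * ((h + 1) * m) + 1 + W * m + (h + 1) * I.a ≤ W * N := by
    exact_mod_cast hslack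
  have hcapr : (OA : ℝ) + OB ≤ W * (Q * m) := by rw [← hnr]; exact_mod_cast hcap
  have hOB0 : (0 : ℝ) ≤ OB := Nat.cast_nonneg _
  push_cast at hdens
  have hOAQ : (OA : ℝ) / Q ≤ W * m := by
    rw [div_le_iff₀ hQr]; linarith
  have hDlt : (D : ℝ) < W * N := by
    have := mul_le_mul_of_nonneg_left hOAQ (by positivity : (0 : ℝ) ≤ h + 1)
    linarith
  refine ⟨D, hpos, by exact_mod_cast hDlt, S', hdensity, ?_⟩
  -- `f` is the ratio of the new period to the original length of the `h + 1` windows in it.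
  set f : ℝ := N / ((h + 1) * m) with hf
  have hKm : (0 : ℝ) < (h + 1) * m := by positivity
  have hf1 : 1 ≤ f := by
    rw [hf, one_le_div hKm]
    have : (h + 1) * m ≤ N := le_trans (Nat.mul_le_mul_left _ (by omega)) hKN
    exact_mod_cast this
  have hf2 : f ≤ 1 + 11 / 10 * ε := by
    have e1 : (N : ℝ) ≤ (h + 1) * (m + r + I.a + 1) := by exact_mod_cast hNK.le
    rw [hf, div_le_iff₀ hKm]
    have e2 : (r : ℝ) ≤ ε * m := by
      have : (r : ℝ) * h ≤ m := by rw [hm]; push_cast; linarith only [Nat.cast_nonneg (α := ℝ) s]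
      calc (r : ℝ) = r * 1 := (mul_one _).symm
        _ ≤ r * (ε * h) := by gcongr
        _ = ε * (r * h) := by ring
        _ ≤ ε * m := by gcongr
    calc (N : ℝ) ≤ (h + 1) * (m + r + I.a + 1) := e1
      _ ≤ (h + 1) * ((1 + 11 / 10 * ε) * m) := by gcongr; linarith only [e2, h1]
      _ = _ := by ring
  have hlb : I.lb W (1 - (D : ℝ) / (W * N)) ≤ f / n * (B + GC) := by
    apply hlbgen hnpos _ _ hf1
    have e1 : (1 - (D : ℝ) / (W * N)) * W = W - D / N := by field_simp
    rw [e1]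
    have e2 : f * n * (W - D / N) = Q / (h + 1) * (W * N - D) := by
      rw [hf, hnr]; field_simp
    rw [e2, Nat.cast_add]
    -- The slot in reserve, counted `Q` times, pays for the `+ 1` per message of `B` in
    -- `lb_le_totalB`.
    have e3 : ((h : ℝ) + 1) * GB ≤ Q := by exact_mod_cast hQB
    rw [div_mul_eq_mul_div, le_div_iff₀ (by positivity)]
    have e4 := mul_le_mul_of_nonneg_left hdens hQr.le
    have e5 : (Q : ℝ) * ((h + 1) * (OA / Q) + W * m + (h + 1) * I.a) =
        (h + 1) * OA + Q * (W * m + (h + 1) * I.a) := by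
      field_simp; ring
    rw [e5] at e4
    have e6 := mul_le_mul_of_nonneg_left hslackr hQr.le
    have e7 := mul_le_mul_of_nonneg_left hcapr (by positivity : (0 : ℝ) ≤ h + 1)
    linarith
  have hlb' : I.lb W (1 - (D : ℝ) / (W * N)) ≤ (1 + 11 / 10 * ε) * (B / n) + 2 * δ := by
    refine hlb.trans ?_
    have e1 : f / n * (B + GC) = f * (B / n + GC / n) := by
      ring
    rw [e1]
    have e2 : 0 ≤ B / n := div_nonneg hB0 hnrpos.le
    calc f * (B / n + GC / n) ≤ f * (B / n + δ) := by gcongr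
      _ ≤ (1 + 11 / 10 * ε) * (B / n + δ) := by gcongr
      _ ≤ _ := by
        have : 11 / 10 * ε * δ ≤ 1 * δ := by gcongr; linarith only [hε]
        linarith only [this]
  -- Part of the loss `(h + 3) / h` is regained, since the larger total is averaged over at least
  -- `(h + 1) * (m + r)` slots instead of `(h + 1) * m`.
  have hwin : ((h + 1 : ℕ) : ℝ) * ((h + 3) / (h * Q) * A) / N ≤ (1 + 2 * ε) * (A / n) := by
    have e1 : ((h : ℝ) + 1) * (m + r) ≤ N := by
      have : (h + 1) * (m + r) ≤ N := le_trans (Nat.mul_le_mul_left _ (by omega)) hKN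
      exact_mod_cast this
    have e2 : (m : ℝ) * (h + 2) ≤ (m + r) * (h + 1) := by
      have : m * (h + 2) ≤ (m + r) * (h + 1) := by rw [hm]; nlinarith only [hsr]
      exact_mod_cast this
    have e3 : ((h : ℝ) + 1) * (h + 3) * m ≤ (1 + 2 * ε) * h * N := by
      have g1 : ((h : ℝ) + 1) * (h + 3) ≤ (h + 2) * (h + 2) := by linarith only []
      have g2 : (h : ℝ) + 2 ≤ (1 + 2 * ε) * h := by linarith
      calc ((h : ℝ) + 1) * (h + 3) * m ≤ (h + 2) * (h + 2) * m := by gcongr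
        _ = (h + 2) * (m * (h + 2)) := by ring
        _ ≤ (1 + 2 * ε) * h * ((m + r) * (h + 1)) := by gcongr
        _ ≤ (1 + 2 * ε) * h * N := by
            gcongr
            linarith
    have e4 : ((h + 1 : ℕ) : ℝ) * ((h + 3) / (h * Q) * A) / N =
        ((h + 1) * (h + 3) * m / (h * N)) * (A / n) := by
      rw [hnr]; push_cast; field_simp
    rw [e4]
    apply mul_le_mul_of_nonneg_right _ (div_nonneg hA0 hnrpos.le)
    rw [div_le_iff₀ (by positivity)]
    linarith
  have hcostA : cost I.pA I.cA S' ≤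
      ENNReal.ofReal ((1 + 28 / 10 * ε) * (A / n) + ε / 200) := by
    refine hcost.trans (ENNReal.ofReal_le_ofReal ?_)
    rw [add_div, mul_div_assoc]
    apply add_le_add
    · calc (1 + ε / 2 + ε / 20) * (((h + 1 : ℕ) : ℝ) * ((h + 3) / (h * Q) * A) / N)
          ≤ (1 + ε / 2 + ε / 20) * ((1 + 2 * ε) * (A / n)) := by gcongr
        _ = ((1 + ε / 2 + ε / 20) * (1 + 2 * ε)) * (A / n) := by ring
        _ ≤ _ := by
          apply mul_le_mul_of_nonneg_right _ (div_nonneg hA0 hnrpos.le)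
          nlinarith only [hε₀, hε]
    · rw [div_le_iff₀ hNr]; exact h3
  refine (add_le_add hcostA (ENNReal.ofReal_le_ofReal hlb')).trans ?_
  have hAn : 0 ≤ A / n := div_nonneg hA0 hnrpos.le
  have hBn : 0 ≤ B / n := div_nonneg hB0 hnrpos.le
  rw [← ENNReal.ofReal_add (by positivity) (by positivity)]
  apply ENNReal.ofReal_le_ofReal
  rw [hAB] at htot ⊢
  -- The gap between `28 / 10` and `3` absorbs the lump cost `ε / 200`, as the mean cost is at least
  -- `1 / 2`.
  have hhalf : 1 / 2 ≤ A / n + B / n := by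
    rw [← add_div, le_div_iff₀ hnrpos]
    linarith
  rw [add_div]
  linarith only [mul_nonneg hε₀.le hAn, mul_nonneg hε₀.le hBn, mul_le_mul_of_nonneg_left hhalf hε₀.le]

end Input

/-- All long prefixes of `S` cost at most `L + δ` in the mean, and the candidate made from one of
them competes in steps 1 and 2 of the algorithm. -/
theorem Phase1.cost_add_lb_le {I : Input} {W : ℕ} {ε C : ℝ} (hW : 1 ≤ W) (hε₀ : 0 < ε)
    (hε : ε < 1 / 7) (ha : 1 ≤ I.a) (hC : ∀ i, I.cA i ≤ C)
    (R : Phase1 I W (periodBound C ε I.a)) (S : Schedule W I.Msg) {L δ : ℝ} (hL : 0 ≤ L)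
    (hS : cost I.prob I.bcost S ≤ ENNReal.ofReal L) (hδ : 0 < δ) :
    cost I.pA I.cA R.schedA + ENNReal.ofReal (I.lb W (1 - R.α₀)) ≤
      ENNReal.ofReal ((1 + 3 * ε) * (L + δ) + 2 * δ) := by
  obtain ⟨h, r, s, hh, hsr, hlen, hεh, h1, h2, h3⟩ := exists_parameters (C := C) hε₀ hε ha
  have hm : 0 < r * h + s := by
    have : 0 < r := by omega
    positivity
  have hev : ∀ᶠ n : ℕ in Filter.atTop,
      ENNReal.ofReal (finERT I.prob S n + finBC I.bcost S n) < ENNReal.ofReal (L + δ) := by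
    exact Filter.eventually_lt_of_limsup_lt
      (hS.trans_lt ((ENNReal.ofReal_lt_ofReal_iff (by linarith)).2 (by linarith)))
  have hlim : Filter.Tendsto (fun Q : ℕ => Q * (r * h + s)) Filter.atTop Filter.atTop :=
    Filter.tendsto_id.atTop_mul_const' hm
  have hc0 : ∀ᶠ n : ℕ in Filter.atTop, (∑ j, I.cB j * I.g j) / (n : ℝ) ≤ δ :=
    (tendsto_const_div_atTop_nhds_zero_nat _).eventually_le_const hδ
  obtain ⟨Q, hQ1, hQ2, hQ3⟩ := ((hlim.eventually hev).and ((hlim.eventually hc0).and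
    (Filter.eventually_ge_atTop ((h + 1) * ∑ j, I.g j + 1)))).exists
  have h3' : ((h + 1 : ℕ) : ℝ) * (I.a * C) ≤ ε / 200 * periodBound C ε I.a := by
    refine le_trans ?_ h3
    gcongr
    exact le_max_left _ _
  obtain ⟨x, hx1, hx2, S', hS'1, hS'2⟩ := I.exists_candidate S hW ha hC hε₀ hε hh hsr hlen hεh
    h1 h2 h3' (by omega) (by omega) hδ.le hQ2
  refine (R.x₀_best x hx1 hx2).trans ?_
  refine (add_le_add ((R.sched_optimal x hx1 hx2).2 S' hS'1) le_rfl).trans (hS'2.trans ?_)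
  apply ENNReal.ofReal_le_ofReal
  rw [fin_cost_eq, ENNReal.ofReal_lt_ofReal_iff (by linarith)] at hQ1
  gcongr

theorem Phase1.expectedCost_le_mul_cost {I : Input} {W : ℕ} {ε C : ℝ} (hW : 1 ≤ W) (hε₀ : 0 < ε)
    (hε : ε < 1 / 7) (ha : 1 ≤ I.a) (hC : ∀ i, I.cA i ≤ C)
    (hB : ∀ j, kappa W C ε * (I.a : ℝ) ^ 2 ≤ I.g j)
    (R : Phase1 I W (periodBound C ε I.a)) (S : Schedule W I.Msg) :
    R.expectedCost ≤ ENNReal.ofReal (1 + 5 * ε) * cost I.prob I.bcost S := by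
  rcases eq_or_ne (cost I.prob I.bcost S) ⊤ with htop | htop
  · rw [htop, ENNReal.mul_top (by simpa using by linarith)]
    exact le_top
  have har : (1 : ℝ) ≤ I.a := by exact_mod_cast ha
  have hWr : (1 : ℝ) ≤ W := by exact_mod_cast hW
  -- The definition of `kappa` gives `2 * N * W ≤ ε * g`; as `ε * g ≥ 240`, the summand `1` fits
  -- into another `ε * g / 10`.
  have hg : ∀ j, 2 * (periodBound C ε I.a : ℝ) * W + 1 ≤ (11 / 10 * ε) * I.g j := by
    intro j
    have hT := le_boundT (C := C) hε₀ hε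
    have hT1 : 120 ≤ boundT C ε := by
      refine le_trans ?_ hT
      rw [le_div_iff₀ (by positivity)]
      have : ε ^ 4 ≤ 1 := pow_le_one₀ hε₀.le (by linarith)
      have : 1 ≤ max C 1 := le_max_right _ _
      linarith
    have hTa : 120 ≤ boundT C ε * (I.a : ℝ) ^ 2 := by
      have : (1 : ℝ) ≤ (I.a : ℝ) ^ 2 := one_le_pow₀ har
      nlinarith
    have hfl : (periodBound C ε I.a : ℝ) ≤ boundT C ε * (I.a : ℝ) ^ 2 :=
      Nat.floor_le (by linarith)
    have h1 := mul_le_mul_of_nonneg_left (hB j) hε₀.le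
    have h2 : ε * (kappa W C ε * (I.a : ℝ) ^ 2) = 2 * (W * (boundT C ε * (I.a : ℝ) ^ 2)) := by
      unfold kappa; field_simp
    rw [h2] at h1
    have h3 := mul_le_mul_of_nonneg_right hfl (zero_le_one.trans hWr)
    have h4 : boundT C ε * (I.a : ℝ) ^ 2 ≤ W * (boundT C ε * (I.a : ℝ) ^ 2) :=
      le_mul_of_one_le_left (by linarith) hWr
    linarith
  set L := (cost I.prob I.bcost S).toReal with hL
  have hL0 : 0 ≤ L := ENNReal.toReal_nonneg
  have hcL : cost I.prob I.bcost S = ENNReal.ofReal L := (ENNReal.ofReal_toReal htop).symm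
  rw [hcL, ← ENNReal.ofReal_mul (by linarith)]
  apply ENNReal.le_of_forall_pos_le_add
  intro δ hδ _
  have hδ' : (0 : ℝ) < δ := hδ
  have hmain := R.cost_add_lb_le hW hε₀ hε ha hC S hL0 hcL.le (δ := δ / 6) (by positivity)
  calc R.expectedCost ≤ cost I.pA I.cA R.schedA +
        ENNReal.ofReal ((1 + 11 / 10 * ε) * I.lb W (1 - R.α₀)) := R.expectedCost_le hg
    _ ≤ ENNReal.ofReal (1 + 11 / 10 * ε) *
        (cost I.pA I.cA R.schedA + ENNReal.ofReal (I.lb W (1 - R.α₀))) := by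
        rw [mul_add, ENNReal.ofReal_mul (by linarith)]
        gcongr
        exact le_mul_of_one_le_left zero_le (ENNReal.one_le_ofReal.2 (by linarith))
    _ ≤ ENNReal.ofReal (1 + 11 / 10 * ε) *
        ENNReal.ofReal ((1 + 3 * ε) * (L + δ / 6) + 2 * (δ / 6)) := by gcongr
    _ ≤ ENNReal.ofReal ((1 + 5 * ε) * L + δ) := by
        rw [← ENNReal.ofReal_mul (by linarith)]
        apply ENNReal.ofReal_le_ofReal
        have e1 : (1 + 11 / 10 * ε) * (1 + 3 * ε) ≤ 1 + 5 * ε := by nlinarith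
        have e2 := mul_le_mul_of_nonneg_right e1 hL0
        have e3 := mul_le_mul_of_nonneg_right e1 hδ'.le
        nlinarith
    _ = _ := by
        rw [ENNReal.ofReal_add (by positivity) hδ'.le, ENNReal.ofReal_coe_nnreal]

end DataBroadcast

end

theorem mainTheorem3 (I : DataBroadcast.Input) (W : ℕ) (hW : 1 ≤ W) (ε C : ℝ)
    (hε₀ : 0 < ε) (hε : ε < 1 / 7)
    (hA : 1 ≤ I.a) (hC : ∀ i, I.cA i ≤ C)
    (hB : ∀ j, DataBroadcast.kappa W C ε * (I.a : ℝ) ^ 2 ≤ (I.g j : ℝ)) :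
    Nonempty (DataBroadcast.Phase1 I W (DataBroadcast.periodBound C ε I.a)) ∧
      ∀ R : DataBroadcast.Phase1 I W (DataBroadcast.periodBound C ε I.a),
        R.expectedCost ≤
          ENNReal.ofReal (1 + 5 * ε) * DataBroadcast.opt W I.prob I.bcost := by
  constructor
  · apply DataBroadcast.nonempty_phase1 I hA
    have h1 := DataBroadcast.le_periodBound (C := C) hε₀ hε hA
    have h2 : 2 ≤ DataBroadcast.periodBound C ε I.a := by
      have hM : 1 ≤ max C 1 := le_max_right _ _
      have ha : (1 : ℝ) ≤ (I.a : ℝ) ^ 2 := one_le_pow₀ (by exact_mod_cast hA)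
      have h3 : ε ^ 4 ≤ 1 := pow_le_one₀ hε₀.le (by linarith)
      have h4 : ε ^ 4 * DataBroadcast.periodBound C ε I.a ≤ DataBroadcast.periodBound C ε I.a :=
        mul_le_of_le_one_left (Nat.cast_nonneg _) h3
      have h5 : (2 : ℝ) ≤ DataBroadcast.periodBound C ε I.a := by nlinarith
      exact_mod_cast h5
    nlinarith
  · intro R
    rw [DataBroadcast.opt, ENNReal.mul_iInf_of_ne
      (by simpa using by linarith) ENNReal.ofReal_ne_top]
    exact le_iInf (fun S => R.expectedCost_le_mul_cost hW hε₀ hε hA hC hB S)
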